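/- The model of computation is the word RAM: a machine with finitely many registers, random access memory, and unit-cost instructions (constants, $+,-,\cdot$ modulo $2^w$, integer quotient and remainder, comparisons, loads, stores, branches and loops) on words of $w$ bits; time is the number of steps. A finite field $\mathbb{F}$ of size $q=p^e$ is represented as $\mathbb{F}_p[z]/(E(z))$ with $E$ monic irreducible of degree $e$ over $\mathbb{F}_p$, $p$ prime, and the field element $\sum_{j<e}x_jz^j$ with $x_j\in\{0,\dots,p-1\}$ is stored as the number $\sum_{j<e}x_jp^j$. **Theorem.** There are a deterministic word RAM program and constants $c,C,k\in\mathbb{N}$ such that the following holds. Let $\mathbb{F}$ be a finite field of size $q$, represented as above, let $m,N\in\mathbb{N}$, and let $d,\tilde d$ be positive integers such that $\tilde d\in[0.8d,d]$ and $\tilde d-1$ divides $q-1$. Let $f\in\mathbb{F}[x_1,\dots,x_m]$ be a homogeneous polynomial of degree less than $d$ in every variable, let $\mathbf{a}_1,\dots,\mathbf{a}_N\in\mathbb{F}^m$, and let the word length satisfy $2^w\ge(q+m+d+d^m+N)^c$. Given $p$, $e$, $d$, $\tilde d$, $m$, $N$, the coefficients of $E$, the vector of the $d^m$ coefficients of $f$,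 and the points $\mathbf{a}_1,\dots,\mathbf{a}_N$, the program outputs $f(\mathbf{a}_1),\dots,f(\mathbf{a}_N)$ in time at most $$(d^m+N)\cdot C^m\cdot (q+m+d)^k,$$ that is, in time $(d^m+N)\cdot\Theta(1)^m\cdot\mathrm{poly}(q,m,d)$. -/

import Mathlib

/-! ## A random access machine with words of `w` bits and a step count -/

namespace WordRAM

/-- Arithmetic operations of the machine on words. -/
inductive Op where
  | add | sub | mul | div | mod | lt | eq

/-- Value of an operation on two words of `w` bits. Addition, subtraction and multiplication are
modulo `2 ^ w`, `div` and `mod` are quotient and remainder (division by zero gives the quotient `0`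
and leaves the dividend as remainder), the comparisons return `1` for true and `0` for false. -/
def Op.eval (w : ℕ) : Op → ℕ → ℕ → ℕ
  | .add, x, y => (x + y) % 2 ^ w
  | .sub, x, y => (x + (2 ^ w - y)) % 2 ^ w
  | .mul, x, y => (x * y) % 2 ^ w
  | .div, x, y => x / y
  | .mod, x, y => x % y
  | .lt, x, y => if x < y then 1 else 0
  | .eq, x, y => if x = y then 1 else 0

/-- Programs. Every program mentions finitely many registers, which are named by numbers. -/
inductive Prog where
  /-- do nothing -/
  | skip : Prog
  /-- `const r n` sets register `r` to the literal `n` (modulo `2 ^ w`) -/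
  | const (r n : ℕ) : Prog
  /-- `arith o r x y` sets register `r` to the value of `o` on registers `x` and `y` -/
  | arith (o : Op) (r x y : ℕ) : Prog
  /-- `load r x` copies into register `r` the memory cell whose address is in register `x` -/
  | load (r x : ℕ) : Prog
  /-- `store x r` copies register `r` into the memory cell whose address is in register `x` -/
  | store (x r : ℕ) : Prog
  /-- run two programs one after the other -/
  | seq (P Q : Prog) : Prog
  /-- `ite r P Q` runs `P` if register `r` is nonzero, and `Q` otherwise -/
  | ite (r : ℕ) (P Q : Prog) : Prog
  /-- `loop r P` repeats `P` as long as register `r` is nonzero -/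
  | loop (r : ℕ) (P : Prog) : Prog

/-- A configuration: contents of the registers and of the memory cells. -/
structure State where
  reg : ℕ → ℕ
  mem : ℕ → ℕ

/-- Initial configuration: the words of the input stand in the memory cells `0, 1, 2, …`, all other
cells and all registers contain `0`. -/
def State.init (w : ℕ) (input : List ℕ) : State where
  reg := fun _ => 0
  mem := fun i => input.getD i 0 % 2 ^ w

/-- `Exec w P s t s'`: on words of `w` bits, the program `P`, started in configuration `s`, halts in
configuration `s'` after exactly `t` steps. Every instruction and every test is one step. -/
inductive Exec (w : ℕ) : Prog → State → ℕ → State → Prop where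
  | skip (s : State) : Exec w .skip s 1 s
  | const (r n : ℕ) (s : State) :
      Exec w (.const r n) s 1 { s with reg := Function.update s.reg r (n % 2 ^ w) }
  | arith (o : Op) (r x y : ℕ) (s : State) :
      Exec w (.arith o r x y) s 1
        { s with reg := Function.update s.reg r (o.eval w (s.reg x) (s.reg y)) }
  | load (r x : ℕ) (s : State) :
      Exec w (.load r x) s 1 { s with reg := Function.update s.reg r (s.mem (s.reg x)) }
  | store (x r : ℕ) (s : State) :
      Exec w (.store x r) s 1 { s with mem := Function.update s.mem (s.reg x) (s.reg r) }
  | seq {P Q : Prog} {s s₁ s₂ : State} {t₁ t₂ : ℕ} :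
      Exec w P s t₁ s₁ → Exec w Q s₁ t₂ s₂ → Exec w (.seq P Q) s (t₁ + t₂) s₂
  | ite_true {r : ℕ} {P Q : Prog} {s s₁ : State} {t : ℕ} :
      s.reg r ≠ 0 → Exec w P s t s₁ → Exec w (.ite r P Q) s (1 + t) s₁
  | ite_false {r : ℕ} {P Q : Prog} {s s₁ : State} {t : ℕ} :
      s.reg r = 0 → Exec w Q s t s₁ → Exec w (.ite r P Q) s (1 + t) s₁
  | loop_true {r : ℕ} {P : Prog} {s s₁ s₂ : State} {t₁ t₂ : ℕ} :
      s.reg r ≠ 0 → Exec w P s t₁ s₁ → Exec w (.loop r P) s₁ t₂ s₂ →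
        Exec w (.loop r P) s (1 + t₁ + t₂) s₂
  | loop_false {r : ℕ} {P : Prog} {s : State} :
      s.reg r = 0 → Exec w (.loop r P) s 1 s

/-- The machine is deterministic: the result and the number of steps are determined by the start. -/
theorem Exec.deterministic {w : ℕ} {P : Prog} {s s₁ s₂ : State} {t₁ t₂ : ℕ}
    (h₁ : Exec w P s t₁ s₁) (h₂ : Exec w P s t₂ s₂) : t₁ = t₂ ∧ s₁ = s₂ := by
  induction h₁ generalizing t₂ s₂ with
  | skip s => cases h₂; exact ⟨rfl, rfl⟩
  | const r n s => cases h₂; exact ⟨rfl, rfl⟩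
  | arith o r x y s => cases h₂; exact ⟨rfl, rfl⟩
  | load r x s => cases h₂; exact ⟨rfl, rfl⟩
  | store x r s => cases h₂; exact ⟨rfl, rfl⟩
  | seq _ _ ih₁ ih₂ =>
    cases h₂ with
    | seq a b =>
      obtain ⟨rfl, rfl⟩ := ih₁ a
      obtain ⟨rfl, rfl⟩ := ih₂ b
      exact ⟨rfl, rfl⟩
  | ite_true h _ ih =>
    cases h₂ with
    | ite_true _ a => obtain ⟨rfl, rfl⟩ := ih a; exact ⟨rfl, rfl⟩
    | ite_false h' _ => exact absurd h' h
  | ite_false h _ ih =>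
    cases h₂ with
    | ite_true h' _ => exact absurd h h'
    | ite_false _ a => obtain ⟨rfl, rfl⟩ := ih a; exact ⟨rfl, rfl⟩
  | loop_true h _ _ ih₁ ih₂ =>
    cases h₂ with
    | loop_true _ a b =>
      obtain ⟨rfl, rfl⟩ := ih₁ a
      obtain ⟨rfl, rfl⟩ := ih₂ b
      exact ⟨rfl, rfl⟩
    | loop_false h' => exact absurd h' h
  | loop_false h =>
    cases h₂ with
    | loop_true h' _ _ => exact absurd h h'
    | loop_false _ => exact ⟨rfl, rfl⟩

end WordRAM

/-! ## Instances of multivariate multipoint evaluation as lists of words -/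

namespace MME

/-- The word for an element `x` of a finite field `F` that is represented as `𝔽_p[z] / (E)`: if
`x = x₀ + x₁ z + ⋯ + x_{e-1} z^{e-1}` modulo `E`, where `e = deg E` and `x_j ∈ {0, …, p - 1}`, it is
the number `x₀ + x₁ p + ⋯ + x_{e-1} p^{e-1} < p^e`. -/
noncomputable def encode {p : ℕ} {E : Polynomial (ZMod p)} (hE : E.Monic)
    {F : Type*} [Field F] (θ : AdjoinRoot E ≃+* F) (x : F) : ℕ :=
  ∑ j ∈ Finset.range E.natDegree,
    ((AdjoinRoot.modByMonicHom hE (θ.symm x)).coeff j).val * p ^ j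

/-- The exponent vector with number `k < d ^ m` among those in `{0, …, d - 1}^m`: its entries are
the base-`d` digits of `k`. -/
noncomputable def exponent (d m k : ℕ) : Fin m →₀ ℕ :=
  Finsupp.equivFunOnFinite.symm fun i => k / d ^ (i : ℕ) % d

/-- The input: the numbers `p`, `e = deg E`, `d`, `d'`, `m`, `N`, the `e` lower coefficients of the
monic polynomial `E`, the `d ^ m` coefficients of `f`, and the `m` coordinates of each of the `N`
points. -/
noncomputable def input {p : ℕ} {E : Polynomial (ZMod p)} (hE : E.Monic)
    {F : Type*} [Field F] (θ : AdjoinRoot E ≃+* F) (d d' m N : ℕ)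
    (f : MvPolynomial (Fin m) F) (a : Fin N → Fin m → F) : List ℕ :=
  [p, E.natDegree, d, d', m, N]
    ++ (List.range E.natDegree).map (fun j => (E.coeff j).val)
    ++ (List.range (d ^ m)).map (fun k => encode hE θ (f.coeff (exponent d m k)))
    ++ (List.ofFn fun i : Fin N => List.ofFn fun l : Fin m => encode hE θ (a i l)).flatten

end MME

set_option linter.constructorNameAsVariable false
set_option linter.unusedSimpArgs false

/-! Evaluation at arbitrary points is traded for evaluation of f and of its Hasse derivatives on a
small fixed grid. Put n = (q-1)/(d'-1) and b = -(d'-1). Then n·b = -(q-1) = 1 in F. For c in F let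
g_c(X) = (1 + b c X)^n - 1. It vanishes at 0 and has linear coefficient n b c = c. Its values at the
elements of F lie in {y - 1 : y = 0 or y^(d'-1) = 1}, a set of at most d' ≤ d elements
(`card_base_le`). So for every point a, the curve (g_{a_1}, …, g_{a_m}) takes all its values over F
in one grid of at most d^m points. If f is homogeneous of degree D, then P = f(g_{a_1}, …, g_{a_m})
has no terms below X^D, its coefficient at X^D is f(a), and for f ≠ 0 its degree is at most nD ≤
2m(q-1), because D ≤ m(d-1) ≤ 2m(d'-1).

This degree is too large for P to be determined by its q values, but expansions of P to order s = 2m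
around all λ in F suffice (`sum_weight`). They are taken along λt, where t is a power series with
(1+X) t^(q-1) = 1 modulo X^(s+1); in characteristic p such a t is an explicit power of 1+X
(`one_add_X_mul_root_pow`). With an exponent e congruent to -D modulo q-1, the sum of λ^(e+i) over λ
removes every degree i that is not D + l(q-1). At these degrees the weights leave the coefficient of
X^s in (1+X)^(s-l), which is 1 for l = 0 and 0 for 1 ≤ l ≤ s.

The expansion of P at λt comes from the Hasse derivatives of f of order at most 2m at a grid point.
Their index vectors are coded by bit strings of length 3m with exactly m zeros: runs of ones are the
entries, and one further entry takes up the slack (`sum_parse`, `sum_parse_taylor`). This gives the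
factor 8^m = 2^(3m). For each index vector the derivative is evaluated on the whole grid one
coordinate at a time (`evalS_run`, `partialEval_succ`), with d^m·poly operations; then each pair of
a point and a λ costs poly more (`localS_run`). `sum_grid` and `sum_term` assemble the identity,
which yields -f(a); the last pass of the program changes the sign.

The program is written in a small language of bounded loops over variables and arrays, whose
semantics is a plain function, so correctness is proved by loop invariants and syntactic frames.
Sizes and running time are bounded by monomials in S = q+m+d, Z = 2^m and Y = d^m+N, computed from
the program text and checked by evaluation (`evaluationS_ok`, `evaluationS_time`). `Stmt.prog_runs`
transfers everything to the word RAM. -/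

namespace ForLang

/-! ## A language of bounded loops over arrays -/

/-- Names of the variables. -/
inductive Var where
  | p | e | d | d' | m | N | q | X | r | L | B | oF | oP | ne | n | b | D | i | j | k | l | u | x
  | y | z | acc | c | cnt | lam | X₁ | bc | rest | pt | idx | bits
deriving DecidableEq

/-- Names of the arrays. -/
inductive Arr where
  | inp | add | mulz | mul | U | T | V | W | tmp | del | val | om | mark | rank | xs | pt
  | al | H | H' | out
deriving DecidableEq

/-- Binary operations on natural numbers; `guard x y` is `x` if `x < y`, and `0` otherwise. -/
inductive BinOp where
  | add | sub | mul | div | mod | lt | eq | guard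

/-- Value of a binary operation. -/
def BinOp.eval : BinOp → ℕ → ℕ → ℕ
  | .add, x, y => x + y
  | .sub, x, y => x - y
  | .mul, x, y => x * y
  | .div, x, y => x / y
  | .mod, x, y => x % y
  | .lt, x, y => if x < y then 1 else 0
  | .eq, x, y => if x = y then 1 else 0
  | .guard, x, y => if x < y then x else 0

/-- Expressions. -/
inductive Expr where
  | num (n : ℕ) : Expr
  | var (x : Var) : Expr
  | get (A : Arr) (i : Expr) : Expr
  | op (o : BinOp) (a b : Expr) : Expr

instance : Coe Var Expr := ⟨.var⟩
instance (n : ℕ) : OfNat Expr n := ⟨.num n⟩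
instance : Add Expr := ⟨.op .add⟩
instance : Sub Expr := ⟨.op .sub⟩
instance : Mul Expr := ⟨.op .mul⟩
instance : Div Expr := ⟨.op .div⟩
instance : Mod Expr := ⟨.op .mod⟩

/-- Statements. An assignment carries a flag that says whether its bound has to be justified by the
actual values (`true`) or follows from the bounds of the variables (`false`). -/
inductive Stmt where
  | skip : Stmt
  | assign (dyn : Bool) (x : Var) (a : Expr) : Stmt
  | store (A : Arr) (i a : Expr) : Stmt
  | seq (P Q : Stmt) : Stmt
  | ite (c : Expr) (P Q : Stmt) : Stmt
  | loop (x : Var) (n : Expr) (P : Stmt) : Stmt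

/-- A configuration: values of the variables and contents of the arrays. -/
structure St where
  v : Var → ℕ
  a : Arr → ℕ → ℕ

/-- Assignment to a variable. -/
def St.setv (s : St) (x : Var) (n : ℕ) : St := { s with v := Function.update s.v x n }

/-- Assignment to a cell of an array. -/
def St.seta (s : St) (A : Arr) (i n : ℕ) : St :=
  { s with a := Function.update s.a A (Function.update (s.a A) i n) }

/-- Value of an expression. -/
def Expr.eval (s : St) : Expr → ℕ
  | num n => n
  | var x => s.v x
  | get A i => s.a A (i.eval s)
  | op o a b => o.eval (a.eval s) (b.eval s)

/-- Iteration of a family of functions. -/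
def iter {α : Type*} (f : ℕ → α → α) (s : α) : ℕ → α
  | 0 => s
  | n + 1 => f n (iter f s n)

/-- The configuration after the run of a statement. -/
def Stmt.run : Stmt → St → St
  | skip, s => s
  | assign _ x a, s => s.setv x (a.eval s)
  | store A i a, s => s.seta A (i.eval s) (a.eval s)
  | seq P Q, s => Q.run (P.run s)
  | ite c P Q, s => if c.eval s ≠ 0 then P.run s else Q.run s
  | .loop x n P, s => iter (fun i s' => P.run (s'.setv x i)) s (n.eval s)

section Simp
variable (s : St) (a b : Expr)
@[simp] theorem St.setv_v (x : Var) (n : ℕ) (y : Var) :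
    (s.setv x n).v y = if y = x then n else s.v y := by
  simp [St.setv, Function.update_apply]
@[simp] theorem St.setv_a (x : Var) (n : ℕ) : (s.setv x n).a = s.a := rfl
@[simp] theorem St.seta_v (A : Arr) (i n : ℕ) : (s.seta A i n).v = s.v := rfl
@[simp] theorem St.seta_a (A : Arr) (i n : ℕ) (A' : Arr) (i' : ℕ) :
    (s.seta A i n).a A' i' = if A' = A ∧ i' = i then n else s.a A' i' := by
  by_cases h : A' = A
  · subst h; simp [St.seta, Function.update_apply]
  · simp [St.seta, h]
@[simp] theorem Expr.eval_num (n : ℕ) : (Expr.num n).eval s = n := rfl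
@[simp] theorem Expr.eval_zero : (0 : Expr).eval s = 0 := rfl
@[simp] theorem Expr.eval_one : (1 : Expr).eval s = 1 := rfl
@[simp] theorem Expr.eval_six : (6 : Expr).eval s = 6 := rfl
@[simp] theorem Expr.eval_two : (2 : Expr).eval s = 2 := rfl
@[simp] theorem Expr.eval_var (x : Var) : (Expr.var x).eval s = s.v x := rfl
@[simp] theorem Expr.eval_get (A : Arr) : (Expr.get A a).eval s = s.a A (a.eval s) := rfl
@[simp] theorem Expr.eval_add : (a + b).eval s = a.eval s + b.eval s := rfl
@[simp] theorem Expr.eval_sub : (a - b).eval s = a.eval s - b.eval s := rfl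
@[simp] theorem Expr.eval_mul : (a * b).eval s = a.eval s * b.eval s := rfl
@[simp] theorem Expr.eval_div : (a / b).eval s = a.eval s / b.eval s := rfl
@[simp] theorem Expr.eval_mod : (a % b).eval s = a.eval s % b.eval s := rfl
@[simp] theorem Expr.eval_lt :
    (Expr.op .lt a b).eval s = if a.eval s < b.eval s then 1 else 0 := rfl
@[simp] theorem Expr.eval_eq :
    (Expr.op .eq a b).eval s = if a.eval s = b.eval s then 1 else 0 := rfl
@[simp] theorem Expr.eval_guard :
    (Expr.op .guard a b).eval s = if a.eval s < b.eval s then a.eval s else 0 := rfl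
variable (P Q : Stmt)
@[simp] theorem Stmt.run_skip : Stmt.skip.run s = s := rfl
@[simp] theorem Stmt.run_assign (f : Bool) (x : Var) :
    (Stmt.assign f x a).run s = s.setv x (a.eval s) := rfl
@[simp] theorem Stmt.run_store (A : Arr) :
    (Stmt.store A a b).run s = s.seta A (a.eval s) (b.eval s) := rfl
@[simp] theorem Stmt.run_seq : (Stmt.seq P Q).run s = Q.run (P.run s) := rfl
@[simp] theorem Stmt.run_ite :
    (Stmt.ite a P Q).run s = if a.eval s ≠ 0 then P.run s else Q.run s := rfl
theorem Stmt.run_for (x : Var) : (Stmt.loop x a P).run s =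
    iter (fun i s' => P.run (s'.setv x i)) s (a.eval s) := rfl
end Simp

/-! ### Frames -/

/-- Whether a statement may change a variable. -/
def Stmt.modv (y : Var) : Stmt → Bool
  | skip => false
  | assign _ x _ => y = x
  | store _ _ _ => false
  | seq P Q => P.modv y || Q.modv y
  | ite _ P Q => P.modv y || Q.modv y
  | .loop x _ P => y = x || P.modv y

/-- Whether a statement may change an array. -/
def Stmt.moda (A : Arr) : Stmt → Bool
  | skip => false
  | assign _ _ _ => false
  | store A' _ _ => A = A'
  | seq P Q => P.moda A || Q.moda A
  | ite _ P Q => P.moda A || Q.moda A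
  | .loop _ _ P => P.moda A

/-- The test is purely syntactic, so for the concrete program fragments below its hypothesis is
closed by `rfl`. -/
theorem Stmt.run_v {y : Var} : ∀ (P : Stmt) (s : St), P.modv y = false → (P.run s).v y = s.v y
  | skip, s, _ => rfl
  | assign _ x a, s, h => by simp [modv] at h; simp [h]
  | store _ _ _, s, h => rfl
  | seq P Q, s, h => by
    simp [modv] at h; rw [run_seq, run_v Q _ h.2, run_v P _ h.1]
  | ite c P Q, s, h => by
    simp [modv] at h; rw [run_ite]; split_ifs
    exacts [run_v P _ h.1, run_v Q _ h.2]
  | .loop x n P, s, h => by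
    simp [modv] at h; rw [run_for]
    induction n.eval s with
    | zero => rfl
    | succ k ih => rw [iter, run_v P _ h.2]; simp [h.1, ih]

theorem Stmt.run_a {A : Arr} : ∀ (P : Stmt) (s : St), P.moda A = false → (P.run s).a A = s.a A
  | skip, s, _ => rfl
  | assign _ x a, s, h => rfl
  | store _ _ _, s, h => by simp [moda] at h; ext; simp [h]
  | seq P Q, s, h => by
    simp [moda] at h; rw [run_seq, run_a Q _ h.2, run_a P _ h.1]
  | ite c P Q, s, h => by
    simp [moda] at h; rw [run_ite]; split_ifs
    exacts [run_a P _ h.1, run_a Q _ h.2]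
  | .loop x n P, s, h => by
    simp [moda] at h; rw [run_for]
    induction n.eval s with
    | zero => rfl
    | succ k ih => rw [iter, run_a P _ h, St.setv_a, ih]

/-- Two configurations agree outside of what the statement `P` may change. -/
structure Stmt.Frame (P : Stmt) (s s' : St) : Prop where
  v : ∀ y, P.modv y = false → s'.v y = s.v y
  a : ∀ A, P.moda A = false → s'.a A = s.a A

theorem Stmt.frame (P : Stmt) (s : St) : P.Frame s (P.run s) :=
  ⟨fun _ h => P.run_v s h, fun _ h => P.run_a s h⟩

/-- Rule for loops: an invariant, with the frame of the loop at hand in every round. -/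
theorem Stmt.for_ind {x : Var} {n : Expr} {P : Stmt} {s : St} (I : ℕ → St → Prop) (h₀ : I 0 s)
    (h : ∀ i < n.eval s, ∀ s', (Stmt.loop x n P).Frame s s' → I i s' →
      I (i + 1) (P.run (s'.setv x i))) : I (n.eval s) ((Stmt.loop x n P).run s) := by
  rw [run_for]
  suffices H : ∀ k ≤ n.eval s, (Stmt.loop x n P).Frame s
      (iter (fun i s' => P.run (s'.setv x i)) s k) ∧
      I k (iter (fun i s' => P.run (s'.setv x i)) s k) from (H _ le_rfl).2
  intro k hk
  induction k with
  | zero => exact ⟨⟨fun _ _ => rfl, fun _ _ => rfl⟩, h₀⟩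
  | succ k ih =>
    obtain ⟨hF, hI⟩ := ih (by omega)
    refine ⟨⟨fun y hy => ?_, fun A hA => ?_⟩, h k (by omega) _ hF hI⟩
    · have := hF.v y hy
      simp only [modv, Bool.or_eq_false_iff, decide_eq_false_iff_not] at hy
      rw [iter, run_v _ _ hy.2]; simp [hy.1, this]
    · have := hF.a A hA
      simp only [moda] at hA
      rw [iter, run_a _ _ hA, St.setv_a, this]

/-- Rule for loops that fill an array cell by cell. -/
theorem Stmt.for_fill {x : Var} {n : Expr} {P : Stmt} {s : St} (A : Arr) (g : ℕ → ℕ)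
    (h : ∀ i < n.eval s, ∀ s', (Stmt.loop x n P).Frame s s' → (∀ k < i, s'.a A k = g k) →
      (P.run (s'.setv x i)).a A i = g i ∧
      ∀ k < i, (P.run (s'.setv x i)).a A k = s'.a A k) :
    ∀ k < n.eval s, ((Stmt.loop x n P).run s).a A k = g k := by
  refine Stmt.for_ind (I := fun i s' => ∀ k < i, s'.a A k = g k) (by simp) ?_
  intro i hi s' hF hI k hk
  obtain ⟨h1, h2⟩ := h i hi s' hF hI
  rcases Nat.lt_succ_iff_lt_or_eq.1 hk with hk | rfl
  · rw [h2 k hk, hI k hk]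
  · exact h1

/-! ### Static bounds -/

/-- Exponents of a monomial in the three size parameters of an instance. -/
structure Lv where
  l : ℕ
  z : ℕ
  y : ℕ

/-- Comparison of the exponents. -/
def Lv.le (a b : Lv) : Bool := a.l ≤ b.l && a.z ≤ b.z && a.y ≤ b.y
/-- Exponents of a bound for a sum. -/
def Lv.add (a b : Lv) : Lv := ⟨max a.l b.l + 1, max a.z b.z, max a.y b.y⟩
/-- Exponents of a product. -/
def Lv.mul (a b : Lv) : Lv := ⟨a.l + b.l, a.z + b.z, a.y + b.y⟩
/-- Exponents of a bound for a constant. -/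
def Lv.num (n : ℕ) : Lv := ⟨n, 0, 0⟩

/-- The three size parameters. -/
structure Size where
  S : ℕ
  Z : ℕ
  Y : ℕ
  hS : 2 ≤ S
  hZ : 1 ≤ Z
  hY : 1 ≤ Y

/-- Value of a monomial. -/
def Lv.val (σ : Size) (a : Lv) : ℕ := σ.S ^ a.l * σ.Z ^ a.z * σ.Y ^ a.y

section Val
variable {σ : Size} {a b : Lv}
theorem Lv.val_mono (h : a.le b = true) : a.val σ ≤ b.val σ := by
  simp only [le, Bool.and_eq_true, decide_eq_true_eq] at h
  have := σ.hS; have := σ.hZ; have := σ.hY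
  unfold val
  gcongr <;> omega
theorem Lv.val_mul : (a.mul b).val σ = a.val σ * b.val σ := by
  simp only [val, mul, pow_add]; ring
-- Both summands are at most the monomial with the larger exponents, and one further factor S ≥ 2
-- pays for doubling it.
theorem Lv.val_add : a.val σ + b.val σ ≤ (a.add b).val σ := by
  let u : Lv := ⟨max a.l b.l, max a.z b.z, max a.y b.y⟩
  have h1 : a.val σ ≤ u.val σ := Lv.val_mono (by simp [Lv.le, u])
  have h2 : b.val σ ≤ u.val σ := Lv.val_mono (by simp [Lv.le, u])
  have h3 : (a.add b).val σ = u.val σ * σ.S := by simp only [val, add, u, pow_succ]; ring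
  have := σ.hS
  nlinarith
theorem Lv.val_pos : 1 ≤ a.val σ := by
  have := σ.hS; have := σ.hZ; have := σ.hY
  have : 0 < a.val σ := by unfold val; positivity
  exact this
theorem Lv.le_val_num (n : ℕ) : n ≤ (Lv.num n).val σ := by
  have := σ.hS
  have : n < σ.S ^ n := Nat.lt_pow_self (by omega)
  simp [val, num]; omega
end Val

/-- Bounds for all variables and all arrays. -/
structure Bounds where
  v : Var → Lv
  a : Arr → Lv

variable (β : Bounds)

/-- Bound for the value of an expression. -/
def Expr.lv : Expr → Lv
  | num n => .num n
  | var x => β.v x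
  | get A _ => β.a A
  | op .add a b => a.lv.add b.lv
  | op .sub a _ => a.lv
  | op .mul a b => a.lv.mul b.lv
  | op .div a _ => a.lv
  | op .mod a _ => a.lv
  | op .lt _ _ => .num 0
  | op .eq _ _ => .num 0
  -- A guarded value inherits the bound of the second operand whatever the first one is. This gives
  -- static bounds to quantities that grow inside loops; correctness proofs show that the guard
  -- never cuts anything off.
  | op .guard _ b => b.lv

/-- All intermediate values stay below the bound `top`. -/
def Expr.ok (top : Lv) : Expr → Bool
  | num n => (Lv.num n).le top
  | var x => (β.v x).le top
  | get A i => i.ok top && (i.lv β).le top && (β.a A).le top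
  | op o a b => a.ok top && b.ok top && (Expr.lv β (op o a b)).le top

/-- Number of machine steps for an expression. -/
def Expr.time : Expr → ℕ
  | num _ => 1
  | var _ => 2
  | get _ i => i.time + 4
  | op _ a b => a.time + b.time + 3

/-- The bounds are respected by a statement. -/
def Stmt.ok (top : Lv) : Stmt → Bool
  | skip => true
  | assign f x a => a.ok β top && (f || (a.lv β).le (β.v x))
  | store A i a => i.ok β top && (i.lv β).le top && a.ok β top && (a.lv β).le (β.a A)
  | seq P Q => P.ok top && Q.ok top
  | ite c P Q => c.ok β top && P.ok top && Q.ok top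
  | .loop x n P => n.ok β top && (n.lv β).le (β.v x) && (n.lv β).le top && P.ok top

/-- Bound for the number of machine steps of a statement. -/
def Stmt.time : Stmt → Lv
  | skip => .num 1
  | assign _ _ a => .num (a.time + 2)
  | store _ i a => .num (i.time + a.time + 4)
  | seq P Q => P.time.add Q.time
  | ite c P Q => (Lv.num (c.time + 1)).add (P.time.add Q.time)
  | .loop _ n P => (Lv.num (n.time + 6)).add ((n.lv β).mul ((Lv.num 6).add P.time))

/-- No assignment needs a justification by actual values. -/
def Stmt.static : Stmt → Bool
  | skip => true
  | assign f _ _ => !f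
  | store _ _ _ => true
  | seq P Q => P.static && Q.static
  | ite _ P Q => P.static && Q.static
  | .loop _ _ P => P.static

variable (σ : Size)

/-- The flagged assignments respect the bounds in a run of the statement. -/
def Stmt.Dyn : Stmt → St → Prop
  | assign true x a, s => a.eval s ≤ (β.v x).val σ
  | seq P Q, s => P.Dyn s ∧ Q.Dyn (P.run s)
  -- Both branches are required regardless of the test. Nothing is lost: the only flagged
  -- assignments of the program are in `paramS`, which does not branch.
  | ite _ P Q, s => P.Dyn s ∧ Q.Dyn s
  | .loop x n P, s => ∀ i < n.eval s,
      P.Dyn ((iter (fun i s' => P.run (s'.setv x i)) s i).setv x i)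
  | _, _ => True

/-- The configuration respects the bounds. -/
structure St.Bdd (s : St) : Prop where
  v : ∀ x, s.v x ≤ (β.v x).val σ
  a : ∀ A i, s.a A i ≤ (β.a A).val σ

variable {β σ}

theorem Stmt.dyn_of_static : ∀ (P : Stmt) (s : St), P.static = true → P.Dyn β σ s
  | skip, _, _ => trivial
  | assign false _ _, _, _ => trivial
  | assign true _ _, _, h => by simp [static] at h
  | store _ _ _, _, _ => trivial
  | seq P Q, s, h => by
    simp only [static, Bool.and_eq_true] at h
    exact ⟨dyn_of_static P _ h.1, dyn_of_static Q _ h.2⟩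
  | ite _ P Q, s, h => by
    simp only [static, Bool.and_eq_true] at h
    exact ⟨dyn_of_static P _ h.1, dyn_of_static Q _ h.2⟩
  | .loop x n P, s, h => fun i _ => dyn_of_static P _ h

theorem Expr.eval_le {s : St} (hs : s.Bdd β σ) : ∀ a : Expr, a.eval s ≤ (a.lv β).val σ
  | num n => Lv.le_val_num n
  | var x => hs.v x
  | get A i => hs.a A _
  | op .add a b => (Nat.add_le_add (eval_le hs a) (eval_le hs b)).trans Lv.val_add
  | op .sub a _ => (Nat.sub_le _ _).trans (eval_le hs a)
  | op .mul a b => (Nat.mul_le_mul (eval_le hs a) (eval_le hs b)).trans Lv.val_mul.ge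
  | op .div a _ => (Nat.div_le_self _ _).trans (eval_le hs a)
  | op .mod a _ => (Nat.mod_le _ _).trans (eval_le hs a)
  | op .lt a b => by
    rw [eval_lt]; split_ifs
    · exact Lv.val_pos
    · exact Nat.zero_le _
  | op .eq a b => by
    rw [eval_eq]; split_ifs
    · exact Lv.val_pos
    · exact Nat.zero_le _
  | op .guard a b => by
    rw [eval_guard]; split_ifs with h
    · exact h.le.trans (eval_le hs b)
    · exact Nat.zero_le _

theorem St.Bdd.setv {s : St} (hs : s.Bdd β σ) {x : Var} {n : ℕ} (h : n ≤ (β.v x).val σ) :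
    (s.setv x n).Bdd β σ := by
  refine ⟨fun y => ?_, hs.a⟩
  rw [St.setv_v]; split_ifs with hy
  · rw [hy]; exact h
  · exact hs.v y

theorem St.Bdd.seta {s : St} (hs : s.Bdd β σ) {A : Arr} {i n : ℕ} (h : n ≤ (β.a A).val σ) :
    (s.seta A i n).Bdd β σ := by
  refine ⟨hs.v, fun A' i' => ?_⟩
  rw [St.seta_a]; split_ifs with hy
  · rw [hy.1]; exact h
  · exact hs.a _ _

end ForLang

namespace ForLang
open WordRAM

/-! ### Compilation to the word RAM -/

/-- `Runs w P σ n Q`: the program halts within `n` steps in a configuration that satisfies `Q`. -/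
def Runs (w : ℕ) (P : Prog) (σ : State) (n : ℕ) (Q : State → Prop) : Prop :=
  ∃ t σ', Exec w P σ t σ' ∧ t ≤ n ∧ Q σ'

section Runs
variable {w : ℕ} {P P' : Prog} {σ : State} {n n' : ℕ} {Q Q' : State → Prop}

theorem Runs.seq (h : Runs w P σ n Q') (h' : ∀ σ', Q' σ' → Runs w P' σ' n' Q) :
    Runs w (.seq P P') σ (n + n') Q := by
  obtain ⟨t, σ', h1, h2, h3⟩ := h
  obtain ⟨t', σ'', h1', h2', h3'⟩ := h' σ' h3
  exact ⟨_, _, .seq h1 h1', by omega, h3'⟩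

theorem Runs.mono (h : Runs w P σ n Q') (hn : n ≤ n') (hQ : ∀ σ', Q' σ' → Q σ') :
    Runs w P σ n' Q := by
  obtain ⟨t, σ', h1, h2, h3⟩ := h
  exact ⟨t, σ', h1, h2.trans hn, hQ _ h3⟩

theorem Runs.const (r c : ℕ)
    (h : Q { σ with reg := Function.update σ.reg r (c % 2 ^ w) }) : Runs w (.const r c) σ 1 Q :=
  ⟨_, _, .const r c σ, le_rfl, h⟩

theorem Runs.arith (o : Op) (r x y : ℕ)
    (h : Q { σ with reg := Function.update σ.reg r (o.eval w (σ.reg x) (σ.reg y)) }) :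
    Runs w (.arith o r x y) σ 1 Q :=
  ⟨_, _, .arith o r x y σ, le_rfl, h⟩

theorem Runs.load (r x : ℕ)
    (h : Q { σ with reg := Function.update σ.reg r (σ.mem (σ.reg x)) }) :
    Runs w (.load r x) σ 1 Q :=
  ⟨_, _, .load r x σ, le_rfl, h⟩

theorem Runs.store (x r : ℕ)
    (h : Q { σ with mem := Function.update σ.mem (σ.reg x) (σ.reg r) }) :
    Runs w (.store x r) σ 1 Q :=
  ⟨_, _, .store x r σ, le_rfl, h⟩

theorem Runs.skip (h : Q σ) : Runs w .skip σ 1 Q := ⟨_, _, .skip σ, le_rfl, h⟩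

end Runs

/-- Register of a variable. -/
def Var.reg (x : Var) : ℕ := 3 * x.ctorIdx

/-- Register for temporary values. -/
def tmpReg (k : ℕ) : ℕ := 3 * k + 1

/-- Register for the control of loops; number `0` holds the size of an array. -/
def ctlReg (k : ℕ) : ℕ := 3 * k + 2

/-- The residue of a register number modulo 3 tells variables, temporaries and loop control apart;
within the class of variables the constructor number decides. -/
theorem Var.reg_inj {x y : Var} : x.reg = y.reg ↔ x = y := by
  refine ⟨fun h => ?_, fun h => h ▸ rfl⟩
  have h : x.ctorIdx = y.ctorIdx := by unfold Var.reg at h; omega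
  rw [← Var.ofNat_ctorIdx x, h, Var.ofNat_ctorIdx]

/-- Code for an operation with operands in the temporary registers `k` and `k + 1`. -/
def BinOp.comp (k : ℕ) : BinOp → Prog
  | .add => .arith .add (tmpReg k) (tmpReg k) (tmpReg (k + 1))
  | .mul => .arith .mul (tmpReg k) (tmpReg k) (tmpReg (k + 1))
  | .div => .arith .div (tmpReg k) (tmpReg k) (tmpReg (k + 1))
  | .mod => .arith .mod (tmpReg k) (tmpReg k) (tmpReg (k + 1))
  | .lt => .arith .lt (tmpReg k) (tmpReg k) (tmpReg (k + 1))
  | .eq => .arith .eq (tmpReg k) (tmpReg k) (tmpReg (k + 1))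
  -- Machine subtraction wraps around. Multiplying by the truth value of `y < x` turns it into
  -- truncated subtraction.
  | .sub => .seq (.arith .lt (tmpReg (k + 2)) (tmpReg (k + 1)) (tmpReg k))
      (.seq (.arith .sub (tmpReg k) (tmpReg k) (tmpReg (k + 1)))
        (.arith .mul (tmpReg k) (tmpReg k) (tmpReg (k + 2))))
  | .guard => .seq (.arith .lt (tmpReg (k + 1)) (tmpReg k) (tmpReg (k + 1)))
      (.arith .mul (tmpReg k) (tmpReg k) (tmpReg (k + 1)))

/-- Code that turns an index into the address of a cell. -/
def Arr.comp (A : Arr) (k : ℕ) : Prog :=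
  .seq (.const (tmpReg (k + 1)) A.ctorIdx)
    (.seq (.arith .mul (tmpReg (k + 1)) (tmpReg (k + 1)) (ctlReg 0))
      (.arith .add (tmpReg k) (tmpReg k) (tmpReg (k + 1))))

/-- Code for an expression, with the result in the temporary register `k`. -/
def Expr.comp : ℕ → Expr → Prog
  | k, num n => .const (tmpReg k) n
  -- There is no move instruction, so a register is copied by adding it to 0.
  | k, var x => .seq (.const (tmpReg k) 0) (.arith .add (tmpReg k) (tmpReg k) x.reg)
  | k, get A i => .seq (i.comp k) (.seq (A.comp k) (.load (tmpReg k) (tmpReg k)))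
  | k, op o a b => .seq (a.comp k) (.seq (b.comp (k + 1)) (o.comp k))

/-- Copy of a register. -/
def copyReg (r x : ℕ) : Prog := .seq (.const r 0) (.arith .add r r x)

/-- Code for a statement inside of `h` loops. -/
def Stmt.comp : ℕ → Stmt → Prog
  | _, skip => .skip
  | _, assign _ x a => .seq (a.comp 0) (copyReg x.reg (tmpReg 0))
  | _, store A i a => .seq (i.comp 0) (.seq (A.comp 0) (.seq (a.comp 1)
      (.store (tmpReg 0) (tmpReg 1))))
  | h, seq P Q => .seq (P.comp h) (Q.comp h)
  | h, ite c P Q => .seq (c.comp 0) (.ite (tmpReg 0) (P.comp h) (Q.comp h))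
  | h, .loop x n P =>
    -- The bound is evaluated once, and the true counter lives in a control register private to the
    -- nesting depth. The body may therefore overwrite the loop variable or anything in the bound,
    -- as in the semantics by `iter`.
    .seq (n.comp 0) (.seq (copyReg (ctlReg (2 * h + 1)) (tmpReg 0))
      (.seq (.const (ctlReg (2 * h + 2)) 0)
      (.seq (.arith .lt (tmpReg 0) (ctlReg (2 * h + 2)) (ctlReg (2 * h + 1)))
      (.loop (tmpReg 0)
        (.seq (copyReg x.reg (ctlReg (2 * h + 2)))
        (.seq (P.comp (h + 1))
        (.seq (.const (tmpReg 0) 1)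
        (.seq (.arith .add (ctlReg (2 * h + 2)) (ctlReg (2 * h + 2)) (tmpReg 0))
          (.arith .lt (tmpReg 0) (ctlReg (2 * h + 2)) (ctlReg (2 * h + 1)))))))))))

/-- Number of cells of each array. -/
def cells (w : ℕ) : ℕ := (2 ^ w - 1) / 32

theorem Arr.ctorIdx_lt (A : Arr) : A.ctorIdx < 32 := by cases A <;> decide

theorem Arr.ctorIdx_inj {A A' : Arr} (h : A.ctorIdx = A'.ctorIdx) : A = A' := by
  rw [← Arr.ofNat_ctorIdx A, h, Arr.ofNat_ctorIdx]

/-- The machine configuration `σ` represents the configuration `s`. -/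
structure Rel (w : ℕ) (s : St) (σ : State) : Prop where
  v : ∀ x : Var, σ.reg x.reg = s.v x
  size : σ.reg (ctlReg 0) = cells w
  a : ∀ (A : Arr), ∀ i < cells w, σ.mem (A.ctorIdx * cells w + i) = s.a A i

theorem Arr.addr_lt {w : ℕ} (A : Arr) {i : ℕ} (hi : i < cells w) :
    A.ctorIdx * cells w + i < 2 ^ w := by
  have h1 := A.ctorIdx_lt
  have h2 : (A.ctorIdx + 1) * cells w ≤ 32 * cells w := Nat.mul_le_mul_right _ h1
  have h3 : 32 * cells w ≤ 2 ^ w - 1 := Nat.mul_div_le _ _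
  have h4 : 0 < 2 ^ w := by positivity
  rw [add_mul, one_mul] at h2
  omega

/-- Division with remainder by the segment length recovers the array and the index, so distinct
cells never share an address. -/
theorem Arr.addr_inj {w : ℕ} {A A' : Arr} {i i' : ℕ} (hi : i < cells w) (hi' : i' < cells w)
    (h : A.ctorIdx * cells w + i = A'.ctorIdx * cells w + i') : A = A' ∧ i = i' := by
  have h0 : 0 < cells w := by omega
  have h1 : A.ctorIdx = A'.ctorIdx := by
    have := congrArg (· / cells w) h
    simpa [Nat.mul_add_div, mul_comm, Nat.add_div_of_dvd_right, Nat.div_eq_of_lt, hi, hi',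
      Nat.mul_div_cancel_left _ h0, Nat.add_div_of_dvd_right (Dvd.intro_left _ rfl)] using this
  rw [h1] at h
  exact ⟨Arr.ctorIdx_inj h1, by omega⟩

/-- Only temporary registers from number `k` on differ. -/
structure SameExcept (k : ℕ) (σ σ' : State) : Prop where
  mem : σ'.mem = σ.mem
  reg : ∀ r, (∀ j, k ≤ j → r ≠ tmpReg j) → σ'.reg r = σ.reg r

theorem SameExcept.rel {w k : ℕ} {s : St} {σ σ' : State} (h : SameExcept k σ σ')
    (hR : Rel w s σ) : Rel w s σ' where
  v x := by rw [h.reg _ (fun j _ => by unfold tmpReg Var.reg; omega), hR.v]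
  size := by rw [h.reg _ (fun j _ => by unfold tmpReg ctlReg; omega), hR.size]
  a A i hi := by rw [h.mem, hR.a A i hi]

theorem SameExcept.trans {k k' : ℕ} {σ σ' σ'' : State} (h : SameExcept k σ σ')
    (h' : SameExcept k' σ' σ'') (hk : k ≤ k') : SameExcept k σ σ'' where
  mem := by rw [h'.mem, h.mem]
  reg r hr := by rw [h'.reg r (fun j hj => hr j (hk.trans hj)), h.reg r hr]

theorem SameExcept.update {k : ℕ} {σ σ' : State} (h : SameExcept k σ σ') (j n : ℕ) (hj : k ≤ j) :
    SameExcept k σ { σ' with reg := Function.update σ'.reg (tmpReg j) n } where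
  mem := h.mem
  reg r hr := by rw [← h.reg r hr]; simp [hr j hj]

theorem SameExcept.refl (k : ℕ) (σ : State) : SameExcept k σ σ := ⟨rfl, fun _ _ => rfl⟩

theorem tmpReg_inj {j k : ℕ} : tmpReg j = tmpReg k ↔ j = k := by unfold tmpReg; omega

theorem BinOp.runs {w k : ℕ} {σ : State} (o : BinOp) {x y : ℕ} (hx : x < 2 ^ w) (hy : y < 2 ^ w)
    (ho : o.eval x y < 2 ^ w) (h1 : σ.reg (tmpReg k) = x) (h2 : σ.reg (tmpReg (k + 1)) = y) :
    Runs w (o.comp k) σ 3 fun σ' => SameExcept k σ σ' ∧ σ'.reg (tmpReg k) = o.eval x y := by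
  have H := SameExcept.refl k σ
  cases o
  case sub =>
    refine (Runs.seq (n := 1) (n' := 2) (Runs.arith _ _ _ _ rfl) ?_)
    rintro _ rfl
    refine (Runs.seq (n := 1) (n' := 1) (Runs.arith _ _ _ _ rfl) ?_)
    rintro _ rfl
    refine Runs.arith _ _ _ _ ⟨((H.update _ _ (by omega)).update _ _ (by omega)).update _ _
      (by omega), ?_⟩
    simp only [Op.eval, Function.update_self, tmpReg_inj, h1, h2, Function.update_apply,
      Nat.left_eq_add, Nat.add_right_cancel_iff, Nat.add_eq_left]
    simp only [BinOp.eval]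
    by_cases h : y < x
    · have e : x + (2 ^ w - y) = 2 ^ w + (x - y) := by omega
      simp [h, e, Nat.mod_eq_of_lt (show x - y < 2 ^ w by omega)]
    · have : x - y = 0 := by omega
      simp [h, this]
  case guard =>
    refine (Runs.seq (n := 1) (n' := 2) (Runs.arith _ _ _ _ rfl) ?_)
    rintro _ rfl
    refine (Runs.arith _ _ _ _ ⟨(H.update _ _ (by omega)).update _ _
      (by omega), ?_⟩ : Runs w _ _ 1 _).mono (by omega) fun _ h => h
    simp only [Op.eval, Function.update_self, tmpReg_inj, h1, h2, Function.update_apply]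
    simp only [BinOp.eval]
    by_cases h : x < y
    · simp [h, Nat.mod_eq_of_lt hx]
    · simp [h]
  all_goals
    refine (Runs.arith _ _ _ _ ⟨H.update _ _ le_rfl, ?_⟩ : Runs w _ _ 1 _).mono (by omega) fun _ h => h
    simp only [Op.eval, Function.update_self, h1, h2]
    first | exact Nat.mod_eq_of_lt ho | rfl

theorem Arr.runs {w k : ℕ} {s : St} {σ : State} (hR : Rel w s σ) (A : Arr) {i : ℕ}
    (hi : i < cells w) (h1 : σ.reg (tmpReg k) = i) :
    Runs w (A.comp k) σ 3 fun σ' => SameExcept k σ σ' ∧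
      σ'.reg (tmpReg k) = A.ctorIdx * cells w + i := by
  have H := SameExcept.refl k σ
  have hA := A.addr_lt hi
  have e1 : A.ctorIdx < 2 ^ w := by
    refine lt_of_le_of_lt ?_ hA
    nlinarith
  refine (Runs.seq (n := 1) (n' := 2) (Runs.const _ _ rfl) ?_)
  rintro _ rfl
  refine (Runs.seq (n := 1) (n' := 1) (Runs.arith _ _ _ _ rfl) ?_)
  rintro _ rfl
  refine Runs.arith _ _ _ _ ⟨((H.update _ _ (by omega)).update _ _ (by omega)).update _ _
      (by omega), ?_⟩
  have e2 : ctlReg 0 ≠ tmpReg (k + 1) := by unfold ctlReg tmpReg; omega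
  simp only [Op.eval, Function.update_self, tmpReg_inj, h1, Function.update_apply, e2, hR.size,
      Nat.left_eq_add]
  simp only [one_ne_zero, if_false, Nat.mod_eq_of_lt e1,
    Nat.mod_eq_of_lt (lt_of_le_of_lt (Nat.le_add_right _ i) hA)]
  rw [add_comm, Nat.mod_eq_of_lt hA]

variable {β : Bounds} {S : Size} {top : Lv} {w : ℕ}

/-- Code with target `k` touches only temporaries from `k` on, so the left operand survives the
evaluation of the right one. The bound by `cells w` does double duty: intermediate values do not
overflow, and indices stay inside the segment of their array. -/
theorem Expr.runs (hw : top.val S < cells w) {s : St} (hs : s.Bdd β S) :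
    ∀ (a : Expr) (k : ℕ) (σ : State), a.ok β top = true → Rel w s σ →
      Runs w (a.comp k) σ a.time fun σ' => SameExcept k σ σ' ∧ σ'.reg (tmpReg k) = a.eval s := by
  have hc : cells w < 2 ^ w :=
    (Nat.div_le_self _ _).trans_lt (Nat.sub_lt (by positivity) one_pos)
  have hlt : ∀ a : Expr, (a.lv β).le top = true → a.eval s < 2 ^ w := fun a h =>
    (Expr.eval_le hs a).trans_lt ((Lv.val_mono h).trans_lt (hw.trans hc))
  have hlt' : ∀ a : Expr, a.ok β top = true → a.eval s < 2 ^ w := fun a h => by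
    cases a with
    | num n => exact hlt (num n) h
    | var x => exact hlt (var x) h
    | get A i =>
      simp only [ok, Bool.and_eq_true] at h
      exact hlt (get A i) h.2
    | op o a b =>
      simp only [ok, Bool.and_eq_true] at h
      exact hlt _ h.2
  intro a
  induction a with
  | num n =>
    intro k σ h hR
    refine Runs.const _ _ ⟨(SameExcept.refl k σ).update _ _ le_rfl, ?_⟩
    have := hlt' _ h
    simp only [eval_num] at this
    simp [Nat.mod_eq_of_lt this]
  | var x =>
    intro k σ h hR
    have := hlt' _ h
    simp only [eval_var] at this
    refine (Runs.seq (n := 1) (n' := 1) (Runs.const _ _ rfl) ?_)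
    rintro _ rfl
    refine Runs.arith _ _ _ _ ⟨((SameExcept.refl k σ).update _ _ le_rfl).update _ _ le_rfl, ?_⟩
    have e : x.reg ≠ tmpReg k := by unfold Var.reg tmpReg; omega
    simp [Op.eval, e, hR.v, Nat.mod_eq_of_lt this]
  | get A i ih =>
    intro k σ h hR
    simp only [ok, Bool.and_eq_true] at h
    have hi : i.eval s < cells w := (Expr.eval_le hs i).trans_lt ((Lv.val_mono h.1.2).trans_lt hw)
    refine (ih k σ h.1.1 hR).seq (n' := 4) ?_
    rintro σ₁ ⟨h1, h2⟩
    refine (Arr.runs (h1.rel hR) A hi h2).seq (n' := 1) ?_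
    rintro σ₂ ⟨h3, h4⟩
    have h5 := h1.trans h3 le_rfl
    refine Runs.load _ _ ⟨h5.update _ _ le_rfl, ?_⟩
    simp [h4, (h5.rel hR).a A _ hi]
  | op o a b iha ihb =>
    intro k σ h hR
    have ho := hlt' _ h
    simp only [ok, Bool.and_eq_true] at h
    refine ((iha k σ h.1.1 hR).seq (n' := b.time + 3) ?_).mono (by simp [time]; omega) fun _ h => h
    rintro σ₁ ⟨h1, h2⟩
    refine (ihb (k + 1) σ₁ h.1.2 (h1.rel hR)).seq (n' := 3) ?_
    rintro σ₂ ⟨h3, h4⟩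
    have h5 := h1.trans h3 (by omega)
    have h6 : σ₂.reg (tmpReg k) = a.eval s := by
      rw [h3.reg _ (fun j hj => by unfold tmpReg; omega), h2]
    refine (BinOp.runs o (hlt' _ h.1.1) (hlt' _ h.1.2) ho h6 h4).mono le_rfl ?_
    rintro σ₃ ⟨h7, h8⟩
    exact ⟨h5.trans h7 le_rfl, h8⟩

theorem copyReg_runs {r x : ℕ} {σ : State} (hrx : r ≠ x) (h : σ.reg x < 2 ^ w) {Q : State → Prop}
    (hQ : Q { σ with reg := Function.update σ.reg r (σ.reg x) }) :
    Runs w (copyReg r x) σ 2 Q := by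
  refine (Runs.seq (n := 1) (n' := 1) (Runs.const _ _ rfl) ?_)
  rintro _ rfl
  refine Runs.arith _ _ _ _ ?_
  simpa [Op.eval, hrx.symm, Nat.mod_eq_of_lt h] using hQ

theorem Rel.setv {s : St} {σ : State} (hR : Rel w s σ) (x : Var) (n : ℕ) :
    Rel w (s.setv x n) { σ with reg := Function.update σ.reg x.reg n } where
  v y := by simp [Function.update_apply, Var.reg_inj, hR.v]
  size := by
    have : ctlReg 0 ≠ x.reg := by unfold ctlReg Var.reg; omega
    simp [this, hR.size]
  a A i hi := hR.a A i hi

theorem Rel.seta {s : St} {σ : State} (hR : Rel w s σ) (A : Arr) {i : ℕ} (n : ℕ)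
    (hi : i < cells w) : Rel w (s.seta A i n)
      { σ with mem := Function.update σ.mem (A.ctorIdx * cells w + i) n } where
  v y := by simp [hR.v]
  size := hR.size
  a A' i' hi' := by
    rw [St.seta_a, ← hR.a A' i' hi']
    simp only [Function.update_apply]
    refine if_congr ⟨fun h => Arr.addr_inj hi' hi h, ?_⟩ rfl rfl
    rintro ⟨rfl, rfl⟩
    rfl

theorem Rel.ctl {s : St} {σ : State} (hR : Rel w s σ) (j n : ℕ) (hj : j ≠ 0) :
    Rel w s { σ with reg := Function.update σ.reg (ctlReg j) n } where
  v y := by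
    have : y.reg ≠ ctlReg j := by unfold ctlReg Var.reg; omega
    simp [this, hR.v]
  size := by
    have : ctlReg 0 ≠ ctlReg j := by unfold ctlReg; omega
    simp [this, hR.size]
  a A i hi := hR.a A i hi

/-- The outcome of the code of a statement inside of `h` loops. -/
structure Outcome (β : Bounds) (S : Size) (w h : ℕ) (s : St) (σ σ' : State) : Prop where
  rel : Rel w s σ'
  bdd : s.Bdd β S
  ctl : ∀ j ≤ 2 * h, σ'.reg (ctlReg j) = σ.reg (ctlReg j)

theorem SameExcept.ctl {k : ℕ} {σ σ' : State} (h : SameExcept k σ σ') (j : ℕ) :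
    σ'.reg (ctlReg j) = σ.reg (ctlReg j) :=
  h.reg _ fun i _ => by unfold tmpReg ctlReg; omega

/-- Each round costs the body and one test, and the failing last test costs one more. The induction
runs backwards from the final round. -/
theorem loop_runs {r : ℕ} {P : Prog} {T n : ℕ} {I : ℕ → State → Prop}
    (h0 : ∀ σ, I n σ → σ.reg r = 0) (h1 : ∀ i < n, ∀ σ, I i σ → σ.reg r ≠ 0)
    (hP : ∀ i < n, ∀ σ, I i σ → Runs w P σ T (I (i + 1))) (i : ℕ) (hi : i ≤ n) :
    ∀ σ, I i σ → Runs w (.loop r P) σ ((n - i) * (T + 1) + 1) (I n) := by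
  induction hi using Nat.decreasingInduction with
  | self =>
    intro σ hI
    exact ⟨_, _, .loop_false (h0 σ hI), by omega, hI⟩
  | of_succ i hi ih =>
    intro σ hI
    obtain ⟨t, σ', e1, t1, hI'⟩ := hP i hi σ hI
    obtain ⟨t', σ'', e2, t2, hI''⟩ := ih σ' hI'
    refine ⟨_, _, .loop_true (h1 i hi σ hI) e1 e2, ?_, hI''⟩
    have : n - i = (n - (i + 1)) + 1 := by omega
    rw [this, add_mul]
    omega

/-- Inside `h` loops only control registers above `2 * h` are written, so those of the enclosing
loops persist. This is what the field `ctl` of `Outcome` records and what makes the loop case go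
through. -/
theorem Stmt.runs (hw : top.val S < cells w) : ∀ (P : Stmt) (h : ℕ) (s : St) (σ : State),
    P.ok β top = true → s.Bdd β S → P.Dyn β S s → Rel w s σ →
      Runs w (P.comp h) σ ((P.time β).val S) (Outcome β S w h (P.run s) σ) := by
  have hc : cells w < 2 ^ w :=
    (Nat.div_le_self _ _).trans_lt (Nat.sub_lt (by positivity) one_pos)
  have hval : ∀ {s : St}, s.Bdd β S → ∀ a : Expr, a.ok β top = true → a.eval s < 2 ^ w := by
    intro s hs a ha
    refine (Expr.eval_le hs a).trans_lt (lt_of_le_of_lt (Lv.val_mono ?_) (hw.trans hc))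
    cases a <;> simp_all [Expr.ok, Expr.lv]
  intro P
  induction P with
  | skip =>
    intro h s σ _ hs _ hR
    exact (Runs.skip ⟨hR, hs, fun _ _ => rfl⟩).mono (Lv.le_val_num 1) fun _ h => h
  | assign f x a =>
    intro h s σ hok hs hd hR
    simp only [ok, Bool.and_eq_true, Bool.or_eq_true] at hok
    refine Runs.mono ?_ (Lv.le_val_num (a.time + 2)) fun _ h => h
    refine (Expr.runs hw hs a 0 σ hok.1 hR).seq ?_
    rintro σ₁ ⟨h1, h2⟩
    refine copyReg_runs (by unfold Var.reg tmpReg; omega) (h2 ▸ hval hs a hok.1) ⟨?_, ?_, ?_⟩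
    · rw [h2]; exact (h1.rel hR).setv x _
    · refine hs.setv ?_
      rcases f with _ | _
      · exact (Expr.eval_le hs a).trans (Lv.val_mono (by simpa using hok.2))
      · exact hd
    · intro j _
      have : ctlReg j ≠ x.reg := by unfold ctlReg Var.reg; omega
      simp [this, h1.ctl]
  | store A i a =>
    intro h s σ hok hs hd hR
    simp only [ok, Bool.and_eq_true] at hok
    have hi : i.eval s < cells w :=
      (Expr.eval_le hs i).trans_lt ((Lv.val_mono hok.1.1.2).trans_lt hw)
    refine Runs.mono (n := i.time + (3 + (a.time + 1))) ?_
      (le_trans (by omega) (Lv.le_val_num (i.time + a.time + 4))) fun _ h => h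
    refine (Expr.runs hw hs i 0 σ hok.1.1.1 hR).seq ?_
    rintro σ₁ ⟨h1, h2⟩
    refine (Arr.runs (h1.rel hR) A hi h2).seq ?_
    rintro σ₂ ⟨h3, h4⟩
    have h5 := h1.trans h3 le_rfl
    refine (Expr.runs hw hs a 1 σ₂ hok.1.2 (h5.rel hR)).seq ?_
    rintro σ₃ ⟨h6, h7⟩
    have h8 := h5.trans h6 (by omega)
    have h9 : σ₃.reg (tmpReg 0) = σ₂.reg (tmpReg 0) :=
      h6.reg _ (fun j hj => by unfold tmpReg; omega)
    refine Runs.store _ _ ⟨?_, hs.seta ((Expr.eval_le hs a).trans (Lv.val_mono hok.2)), ?_⟩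
    · rw [h9, h4, h7]
      exact (h8.rel hR).seta A _ hi
    · exact fun j _ => h8.ctl j
  | seq P Q ihP ihQ =>
    intro h s σ hok hs hd hR
    simp only [ok, Bool.and_eq_true] at hok
    refine Runs.mono ?_ Lv.val_add fun _ h => h
    refine (ihP h s σ hok.1 hs hd.1 hR).seq ?_
    rintro σ₁ ⟨h1, h2, h3⟩
    refine (ihQ h _ σ₁ hok.2 h2 hd.2 h1).mono le_rfl ?_
    rintro σ₂ ⟨h4, h5, h6⟩
    exact ⟨h4, h5, fun j hj => by rw [h6 j hj, h3 j hj]⟩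
  | ite c P Q ihP ihQ =>
    intro h s σ hok hs hd hR
    simp only [ok, Bool.and_eq_true] at hok
    refine Runs.mono (n := c.time + (1 + ((P.time β).val S + (Q.time β).val S))) ?_ ?_ fun _ h => h
    · refine (Expr.runs hw hs c 0 σ hok.1.1 hR).seq ?_
      rintro σ₁ ⟨h1, h2⟩
      rw [run_ite]
      split_ifs with hv
      · obtain ⟨t, σ', e1, t1, h3, h4, h5⟩ := ihP h s σ₁ hok.1.2 hs hd.1 (h1.rel hR)
        exact ⟨_, _, .ite_true (by rwa [h2]) e1, by omega,
          h3, h4, fun j hj => by rw [h5 j hj, h1.ctl]⟩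
      · obtain ⟨t, σ', e1, t1, h3, h4, h5⟩ := ihQ h s σ₁ hok.2 hs hd.2 (h1.rel hR)
        exact ⟨_, _, .ite_false (by rw [h2]; tauto) e1, by omega,
          h3, h4, fun j hj => by rw [h5 j hj, h1.ctl]⟩
    · have h1 := @Lv.val_add S (P.time β) (Q.time β)
      have h2 := @Lv.val_add S (Lv.num (c.time + 1)) ((P.time β).add (Q.time β))
      have h3 := @Lv.le_val_num S (c.time + 1)
      simp only [time]
      omega
  | loop x n P ih =>
    intro h s σ hok hs hd hR
    simp only [ok, Bool.and_eq_true] at hok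
    obtain ⟨⟨⟨hn, hnx⟩, hnt⟩, hP⟩ := hok
    set c := n.eval s with hcdef
    have hcw : c < 2 ^ w := hval hs n hn
    set g := fun (i : ℕ) (s' : St) => P.run (s'.setv x i) with hg
    -- The invariant is stated at the moment of the test; its last clause says that the test
    -- register already holds the outcome for round `i`.
    let I : ℕ → State → Prop := fun i σ' => Rel w (iter g s i) σ' ∧ (iter g s i).Bdd β S ∧
      (∀ j ≤ 2 * h, σ'.reg (ctlReg j) = σ.reg (ctlReg j)) ∧ σ'.reg (ctlReg (2 * h + 1)) = c ∧
      σ'.reg (ctlReg (2 * h + 2)) = i ∧ σ'.reg (tmpReg 0) = if i < c then 1 else 0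
    have ct : ∀ j, ctlReg j ≠ tmpReg 0 := fun j => by unfold ctlReg tmpReg; omega
    have cv : ∀ j, ctlReg j ≠ x.reg := fun j => by unfold ctlReg Var.reg; omega
    have ci : ∀ j j', ctlReg j = ctlReg j' ↔ j = j' := fun j j' => by unfold ctlReg; omega
    have hbody : ∀ i < c, ∀ σ', I i σ' → Runs w
        (.seq (copyReg x.reg (ctlReg (2 * h + 2)))
        (.seq (P.comp (h + 1))
        (.seq (.const (tmpReg 0) 1)
        (.seq (.arith .add (ctlReg (2 * h + 2)) (ctlReg (2 * h + 2)) (tmpReg 0))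
          (.arith .lt (tmpReg 0) (ctlReg (2 * h + 2)) (ctlReg (2 * h + 1)))))))
        σ' (2 + ((P.time β).val S + (1 + (1 + 1)))) (I (i + 1)) := by
      rintro i hi σ₁ ⟨hr, hb, h0, h1, h2, h3⟩
      refine (copyReg_runs (cv _).symm (by rw [h2]; omega) rfl).seq ?_
      rintro _ rfl
      rw [h2]
      have hb' : ((iter g s i).setv x i).Bdd β S := hb.setv
        (hi.le.trans ((Expr.eval_le hs n).trans (Lv.val_mono hnx)))
      refine (ih (h + 1) _ _ hP hb' (hd i hi) (hr.setv x i)).seq ?_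
      rintro σ₂ ⟨h4, h5, h6⟩
      have k1 : σ₂.reg (ctlReg (2 * h + 1)) = c := by rw [h6 _ (by omega)]; simp [cv, h1]
      have k2 : σ₂.reg (ctlReg (2 * h + 2)) = i := by rw [h6 _ (by omega)]; simp [cv, h2]
      refine (Runs.const _ _ rfl).seq ?_
      rintro _ rfl
      refine (Runs.arith _ _ _ _ rfl).seq ?_
      rintro _ rfl
      have hm1 : 1 % 2 ^ w = 1 := Nat.mod_eq_of_lt (by omega)
      have hm2 : (i + 1) % 2 ^ w = i + 1 := Nat.mod_eq_of_lt (by omega)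
      have e1 := ((SameExcept.refl 0 σ₂).update 0 1 le_rfl).rel h4
      have e2 := e1.ctl (2 * h + 2) (i + 1) (by omega)
      refine Runs.arith _ _ _ _ ⟨?_, h5, ?_, ?_, ?_, ?_⟩
      · have := ((SameExcept.refl 0 _).update 0 (if i + 1 < c then 1 else 0) le_rfl).rel e2
        have e3 : iter g s (i + 1) = P.run ((iter g s i).setv x i) := rfl
        simpa [Op.eval, Function.update_apply, ct, (ct _).symm, ci, k1, k2, hm1, hm2, e3] using this
      · intro j hj
        have a1 : j ≠ 2 * h + 2 := by omega
        simp [Function.update_apply, ct, ci, a1]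
        rw [h6 j (by omega)]
        simp [cv, h0 j hj]
      · simp [Function.update_apply, ct, ci, k1]
      · simp [Op.eval, Function.update_apply, ct, (ct _).symm, ci, k2, hm1, hm2]
      · simp [Op.eval, Function.update_apply, ct, (ct _).symm, ci, k1, k2, hm1, hm2]
    have hloop := loop_runs (r := tmpReg 0) (I := I)
      (fun σ' hI => by rw [hI.2.2.2.2.2]; simp) (fun i hi σ' hI => by rw [hI.2.2.2.2.2]; simp [hi])
      hbody 0 (Nat.zero_le _)
    refine Runs.mono (n := n.time + (2 + (1 + (1 + ((c - 0) *
      (2 + ((P.time β).val S + (1 + (1 + 1))) + 1) + 1))))) ?_ ?_ fun _ h => h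
    · refine (Expr.runs hw hs n 0 σ hn hR).seq ?_
      rintro σ₁ ⟨h1, h2⟩
      refine (copyReg_runs (ct _) (by rw [h2]; exact hcw) rfl).seq ?_
      rintro _ rfl
      refine (Runs.const _ _ rfl).seq ?_
      rintro _ rfl
      refine (Runs.arith _ _ _ _ rfl).seq ?_
      rintro _ rfl
      have e1 := ((h1.rel hR).ctl (2 * h + 1) c (by omega)).ctl (2 * h + 2) 0 (by omega)
      refine (hloop _ ⟨?_, hs, ?_, ?_, ?_, ?_⟩).mono le_rfl fun σ' hI => ⟨hI.1, hI.2.1, hI.2.2.1⟩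
      · have := ((SameExcept.refl 0 _).update 0 (if 0 < c then 1 else 0) le_rfl).rel e1
        simpa [Op.eval, Function.update_apply, ct, (ct _).symm, ci, h2, ← hcdef, iter] using this
      · intro j hj
        have a1 : j ≠ 2 * h + 2 := by omega
        have a2 : j ≠ 2 * h + 1 := by omega
        simp [Function.update_apply, ct, ci, a1, a2, h1.ctl]
      · simp [Function.update_apply, ct, ci, h2, ← hcdef]
      · simp [Function.update_apply, ct, ci]
      · simp [Op.eval, Function.update_apply, ct, (ct _).symm, ci, h2, ← hcdef]
    · have h1 := @Lv.val_add S (Lv.num (n.time + 6)) ((n.lv β).mul ((Lv.num 6).add (P.time β)))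
      have h2 := @Lv.le_val_num S (n.time + 6)
      have h3 := @Lv.val_add S (Lv.num 6) (P.time β)
      have h4 := @Lv.le_val_num S 6
      have h5 : c ≤ (n.lv β).val S := Expr.eval_le hs n
      have h6 := Nat.mul_le_mul h5 (show (P.time β).val S + 6 ≤ ((Lv.num 6).add (P.time β)).val S by
        omega)
      rw [← Lv.val_mul] at h6
      simp only [time, Nat.sub_zero]
      rw [show 2 + ((P.time β).val S + (1 + (1 + 1))) + 1 = (P.time β).val S + 6 by ring]
      omega

/-- The complete machine program for a statement. -/
def Stmt.prog (P : Stmt) : Prog :=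
  .seq (.const (tmpReg 0) 1)
    -- Here 0 - 1 wraps around to 2^w - 1. The number 2^w is not itself a word, which is why `cells`
    -- is defined from its predecessor.
    (.seq (.arith .sub (ctlReg 0) (ctlReg 0) (tmpReg 0))
    (.seq (.const (tmpReg 0) 32)
    (.seq (.arith .div (ctlReg 0) (ctlReg 0) (tmpReg 0))
    (.seq (.const (tmpReg 0) 0) (P.comp 0)))))

/-- Start of a statement: the input stands in the array `inp`, everything else is zero. -/
def St.init (input : List ℕ) : St where
  v := fun _ => 0
  a := fun A i => if A = .inp then input.getD i 0 else 0

/-- The array `inp` has number 0, so its segment starts at address 0, where the machine places the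
input and where the output is read. The 5 steps are the computation of the segment length and the
reset of the temporary register. -/
theorem Stmt.prog_runs (hw : top.val S < cells w) (P : Stmt) (input : List ℕ)
    (hin : ∀ x ∈ input, x < 2 ^ w) (hlen : input.length ≤ cells w)
    (hok : P.ok β top = true) (hs : (St.init input).Bdd β S) (hd : P.Dyn β S (St.init input)) :
    Runs w P.prog (State.init w input) (5 + (P.time β).val S) fun σ =>
      ∀ i < cells w, σ.mem i = (P.run (St.init input)).a .inp i := by
  have hc0 : 32 ≤ 2 ^ w - 1 := by
    by_contra h
    have : cells w = 0 := Nat.div_eq_of_lt (by omega)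
    omega
  have hm1 : 1 % 2 ^ w = 1 := Nat.mod_eq_of_lt (by omega)
  have hm2 : 32 % 2 ^ w = 32 := Nat.mod_eq_of_lt (by omega)
  have hm3 : (2 ^ w - 1) % 2 ^ w = 2 ^ w - 1 := Nat.mod_eq_of_lt (by omega)
  have ct : ctlReg 0 ≠ tmpReg 0 := by decide
  refine Runs.mono (n := 1 + (1 + (1 + (1 + (1 + (P.time β).val S))))) ?_ (by omega) fun _ h => h
  refine (Runs.const _ _ rfl).seq ?_
  rintro _ rfl
  refine (Runs.arith _ _ _ _ rfl).seq ?_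
  rintro _ rfl
  refine (Runs.const _ _ rfl).seq ?_
  rintro _ rfl
  refine (Runs.arith _ _ _ _ rfl).seq ?_
  rintro _ rfl
  refine (Runs.const _ _ rfl).seq ?_
  rintro _ rfl
  refine (Stmt.runs hw P 0 (St.init input) _ hok hs hd ⟨?_, ?_, ?_⟩).mono le_rfl ?_
  · intro x
    have h1 : x.reg ≠ tmpReg 0 := by unfold Var.reg tmpReg; omega
    have h2 : x.reg ≠ ctlReg 0 := by unfold Var.reg ctlReg; omega
    simp [Function.update_apply, h1, h2, State.init, St.init]
  · simp [Function.update_apply, ct, ct.symm, State.init, Op.eval, cells, hm1, hm2, hm3]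
  · intro A i hi
    have hget : ∀ j, input.getD j 0 % 2 ^ w = input.getD j 0 := by
      intro j
      refine Nat.mod_eq_of_lt ?_
      rcases lt_or_ge j input.length with h | h
      · rw [List.getD_eq_getElem _ _ h]; exact hin _ (List.getElem_mem h)
      · rw [List.getD_eq_default _ _ h]; positivity
    simp only [State.init, St.init, hget]
    split_ifs with hA
    · subst hA
      have : Arr.inp.ctorIdx = 0 := rfl
      simp [this]
    · refine List.getD_eq_default _ _ ?_
      have h1 : 1 ≤ A.ctorIdx := by
        rw [Nat.one_le_iff_ne_zero]
        exact fun h => hA (Arr.ctorIdx_inj h)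
      -- Every other segment starts at or beyond `cells w`, hence beyond the end of the input, where
      -- memory is 0.
      nlinarith
  · rintro σ ⟨h, -, -⟩ i hi
    have := h.a .inp i hi
    rwa [show Arr.inp.ctorIdx = 0 from rfl, zero_mul, zero_add] at this

end ForLang

/-! ## The evaluation identity -/

namespace MME

open Finset

/-- The exponents `0, 1, 1 + q, 1 + q + q ^ 2, …`. -/
def geomExp (q : ℕ) : ℕ → ℕ
  | 0 => 0
  | i + 1 => 1 + q * geomExp q i

/-- The geometric sum, in the form that turns a power with exponent `q - 1` of the root series into
a Frobenius power. -/
theorem geomExp_mul {q : ℕ} (hq : 1 ≤ q) (i : ℕ) : 1 + geomExp q i * (q - 1) = q ^ i := by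
  obtain ⟨q, rfl⟩ := Nat.exists_eq_add_of_le' hq
  induction i with
  | zero => simp [geomExp]
  | succ i ih =>
    rw [pow_succ, ← ih, geomExp]
    simp only [Nat.add_sub_cancel]
    ring

/-- Outcome of reading the lowest `j` bits of `B`: a bit `1` raises the current entry of the
exponent vector, a bit `0` moves on to the next entry. -/
def parse (B : ℕ) : ℕ → (ℕ → ℕ) × ℕ
  | 0 => (fun _ => 0, 0)
  | j + 1 =>
    let s := parse B j
    if B / 2 ^ j % 2 = 1 then (Function.update s.1 s.2 (s.1 s.2 + 1), s.2) else (s.1, s.2 + 1)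

theorem parse_congr {B B' : ℕ} : ∀ {j : ℕ}, B % 2 ^ j = B' % 2 ^ j → parse B j = parse B' j
  | 0, _ => rfl
  | j + 1, h => by
    have h1 : B % 2 ^ j = B' % 2 ^ j := by
      have := congrArg (· % 2 ^ j) h
      simpa [Nat.mod_mod_of_dvd _ (pow_dvd_pow 2 (Nat.le_succ j))] using this
    have h2 : B / 2 ^ j % 2 = B' / 2 ^ j % 2 := by
      have := congrArg (· / 2 ^ j) h
      simpa [pow_succ, Nat.mod_mul_right_div_self] using this
    rw [parse, parse, parse_congr h1, h2]

theorem parse_gt (B : ℕ) : ∀ (j i : ℕ), (parse B j).2 < i → (parse B j).1 i = 0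
  | 0, _, _ => rfl
  | j + 1, i, h => by
    rw [parse] at h ⊢
    split_ifs with hb
    · simp only [hb, if_true] at h
      simp only
      rw [Function.update_of_ne (by omega), parse_gt B j i h]
    · simp only [hb, if_false] at h
      exact parse_gt B j i (by omega)

theorem parse_le (B : ℕ) : ∀ (j i : ℕ), (parse B j).2 ≤ j ∧ (parse B j).1 i ≤ j
  | 0, _ => ⟨le_rfl, le_rfl⟩
  | j + 1, i => by
    obtain ⟨h1, h2⟩ := parse_le B j i
    rw [parse]
    split_ifs with hb
    · refine ⟨by omega, ?_⟩
      simp only [Function.update_apply]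
      split_ifs with h
      · rw [← h]; omega
      · omega
    · exact ⟨by simp only; omega, by simp only; omega⟩

/-- Bits are read from the lowest up, so the top bit acts last. This lemma and `parse_high` drive
the induction over the number of bits. -/
theorem parse_low {B j : ℕ} (h : B < 2 ^ j) :
    parse B (j + 1) = ((parse B j).1, (parse B j).2 + 1) := by
  rw [parse]; simp [Nat.div_eq_of_lt h]

theorem parse_high {B j : ℕ} (h : B < 2 ^ j) : parse (2 ^ j + B) (j + 1) =
    (Function.update (parse B j).1 (parse B j).2 ((parse B j).1 (parse B j).2 + 1),
      (parse B j).2) := by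
  have h1 : (2 ^ j + B) / 2 ^ j = 1 := by
    rw [Nat.add_div_left _ (by positivity), Nat.div_eq_of_lt h]
  have h2 : parse (2 ^ j + B) j = parse B j := parse_congr (by simp)
  rw [parse]; simp [h1, h2]

/-! ### Exponent vectors of given degree as bit strings -/

section Parse
variable {R : Type*} [CommRing R]

/-- Bit strings enumerate the exponent vectors of a given degree. -/
theorem sum_parse : ∀ (j m : ℕ) (y : ℕ → ℕ → R),
    (∑ B ∈ range (2 ^ j), if (parse B j).2 = m then
      ∏ i ∈ range (m + 1), y i ((parse B j).1 i) else 0) =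
    if m ≤ j then PowerSeries.coeff (j - m) (∏ i ∈ range (m + 1), PowerSeries.mk (y i)) else 0
  | 0, m, y => by
    rcases m with _ | m
    · simp [parse]
    · simp [parse]
  | j + 1, m, y => by
    rw [pow_succ, mul_two, sum_range_add]
    -- If the last bit read is 1, it raises the entry `m` at which the cursor ends. That amounts to
    -- shifting the sequence `y m` by one.
    have hhigh : (∑ B ∈ range (2 ^ j), if (parse (2 ^ j + B) (j + 1)).2 = m then
        ∏ i ∈ range (m + 1), y i ((parse (2 ^ j + B) (j + 1)).1 i) else 0) =
        ∑ B ∈ range (2 ^ j), if (parse B j).2 = m then ∏ i ∈ range (m + 1),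
          (Function.update y m fun k => y m (k + 1)) i ((parse B j).1 i) else 0 := by
      refine sum_congr rfl fun B hB => ?_
      rw [parse_high (mem_range.1 hB)]
      refine if_ctx_congr Iff.rfl (fun h => ?_) fun _ => rfl
      rw [prod_range_succ, prod_range_succ, h]
      simp only [Function.update_self]
      congr 1
      refine prod_congr rfl fun i hi => ?_
      have := (mem_range.1 hi).ne
      simp [Function.update_of_ne this]
    -- If the last bit is 0, the cursor has just arrived at `m`, so entry `m` is still 0 and
    -- contributes `y m 0`.
    have hlow : (∑ B ∈ range (2 ^ j), if (parse B (j + 1)).2 = m then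
        ∏ i ∈ range (m + 1), y i ((parse B (j + 1)).1 i) else 0) =
        ∑ B ∈ range (2 ^ j), if (parse B j).2 + 1 = m then (∏ i ∈ range m,
          y i ((parse B j).1 i)) * y m 0 else 0 := by
      refine sum_congr rfl fun B hB => ?_
      rw [parse_low (mem_range.1 hB)]
      refine if_ctx_congr Iff.rfl (fun h => ?_) fun _ => rfl
      rw [prod_range_succ, parse_gt B j m (by omega)]
    rw [hhigh, hlow, sum_parse j m]
    set A : PowerSeries R := ∏ i ∈ range m, PowerSeries.mk (y i) with hA
    have hA' : ∏ i ∈ range m, PowerSeries.mk ((Function.update y m fun k => y m (k + 1)) i) = A :=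
      prod_congr rfl fun i hi => by rw [Function.update_of_ne (mem_range.1 hi).ne]
    -- The same case distinction for generating functions: constant term plus X times the shifted
    -- series.
    have hsplit : PowerSeries.mk (y m) = PowerSeries.C (y m 0) +
        PowerSeries.mk (fun k => y m (k + 1)) * PowerSeries.X := by
      ext k
      rcases k with _ | k
      · simp
      · simp [PowerSeries.coeff_succ_mul_X, PowerSeries.coeff_C]
    have hlow' : (∑ B ∈ range (2 ^ j), if (parse B j).2 + 1 = m then (∏ i ∈ range m,
          y i ((parse B j).1 i)) * y m 0 else 0) =
        if m ≤ j + 1 then PowerSeries.coeff (j + 1 - m) A * y m 0 else 0 := by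
      rcases m with _ | m
      · simp [hA, PowerSeries.coeff_one]
      · have := sum_parse j m y
        simp only [Nat.add_right_cancel_iff, Nat.add_le_add_iff_right, Nat.add_sub_add_right]
        rw [← hA] at this
        rw [← ite_zero_mul, ← this, sum_mul]
        exact sum_congr rfl fun B _ => by rw [ite_zero_mul]
    rw [hlow', prod_range_succ, prod_range_succ, hA', ← hA, Function.update_self, hsplit, mul_add,
      map_add, PowerSeries.coeff_mul_C]
    rcases lt_trichotomy m (j + 1) with h | rfl | h
    · obtain ⟨s, hs⟩ : ∃ s, j = m + s := ⟨j - m, by omega⟩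
      have e1 : j - m = s := by omega
      have e2 : j + 1 - m = s + 1 := by omega
      rw [if_pos h.le, if_pos (by omega), if_pos h.le, e1, e2, ← mul_assoc,
        PowerSeries.coeff_succ_mul_X]
    · simp [← mul_assoc]
    · rw [if_neg (by omega), if_neg (by omega), if_neg (by omega), add_zero]

end Parse

/-! ### Truncated Taylor expansion of monomials -/

section Taylor
variable {F : Type*} [Field F]

/-- Coefficient of `δ ^ k` in `(x + δ) ^ j`. -/
noncomputable def taylor (x : F) (j k : ℕ) : F :=
  ((Polynomial.X + Polynomial.C x) ^ j).coeff k

theorem taylor_zero (x : F) (k : ℕ) : taylor x 0 k = if k = 0 then 1 else 0 := by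
  simp [taylor, Polynomial.coeff_one]

theorem taylor_succ_zero (x : F) (j : ℕ) : taylor x (j + 1) 0 = taylor x j 0 * x := by
  simp [taylor, pow_succ, mul_add]

theorem taylor_succ_succ (x : F) (j k : ℕ) :
    taylor x (j + 1) (k + 1) = taylor x j (k + 1) * x + taylor x j k := by
  simp [taylor, pow_succ, mul_add, add_comm]

/-- Truncated Taylor expansion of a monomial, with the exponent vectors coded by bit strings. -/
theorem sum_parse_taylor (m s : ℕ) (x : ℕ → F) (δ : ℕ → PowerSeries F)
    (hδ : ∀ l, PowerSeries.constantCoeff (δ l) = 0) (κ : ℕ → ℕ) (G : PowerSeries F) :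
    (∑ B ∈ range (2 ^ (m + s)), if (parse B (m + s)).2 = m then
      (∏ l ∈ range m, taylor (x l) (κ l) ((parse B (m + s)).1 l)) *
        PowerSeries.coeff s (G * ∏ l ∈ range m, δ l ^ (parse B (m + s)).1 l) else 0) =
    PowerSeries.coeff s (G * ∏ l ∈ range m, (PowerSeries.C (x l) + δ l) ^ κ l) := by
  -- The entry with number `m` is the slack: its weight is constantly 1, so total degree exactly `s`
  -- in `m + 1` entries becomes total degree at most `s` in the first `m`.
  let y : ℕ → ℕ → PowerSeries F := fun l k =>
    if l < m then PowerSeries.C (taylor (x l) (κ l) k) * δ l ^ k else 1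
  have h := sum_parse (m + s) m y
  rw [if_pos (Nat.le_add_right _ _), Nat.add_sub_cancel_left] at h
  -- the product as a polynomial in an auxiliary variable
  let P : Polynomial (PowerSeries F) :=
    ∏ l ∈ range m, (Polynomial.C (δ l) * Polynomial.X + Polynomial.C (PowerSeries.C (x l))) ^ κ l
  have hP : ∏ l ∈ range m, PowerSeries.mk (y l) = (P : PowerSeries (PowerSeries F)) := by
    have : (P : PowerSeries (PowerSeries F)) = ∏ l ∈ range m,
        (((Polynomial.C (δ l) * Polynomial.X + Polynomial.C (PowerSeries.C (x l))) ^ κ l :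
          Polynomial (PowerSeries F)) : PowerSeries (PowerSeries F)) := by
      simp only [← Polynomial.coeToPowerSeries.ringHom_apply]
      exact map_prod _ _ _
    rw [this]
    refine prod_congr rfl fun l hl => ?_
    ext1 k
    rw [PowerSeries.coeff_mk, Polynomial.coeff_coe]
    have e : (Polynomial.C (δ l) * Polynomial.X + Polynomial.C (PowerSeries.C (x l))) ^ κ l =
        (((Polynomial.X + Polynomial.C (x l)) ^ κ l).map PowerSeries.C).comp
          (Polynomial.C (δ l) * Polynomial.X) := by
      simp
    rw [e, Polynomial.comp_C_mul_X_coeff, Polynomial.coeff_map]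
    simp [y, mem_range.1 hl, taylor]
  -- Each `δ l` is divisible by X, so the coefficient of degree `j` in the auxiliary variable is
  -- divisible by X^j. Terms beyond `s` are invisible, and the truncated sum equals the full value
  -- `P.eval 1`.
  have hcoeff : ∀ j, s < j → ∀ G, PowerSeries.coeff s (G * P.coeff j) = 0 := by
    intro j hj G
    choose δ' hδ' using fun l => PowerSeries.X_dvd_iff.2 (hδ l)
    have e : P = (∏ l ∈ range m, (Polynomial.C (δ' l) * Polynomial.X +
        Polynomial.C (PowerSeries.C (x l))) ^ κ l).comp
          (Polynomial.C PowerSeries.X * Polynomial.X) := by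
      rw [Polynomial.prod_comp]
      refine prod_congr rfl fun l _ => ?_
      rw [hδ' l]
      simp only [Polynomial.pow_comp, Polynomial.add_comp, Polynomial.mul_comp, Polynomial.C_comp,
        Polynomial.X_comp, map_mul]
      ring
    rw [e, Polynomial.comp_C_mul_X_coeff, ← mul_assoc, PowerSeries.coeff_mul_X_pow', if_neg]
    omega
  have heval : P.eval 1 = ∏ l ∈ range m, (PowerSeries.C (x l) + δ l) ^ κ l := by
    simp [P, Polynomial.eval_prod, add_comm]
  have hsum : PowerSeries.coeff s (G * P.eval 1) =
      ∑ j ∈ range (s + 1), PowerSeries.coeff s (G * P.coeff j) := by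
    rw [Polynomial.eval_eq_sum_range' (n := P.natDegree + 1 + (s + 1)) (by omega)]
    simp only [one_pow, mul_one, mul_sum, map_sum]
    refine (sum_subset (range_subset_range.2 (by omega)) fun j _ hj => hcoeff j ?_ G).symm
    simpa using hj
  -- The slack factor is the series with all coefficients 1, and multiplying by it forms partial
  -- sums of coefficients.
  have hR : PowerSeries.coeff s (∏ i ∈ range (m + 1), PowerSeries.mk (y i)) =
      ∑ j ∈ range (s + 1), P.coeff j := by
    rw [prod_range_succ, hP, PowerSeries.coeff_mul, Nat.sum_antidiagonal_eq_sum_range_succ_mk]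
    refine sum_congr rfl fun j _ => ?_
    simp [y]
  rw [← heval, hsum, ← map_sum, ← mul_sum, ← hR, ← h, mul_sum, map_sum]
  refine sum_congr rfl fun B _ => ?_
  split_ifs
  · rw [prod_range_succ]
    have e : ∏ l ∈ range m, y l ((parse B (m + s)).1 l) = PowerSeries.C (∏ l ∈ range m,
        taylor (x l) (κ l) ((parse B (m + s)).1 l)) * ∏ l ∈ range m, δ l ^ (parse B (m + s)).1 l := by
      rw [map_prod, ← prod_mul_distrib]
      exact prod_congr rfl fun l hl => by simp [y, mem_range.1 hl]
    rw [e, show y m ((parse B (m + s)).1 m) = 1 by simp [y], mul_one, mul_left_comm,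
      PowerSeries.coeff_C_mul]
  · simp

end Taylor

/-! ### Extraction of a coefficient from expansions at all field elements -/

section Extract
variable {F : Type*} [Field F] [Fintype F]

/-- A power series whose power of exponent `q - 1` is inverse to `1 + X` modulo `X ^ r`. -/
noncomputable def root (q r : ℕ) : PowerSeries F := (1 + PowerSeries.X) ^ geomExp q r

/-- By `geomExp_mul` the left side is (1+X)^(q^r), which is 1 + X^(q^r) in characteristic p, and q^r
≥ r. -/
theorem one_add_X_mul_root_pow {q : ℕ} (hq : Fintype.card F = q) (r : ℕ) :
    ∃ G : PowerSeries F, (1 + PowerSeries.X) * root (F := F) q r ^ (q - 1) =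
      1 + PowerSeries.X ^ r * G := by
  have h1 : 1 < q := hq ▸ Fintype.one_lt_card
  obtain ⟨p, hp⟩ := CharP.exists F
  obtain ⟨n, hp', hn⟩ := FiniteField.card F p
  have := Fact.mk hp'
  have : CharP (PowerSeries F) p :=
    charP_of_injective_ringHom (PowerSeries.C_injective (R := F)) p
  have e : (1 + PowerSeries.X) * root (F := F) q r ^ (q - 1) =
      1 + PowerSeries.X ^ (q ^ r) := by
    rw [root, ← pow_mul, ← pow_succ', add_comm (_ * _) 1, geomExp_mul h1.le, ← hq, hn, ← pow_mul,
      add_pow_char_pow, one_pow]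
  refine ⟨PowerSeries.X ^ (q ^ r - r), ?_⟩
  rw [e, ← pow_add]
  congr 2
  have := (Nat.lt_pow_self (n := r) h1)
  omega

/-- The known sum over the units; as the exponent is nonzero, the element 0 adds nothing. -/
theorem sum_pow_field {q : ℕ} (hq : Fintype.card F = q) (i : ℕ) (hi : i ≠ 0) :
    ∑ x : F, x ^ i = if q - 1 ∣ i then -1 else 0 := by
  classical
  rw [← hq, ← FiniteField.sum_pow_units, ← sum_sdiff ({0} : Finset F).subset_univ, sum_singleton,
    zero_pow hi, add_zero]
  symm
  refine sum_bij (fun x _ => (x : F)) (by simp) (fun _ _ _ _ h => Units.ext h) ?_ (by simp)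
  intro y hy
  exact ⟨Units.mk0 y (by simpa using hy), mem_univ _, rfl⟩

-- The extra factor is 1 modulo X^(s+1), so coefficients up to degree `s` do not notice it.
omit [Fintype F] in
theorem coeff_one_add_pow_mul {k : ℕ} (s : ℕ) (G : PowerSeries F) (A : PowerSeries F) :
    PowerSeries.coeff s (A * (1 + PowerSeries.X ^ (s + 1) * G) ^ k) = PowerSeries.coeff s A := by
  induction k with
  | zero => simp
  | succ k ih =>
    rw [pow_succ, ← mul_assoc, mul_add, mul_one, map_add, ih,
      show A * (1 + PowerSeries.X ^ (s + 1) * G) ^ k * (PowerSeries.X ^ (s + 1) * G) =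
        PowerSeries.X ^ (s + 1) * (A * (1 + PowerSeries.X ^ (s + 1) * G) ^ k * G) by ring,
      PowerSeries.coeff_X_pow_mul', if_neg (by omega), add_zero]

/-- The weights by which values near the points `lam` determine a coefficient. -/
noncomputable def weight (q s D : ℕ) (lam : F) : PowerSeries F :=
  (PowerSeries.C lam * root q (s + 1)) ^ ((q - 1) * (D + 1) - D) *
    (1 + PowerSeries.X) ^ (s + 1 + D)

/-- Recovery of a coefficient of a polynomial from its expansions at all elements of the field. -/
theorem sum_weight {q : ℕ} (hq : Fintype.card F = q) (s D : ℕ) (P : Polynomial F)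
    (hlow : ∀ i < D, P.coeff i = 0) (hdeg : P.natDegree ≤ D + s * (q - 1)) :
    ∑ lam : F, PowerSeries.coeff s (weight q s D lam *
      Polynomial.aeval (PowerSeries.C lam * root q (s + 1)) P) = -P.coeff D := by
  have h1 : 1 < q := hq ▸ Fintype.one_lt_card
  obtain ⟨G, hG⟩ := one_add_X_mul_root_pow hq (s + 1)
  set t : PowerSeries F := root q (s + 1) with ht
  have hD : D < (q - 1) * (D + 1) := by
    have : 1 * (D + 1) ≤ (q - 1) * (D + 1) := Nat.mul_le_mul_right _ (by omega)
    omega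
  -- A natural number congruent to -D modulo q - 1, and positive, so that 0^(e+i) = 0 even for i =
  -- 0. It makes e + D = (q-1)(D+1).
  set e := (q - 1) * (D + 1) - D with he
  have hterm : ∀ lam : F, PowerSeries.coeff s (weight q s D lam *
      Polynomial.aeval (PowerSeries.C lam * t) P) = ∑ i ∈ range (D + s * (q - 1) + 1),
        P.coeff i * (lam ^ (e + i) * PowerSeries.coeff s
          (t ^ (e + i) * (1 + PowerSeries.X) ^ (s + 1 + D))) := by
    intro lam
    rw [Polynomial.aeval_eq_sum_range' (n := D + s * (q - 1) + 1) (by omega), mul_sum, map_sum]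
    refine sum_congr rfl fun i _ => ?_
    rw [weight, ← ht, ← he, mul_smul_comm, PowerSeries.coeff_smul, ← PowerSeries.coeff_C_mul]
    congr 2
    rw [mul_pow, mul_pow, map_pow, pow_add, pow_add]
    ring
  rw [sum_congr rfl fun lam _ => hterm lam, sum_comm, sum_eq_single D]
  · rw [← mul_sum, ← sum_mul, sum_pow_field hq _ (by omega)]
    have e1 : e + D = (q - 1) * (D + 1) := by omega
    rw [e1, if_pos (Dvd.intro _ rfl), pow_mul]
    -- Of the s + 1 + D factors 1+X, D + 1 cancel against the powers of t. The remaining (1+X)^s has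
    -- leading coefficient 1.
    have e2 : (t ^ (q - 1)) ^ (D + 1) * (1 + PowerSeries.X) ^ (s + 1 + D) =
        (1 + PowerSeries.X) ^ s * (1 + PowerSeries.X ^ (s + 1) * G) ^ (D + 1) := by
      rw [← hG, mul_pow]; ring
    rw [e2, coeff_one_add_pow_mul]
    have : PowerSeries.coeff s ((1 + PowerSeries.X : PowerSeries F) ^ s) = 1 := by
      have := congrArg (Polynomial.coeff · s) (rfl : (1 + Polynomial.X : Polynomial F) ^ s = _)
      have h3 : ((1 + PowerSeries.X : PowerSeries F) ^ s) =
        (((1 + Polynomial.X : Polynomial F) ^ s : Polynomial F) : PowerSeries F) := by simp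
      rw [h3, Polynomial.coeff_coe, Polynomial.coeff_one_add_X_pow]; simp
    rw [this]; ring
  · intro i hi hne
    rcases lt_or_gt_of_ne hne with h | h
    · simp [hlow i h]
    · rw [← mul_sum, ← sum_mul, sum_pow_field hq _ (by omega)]
      split_ifs with hdvd
      · have e1 : e + i = (q - 1) * (D + 1) + (i - D) := by omega
        obtain ⟨l, hl⟩ := (Nat.dvd_add_right (Dvd.intro (D + 1) rfl)).1 (e1 ▸ hdvd)
        have hl0 : l ≠ 0 := by rintro rfl; omega
        -- This is where the degree bound enters. At i = D + l(q-1) only (1+X)^(s-l) remains, a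
        -- polynomial of degree below `s` as l > 0.
        have hls : l ≤ s := by
          have : (q - 1) * l ≤ (q - 1) * s := by
            rw [← hl, mul_comm (q - 1) s]
            have := mem_range.1 hi
            omega
          exact Nat.le_of_mul_le_mul_left this (by omega)
        obtain ⟨u, rfl⟩ := Nat.exists_eq_add_of_le hls
        have e2 : t ^ (e + i) * (1 + PowerSeries.X) ^ (l + u + 1 + D) =
            (1 + PowerSeries.X) ^ u * (1 + PowerSeries.X ^ (l + u + 1) * G) ^ (D + 1 + l) := by
          rw [← hG, mul_pow, e1, hl, ← mul_add, pow_mul]; ring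
        rw [e2, coeff_one_add_pow_mul]
        have : PowerSeries.coeff (l + u) ((1 + PowerSeries.X : PowerSeries F) ^ u) = 0 := by
          have h3 : ((1 + PowerSeries.X : PowerSeries F) ^ u) =
            (((1 + Polynomial.X : Polynomial F) ^ u : Polynomial F) : PowerSeries F) := by simp
          rw [h3, Polynomial.coeff_coe, Polynomial.coeff_one_add_X_pow,
            Nat.choose_eq_zero_of_lt (by omega)]
          simp
        rw [this]; ring
      · simp
  · intro h
    exact absurd (mem_range.2 (by omega)) h

end Extract

/-! ### Monomials along curves through the origin with values in a grid -/

section Main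
variable {F : Type*} [Field F]

/-- The curve `(1 + b c t) ^ n - 1`, where `t` is the series `root q r`, as a power series. -/
noncomputable def curve (q r n : ℕ) (b c : F) : PowerSeries F :=
  (1 + PowerSeries.C (b * c) * root q r) ^ n

/-- The constant coefficient of the curve. -/
noncomputable def base (n : ℕ) (b c : F) : F := (1 + b * c) ^ n - 1

/-- The nonconstant part of the curve. -/
noncomputable def increment (q r n : ℕ) (b c : F) : PowerSeries F :=
  PowerSeries.mk fun k => if k = 0 then 0 else PowerSeries.coeff k (curve q r n b c)

theorem constantCoeff_root (q r : ℕ) : PowerSeries.constantCoeff (root (F := F) q r) = 1 := by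
  simp [root]

theorem constantCoeff_curve (q r n : ℕ) (b c : F) :
    PowerSeries.constantCoeff (curve q r n b c) = base n b c + 1 := by
  simp [curve, base, constantCoeff_root]

/-- The curve at λt is split into a grid value and a series without constant term, the form that
`sum_parse_taylor` needs. -/
theorem base_add_increment (q r n : ℕ) (b c : F) :
    PowerSeries.C (base n b c) + increment q r n b c = curve q r n b c - 1 := by
  ext k
  rcases k with _ | k
  · have := constantCoeff_curve q r n b c
    rw [← PowerSeries.coeff_zero_eq_constantCoeff_apply] at this
    simp only [increment, map_add, map_sub, PowerSeries.coeff_mk, if_true, this]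
    simp
  · simp [increment, PowerSeries.coeff_C, PowerSeries.coeff_one]

theorem constantCoeff_increment (q r n : ℕ) (b c : F) :
    PowerSeries.constantCoeff (increment q r n b c) = 0 := by
  rw [← PowerSeries.coeff_zero_eq_constantCoeff_apply, increment, PowerSeries.coeff_mk, if_pos rfl]

variable [Fintype F]

/-- Evaluation of a monomial on the grid of the values `base n b c`. -/
theorem sum_grid {q : ℕ} (hq : Fintype.card F = q) {n m : ℕ} {b : F} (hb : n * b = 1)
    (κ : ℕ → ℕ) (hn : n * (∑ l ∈ range m, κ l) ≤ 2 * m * (q - 1)) (a : ℕ → F) :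
    (∑ B ∈ range (2 ^ (m + 2 * m)), if (parse B (m + 2 * m)).2 = m then ∑ lam : F,
      (∏ l ∈ range m, taylor (base n b (lam * a l)) (κ l) ((parse B (m + 2 * m)).1 l)) *
        PowerSeries.coeff (2 * m) (weight q (2 * m) (∑ l ∈ range m, κ l) lam *
          ∏ l ∈ range m, increment q (2 * m + 1) n b (lam * a l) ^ (parse B (m + 2 * m)).1 l)
      else 0) = -∏ l ∈ range m, a l ^ κ l := by
  set D := ∑ l ∈ range m, κ l with hD
  have h1 : 1 < q := hq ▸ Fintype.one_lt_card
  -- the curve through the origin as a polynomial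
  let g : F → Polynomial F := fun c => (1 + Polynomial.C (b * c) * Polynomial.X) ^ n - 1
  -- The linear coefficient is the derivative at 0, which is n·b·c = c. Hence a product of powers of
  -- such polynomials starts with the matching monomial in the coordinates.
  have hg : ∀ c, ∃ h, g c = Polynomial.X * h ∧ h.coeff 0 = c := by
    intro c
    obtain ⟨h, hh⟩ : Polynomial.X ∣ g c := by
      rw [Polynomial.X_dvd_iff, Polynomial.coeff_zero_eq_eval_zero]; simp [g]
    refine ⟨h, hh, ?_⟩
    have e1 : (g c).coeff 1 = c := by
      have : (g c).coeff 1 = (Polynomial.derivative (g c)).eval 0 := by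
        rw [← Polynomial.coeff_zero_eq_eval_zero, Polynomial.coeff_derivative]; simp
      rw [this]
      simp [g, Polynomial.derivative_pow, ← mul_assoc, hb]
    rw [hh, show (1 : ℕ) = 0 + 1 from rfl, Polynomial.coeff_X_mul] at e1
    exact e1
  choose h hgh hh0 using hg
  have hgdeg : ∀ c, (g c).natDegree ≤ n := by
    intro c
    refine (Polynomial.natDegree_sub_le _ _).trans ?_
    simp only [Polynomial.natDegree_one, Nat.max_zero]
    refine Polynomial.natDegree_pow_le.trans ?_
    have : (1 + Polynomial.C (b * c) * Polynomial.X).natDegree ≤ 1 := by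
      rw [add_comm]; exact Polynomial.natDegree_linear_le
    nlinarith
  let P : Polynomial F := ∏ l ∈ range m, g (a l) ^ κ l
  have hP : P = Polynomial.X ^ D * ∏ l ∈ range m, h (a l) ^ κ l := by
    simp only [P, hgh, mul_pow, prod_mul_distrib]
    rw [prod_pow_eq_pow_sum]
  have hPD : P.coeff D = ∏ l ∈ range m, a l ^ κ l := by
    have : P.coeff D = (∏ l ∈ range m, h (a l) ^ κ l).coeff 0 := by
      rw [hP]; simpa using Polynomial.coeff_X_pow_mul (∏ l ∈ range m, h (a l) ^ κ l) D 0
    rw [this, Polynomial.coeff_zero_eq_eval_zero, Polynomial.eval_prod]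
    refine prod_congr rfl fun l _ => ?_
    rw [Polynomial.eval_pow, ← Polynomial.coeff_zero_eq_eval_zero, hh0]
  have hPlow : ∀ i < D, P.coeff i = 0 := by
    intro i hi
    rw [hP, Polynomial.coeff_X_pow_mul', if_neg (by omega)]
  have hPdeg : P.natDegree ≤ D + 2 * m * (q - 1) := by
    refine (Polynomial.natDegree_prod_le _ _).trans ?_
    refine le_trans (sum_le_sum fun l _ => Polynomial.natDegree_pow_le.trans
      (Nat.mul_le_mul_left _ (hgdeg _))) ?_
    rw [← sum_mul, ← hD]
    linarith
  rw [← hPD, ← sum_weight hq (2 * m) D P hPlow hPdeg]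
  have key : ∀ lam : F, Polynomial.aeval (PowerSeries.C lam * root q (2 * m + 1)) P =
      ∏ l ∈ range m, (PowerSeries.C (base n b (lam * a l)) +
        increment q (2 * m + 1) n b (lam * a l)) ^ κ l := by
    intro lam
    simp only [P, map_prod, map_pow]
    refine prod_congr rfl fun l _ => ?_
    rw [base_add_increment]
    congr 1
    simp only [g, curve, map_sub, map_pow, map_add, map_one, map_mul, Polynomial.aeval_C,
      Polynomial.aeval_X]
    rw [show algebraMap F (PowerSeries F) = PowerSeries.C from rfl]
    congr 3
    ring
  have key' := fun lam : F => sum_parse_taylor m (2 * m) (fun l => base n b (lam * a l))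
    (fun l => increment q (2 * m + 1) n b (lam * a l)) (fun l => constantCoeff_increment ..) κ
    (weight q (2 * m) D lam)
  simp only [key, ← key']
  rw [sum_comm]
  refine sum_congr rfl fun B _ => ?_
  split_ifs
  · rfl
  · simp

end Main
end MME

/-! ## The program -/

namespace MME
open ForLang ForLang.Stmt

infixr:30 " ;; " => Stmt.seq
infix:45 " ≔ " => Stmt.assign false

/-- Field addition by table lookup. -/
def fadd (a b : Expr) : Expr := .get .add (a * Var.q + b)
/-- Field multiplication by table lookup. -/
def fmul (a b : Expr) : Expr := .get .mul (a * Var.q + b)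

/-- `x ≔ a ^ n`. -/
def powS (x : Var) (a n : Expr) : Stmt :=
  .assign true x 1 ;; .loop .i n (.assign true x (x * a))

/-- Read the parameters. -/
def paramS : Stmt :=
  .assign true .p (.get .inp 0) ;; .assign true .e (.get .inp 1) ;;
  .assign true .d (.get .inp 2) ;; .assign true .d' (.get .inp 3) ;;
  .assign true .m (.get .inp 4) ;; .assign true .N (.get .inp 5) ;;
  powS .q Var.p Var.e ;; powS .X Var.d Var.m ;;
  .r ≔ Var.m + Var.m + 1 ;; .L ≔ Var.m + 2 * Var.m ;; powS .B 2 Var.L ;;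
  .oF ≔ 6 + Var.e ;; .oP ≔ Var.oF + Var.X

/-- The addition table of the field. -/
def addS : Stmt :=
  -- A cell with number x·q + y is computed from the lowest digits and from the earlier cell for x/p
  -- and y/p. For z = 0 the cell reads itself, which is harmless since it starts as 0.
  .loop .z (Var.q * Var.q) (.store .add Var.z (.op .guard
    ((Var.z / Var.q % Var.p + Var.z % Var.q % Var.p) % Var.p +
      Var.p * .get .add (Var.z / Var.q / Var.p * Var.q + Var.z % Var.q / Var.p)) Var.q))

/-- The reduction of the leading monomial of the modulus. -/
def redS : Stmt :=
  .ne ≔ 0 ;; .loop .i Var.e (.ne ≔ .op .guard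
    (Var.ne * Var.p + (Var.p - .get .inp (6 + (Var.e - 1 - Var.i))) % Var.p) Var.q)

/-- The table for multiplication by the generator of the field. -/
def mulzS : Stmt :=
  .loop .z Var.q (.ite (.op .lt Var.z (Var.q / Var.p)) (.store .mulz Var.z (Var.z * Var.p))
    (.store .mulz Var.z (fadd (.get .mulz (Var.z - Var.q / Var.p)) Var.ne)))

/-- The multiplication table of the field. -/
def mulS : Stmt :=
  .loop .z (Var.q * Var.q) (.ite (.op .eq (Var.z % Var.q) 0) (.store .mul Var.z 0)
    (.ite (.op .eq (Var.z % Var.q % Var.p) 0)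
      (.store .mul Var.z (.get .mulz (.get .mul (Var.z / Var.q * Var.q + Var.z % Var.q / Var.p))))
      (.store .mul Var.z (fadd (.get .mul (Var.z - 1)) (Var.z / Var.q)))))

/-- `acc` becomes the sum in the field of the values of `a` for `x < n`. -/
def sumS (x : Var) (n a : Expr) : Stmt :=
  .acc ≔ 0 ;; .loop x n (.acc ≔ fadd Var.acc a)

/-- Multiply the series in `W` by the series in `A` from place `o` on. -/
def mulSerS (A : Arr) (o : Expr) : Stmt :=
  .loop .u Var.r (sumS .i (Var.u + 1)
    (fmul (.get .W Var.i) (.get A (o + (Var.u - Var.i)))) ;; .store .tmp Var.u Var.acc) ;;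
  .loop .u Var.r (.store .W Var.u (.get .tmp Var.u))

/-- Store the series with coefficients `a` in `A` from place `o` on. -/
def setSerS (A : Arr) (o a : Expr) : Stmt := .loop .u Var.r (.store A (o + Var.u) a)

/-- The series `1 + X` and `root q r`. -/
def rootS : Stmt :=
  setSerS .U 0 (.op .lt Var.u 2) ;; setSerS .T 0 (.op .eq Var.u 0) ;;
  .loop .x Var.r (setSerS .W 0 (.get .U Var.u) ;; .loop .j Var.q (mulSerS .T 0) ;;
    setSerS .T 0 (.get .W Var.u))

/-- The exponent and the factor of the curves. -/
def curveParamS : Stmt :=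
  .n ≔ (Var.q - 1) / (Var.d' - 1) ;; .b ≔ 0 ;;
  -- The word p - 1 stands for -1, so b becomes -(d'-1), the inverse of n.
  .loop .i (Var.d' - 1) (.b ≔ fadd Var.b (Var.p - 1))

/-- The degree of the polynomial. -/
def degS : Stmt :=
  .D ≔ 0 ;; .loop .k Var.X (.ite (.get .inp (Var.oF + Var.k))
    (.D ≔ 0 ;; .y ≔ Var.k ;;
      .loop .j Var.m (.D ≔ .op .guard (Var.D + Var.y % Var.d) (Var.m * Var.d + 1) ;;
        .y ≔ Var.y / Var.d)) .skip)

/-- The curves: constant coefficients and increments. -/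
def curveS : Stmt :=
  .loop .c Var.q (.bc ≔ fmul Var.b Var.c ;;
    setSerS .V 0 (fadd (.op .eq Var.u 0) (fmul Var.bc (.get .T Var.u))) ;;
    setSerS .W 0 (.op .eq Var.u 0) ;; .loop .j Var.n (mulSerS .V 0) ;;
    -- The constant coefficient minus 1 is the grid value; clearing it leaves the increment in `W`.
    .store .val Var.c (fadd (.get .W 0) (Var.p - 1)) ;; .store .W 0 0 ;;
    setSerS .del (Var.c * Var.r) (.get .W Var.u))

/-- The weights. -/
def weightS : Stmt :=
  .loop .lam Var.q (setSerS .V 0 (fmul Var.lam (.get .T Var.u)) ;;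
    setSerS .W 0 (.op .eq Var.u 0) ;;
    .loop .j ((Var.q - 1) * (Var.D + 1) - Var.D) (mulSerS .V 0) ;;
    .loop .j (Var.r + Var.D) (mulSerS .U 0) ;;
    setSerS .om (Var.lam * Var.r) (.get .W Var.u))

/-- The values of the curves in increasing order. -/
def gridS : Stmt :=
  .loop .c Var.q (.store .mark (.get .val Var.c) 1) ;; .cnt ≔ 0 ;;
  .loop .z Var.q (.store .rank Var.z Var.cnt ;; .ite (.get .mark Var.z)
    (.store .xs Var.cnt Var.z ;; .cnt ≔ .op .guard (Var.cnt + 1) (Var.q + 1)) .skip)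

/-- The coefficients of the Taylor expansions of the powers at the grid points. -/
def taylorS : Stmt :=
  .loop .z (Var.d * Var.d * Var.r) (.ite (.op .eq (Var.z / Var.r % Var.d) 0)
    (.store .pt Var.z (.op .eq (Var.z % Var.r) 0))
    (.store .pt Var.z (fadd (fmul (.get .pt (Var.z - Var.r)) (.get .xs (Var.z / Var.r / Var.d)))
      -- For k = 0 the neighbouring cell belongs to another row, and the truth value masks it.
      (.op .lt 0 (Var.z % Var.r) * .get .pt (Var.z - Var.r - 1)))))

/-- Exponent vector of a bit string. -/
def parseS : Stmt :=
  .loop .i (Var.L + 1) (.store .al Var.i 0) ;; .z ≔ 0 ;; .y ≔ Var.bits ;;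
  .loop .j Var.L (.ite (Var.y % 2)
    (.store .al Var.z (.op .guard (.get .al Var.z + 1) (Var.L + 1)))
    (.z ≔ .op .guard (Var.z + 1) (Var.L + 1)) ;; .y ≔ Var.y / 2)

/-- Evaluation of a derivative on the grid. -/
def evalS : Stmt :=
  .X₁ ≔ Var.X / Var.d ;; .loop .k Var.X (.store .H Var.k (.get .inp (Var.oF + Var.k))) ;;
  .loop .l Var.m (
    -- Each pass consumes the lowest base-d digit, an exponent, and puts the new grid coordinate on
    -- top. After m passes every digit is replaced and the order is the original one.
    .loop .k Var.X (.x ≔ Var.k / Var.X₁ ;; .rest ≔ Var.k % Var.X₁ ;;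
      sumS .j Var.d (fmul (.get .pt ((Var.x * Var.d + Var.j) * Var.r + .get .al Var.l))
        (.get .H (Var.j + Var.d * Var.rest))) ;;
      .store .H' Var.k Var.acc) ;;
    .loop .k Var.X (.store .H Var.k (.get .H' Var.k)))

/-- Contribution of one field element to the value at one point. -/
def localS : Stmt :=
  setSerS .W 0 (.get .om (Var.lam * Var.r + Var.u)) ;; .idx ≔ 0 ;;
  -- Coordinates are taken from the last to the first, so that Horner's rule makes coordinate 0 the
  -- lowest digit of the grid index.
  .loop .l Var.m (.y ≔ Var.m - 1 - Var.l ;;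
    .c ≔ fmul Var.lam (.get .inp (Var.oP + Var.pt * Var.m + Var.y)) ;;
    .idx ≔ .op .guard (Var.idx * Var.d + .get .rank (.get .val Var.c)) Var.X ;;
    -- The common bound for array entries contains a factor Y, which would spoil the running time
    -- here. The guard replaces it by a bound polynomial in S.
    .loop .j (.op .guard (.get .al Var.y) Var.r) (mulSerS .del (Var.c * Var.r))) ;;
  .store .out Var.pt (fadd (.get .out Var.pt) (fmul (.get .H Var.idx) (.get .W (Var.r - 1))))

/-- Contribution of one derivative to the values at all points. -/
def decodeS : Stmt := .loop .pt Var.N (.loop .lam Var.q localS)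

/-- All contributions. -/
def mainS : Stmt :=
  .loop .bits Var.B (parseS ;; .ite (.op .eq Var.z Var.m) (evalS ;; decodeS) .skip)

/-- The output. -/
def outS : Stmt := .loop .pt Var.N (.store .inp Var.pt (fmul (Var.p - 1) (.get .out Var.pt)))

/-- Everything after the reading of the parameters. -/
def bodyS : Stmt :=
  addS ;; redS ;; mulzS ;; mulS ;; rootS ;; curveParamS ;; degS ;; curveS ;; weightS ;; gridS ;;
    taylorS ;; mainS ;; outS

/-- The whole program. -/
def evaluationS : Stmt := paramS ;; bodyS

/-- Bounds for the variables and the arrays of the program. -/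
def bounds : Bounds where
  v
    | .p | .e | .d | .d' | .m | .q | .ne | .n => ⟨1, 0, 0⟩
    | .N | .X | .X₁ | .idx | .pt => ⟨0, 0, 1⟩
    | .r | .u => ⟨3, 0, 0⟩
    | .L | .D => ⟨4, 0, 0⟩
    | .i | .j | .l | .z | .cnt | .oF | .lam => ⟨8, 0, 0⟩
    | .B | .bits => ⟨0, 3, 0⟩
    | .oP | .k | .x | .acc | .c | .b | .bc | .rest => ⟨10, 0, 1⟩
    -- This variable serves both for indices of coefficients and for bit strings, so its bound must
    -- cover both.
    | .y => ⟨10, 3, 1⟩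
  a _ := ⟨10, 0, 1⟩

/-- Bound for all intermediate values. -/
def topLv : Lv := ⟨40, 6, 3⟩

theorem evaluationS_ok : evaluationS.ok bounds topLv = true := by decide
theorem bodyS_static : bodyS.static = true := by decide

end MME

/-! ## Tables of the field operations -/

namespace MME
open ForLang ForLang.Stmt

/-! ### Field elements as base-p digit strings -/

section Coding
variable {F : Type*} [Field F]

/-- The element of the field with the word `z`, if the field is generated by `ζ`. -/
noncomputable def dec (p : ℕ) (ζ : F) (z : ℕ) : F := Nat.ofDigits ζ (Nat.digits p z)

theorem dec_zero (p : ℕ) (ζ : F) : dec p ζ 0 = 0 := by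
  rw [dec, Nat.digits_zero]; rfl

theorem dec_step {p : ℕ} (hp : 1 < p) (ζ : F) (z : ℕ) :
    dec p ζ z = ((z % p : ℕ) : F) + ζ * dec p ζ (z / p) := by
  rcases Nat.eq_zero_or_pos z with rfl | hz
  · simp [dec_zero]
  · rw [dec, Nat.digits_def' hp hz]
    rfl

theorem dec_of_lt {p : ℕ} (hp : 1 < p) (ζ : F) {z : ℕ} (hz : z < p) : dec p ζ z = z := by
  rw [dec_step hp, Nat.mod_eq_of_lt hz, Nat.div_eq_of_lt hz, dec_zero]; ring

theorem dec_mul_add {p : ℕ} (hp : 1 < p) (ζ : F) (z c : ℕ) (hc : c < p) :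
    dec p ζ (c + p * z) = c + ζ * dec p ζ z := by
  rw [dec_step hp, Nat.add_mul_mod_self_left, Nat.mod_eq_of_lt hc,
    Nat.add_mul_div_left _ _ (by omega), Nat.div_eq_of_lt hc, zero_add]

theorem dec_sum {p : ℕ} (hp : 1 < p) (ζ : F) (n : ℕ) (c : ℕ → ℕ) (hc : ∀ j, c j < p) :
    dec p ζ (∑ j ∈ Finset.range n, c j * p ^ j) = ∑ j ∈ Finset.range n, (c j : F) * ζ ^ j := by
  induction n generalizing c with
  | zero => simp [dec_zero]
  | succ n ih =>
    have e : ∑ j ∈ Finset.range (n + 1), c j * p ^ j =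
        c 0 + p * ∑ j ∈ Finset.range n, c (j + 1) * p ^ j := by
      rw [Finset.sum_range_succ', pow_zero, mul_one, Finset.mul_sum, add_comm]
      congr 1
      exact Finset.sum_congr rfl fun j _ => by ring
    rw [e, dec_mul_add hp ζ _ _ (hc 0), ih (fun j => c (j + 1)) fun j => hc _,
      Finset.sum_range_succ', pow_zero, mul_one, Finset.mul_sum, add_comm]
    congr 1
    exact Finset.sum_congr rfl fun j _ => by ring

theorem sum_digits_lt {p : ℕ} (n : ℕ) (c : ℕ → ℕ) (hc : ∀ j, c j < p) :
    ∑ j ∈ Finset.range n, c j * p ^ j < p ^ n := by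
  induction n with
  | zero => simp
  | succ n ih =>
    rw [Finset.sum_range_succ, pow_succ]
    have := Nat.mul_le_mul_right (p ^ n) (Nat.succ_le_iff.2 (hc n))
    rw [Nat.succ_mul] at this
    nlinarith

/-- Adding a leading digit. -/
theorem dec_add_pow {p : ℕ} (hp : 1 < p) (ζ : F) (k : ℕ) (z : ℕ) (hz : z + p ^ k < p ^ (k + 1)) :
    dec p ζ (z + p ^ k) = dec p ζ z + ζ ^ k := by
  induction k generalizing z with
  | zero =>
    simp only [pow_zero, zero_add, pow_one] at hz ⊢
    rw [dec_of_lt hp ζ hz, dec_of_lt hp ζ (by omega)]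
    push_cast; ring
  | succ k ih =>
    rw [dec_step hp ζ (z + p ^ (k + 1)), dec_step hp ζ z]
    have e1 : (z + p ^ (k + 1)) % p = z % p := by rw [pow_succ', Nat.add_mul_mod_self_left]
    have e2 : (z + p ^ (k + 1)) / p = z / p + p ^ k := by
      rw [pow_succ', Nat.add_mul_div_left _ _ (by omega)]
    rw [e1, e2, ih]
    · ring
    · rw [← e2]
      exact Nat.div_lt_of_lt_mul (by rw [← pow_succ']; exact hz)

/-- Digitwise addition without carry. -/
def addc (p : ℕ) (x y : ℕ) : ℕ :=
  if _h : 1 < p ∧ (x ≠ 0 ∨ y ≠ 0) then (x % p + y % p) % p + p * addc p (x / p) (y / p) else 0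
termination_by x + y
decreasing_by
  rcases _h with ⟨hp, h | h⟩
  · have := Nat.div_lt_self (Nat.pos_of_ne_zero h) hp
    have := Nat.div_le_self y p
    omega
  · have := Nat.div_lt_self (Nat.pos_of_ne_zero h) hp
    have := Nat.div_le_self x p
    omega

theorem addc_zero (p : ℕ) : addc p 0 0 = 0 := by rw [addc]; simp

theorem addc_step {p : ℕ} (hp : 1 < p) (x y : ℕ) :
    addc p x y = (x % p + y % p) % p + p * addc p (x / p) (y / p) := by
  by_cases h : x ≠ 0 ∨ y ≠ 0
  · rw [addc, dif_pos ⟨hp, h⟩]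
  · have hx : x = 0 := by tauto
    have hy : y = 0 := by tauto
    subst hx hy
    simp [addc_zero]

theorem addc_lt {p : ℕ} (hp : 1 < p) (i : ℕ) :
    ∀ {x y}, x < p ^ i → y < p ^ i → addc p x y < p ^ i := by
  induction i with
  | zero =>
    intro x y hx hy
    have hx : x = 0 := by simpa using hx
    have hy : y = 0 := by simpa using hy
    subst hx hy
    simp [addc_zero]
  | succ i ih =>
    intro x y hx hy
    rw [pow_succ'] at hx hy ⊢
    have h1 := ih (Nat.div_lt_of_lt_mul hx) (Nat.div_lt_of_lt_mul hy)
    rw [addc_step hp]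
    have h2 := Nat.mod_lt (x % p + y % p) (show 0 < p by omega)
    nlinarith

/-- Dropping the carry changes a digit by a multiple of p, which is 0 in F. -/
theorem dec_addc {p : ℕ} (hp : 1 < p) (h0 : (p : F) = 0) (ζ : F) (x y : ℕ) :
    dec p ζ (addc p x y) = dec p ζ x + dec p ζ y := by
  by_cases h : x ≠ 0 ∨ y ≠ 0
  · rw [addc_step hp, dec_mul_add hp ζ _ _ (Nat.mod_lt _ (by omega)),
      dec_addc hp h0 ζ (x / p) (y / p), dec_step hp ζ x, dec_step hp ζ y]
    have e : (((x % p + y % p) % p : ℕ) : F) = ((x % p + y % p : ℕ) : F) := by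
      conv_rhs => rw [← Nat.mod_add_div (x % p + y % p) p]
      push_cast
      rw [h0]; ring
    rw [e]; push_cast; ring
  · have hx : x = 0 := by tauto
    have hy : y = 0 := by tauto
    subst hx hy
    simp [addc_zero, dec_zero]
termination_by x + y
decreasing_by
  rcases h with h | h
  · have := Nat.div_lt_self (Nat.pos_of_ne_zero h) hp
    have := Nat.div_le_self y p
    omega
  · have := Nat.div_lt_self (Nat.pos_of_ne_zero h) hp
    have := Nat.div_le_self x p
    omega

/-- The words of the elements of a field with `p ^ e` elements that is generated by `ζ`. -/
structure Coding (p e : ℕ) (ζ : F) (enc : F → ℕ) : Prop where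
  hp : 1 < p
  he : 1 ≤ e
  char : (p : F) = 0
  lt : ∀ x, enc x < p ^ e
  enc_dec : ∀ z < p ^ e, enc (dec p ζ z) = z
  dec_enc : ∀ x, dec p ζ (enc x) = x

namespace Coding
variable {p e : ℕ} {ζ : F} {enc : F → ℕ} (h : Coding p e ζ enc)
include h

theorem le_card : p ≤ p ^ e := Nat.le_self_pow (Nat.one_le_iff_ne_zero.1 h.he) p

theorem enc_inj {x y : F} : enc x = enc y ↔ x = y :=
  ⟨fun e => by rw [← h.dec_enc x, e, h.dec_enc], fun e => e ▸ rfl⟩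

/-- This is how computed words are identified: it suffices that they are in range and decode
correctly. -/
theorem eq_enc {z : ℕ} {x : F} (hz : z < p ^ e) (hx : dec p ζ z = x) : z = enc x := by
  rw [← hx, h.enc_dec z hz]

theorem enc_zero : enc 0 = 0 := by
  have := h.lt 0
  exact (h.eq_enc (by omega) (dec_zero p ζ)).symm

theorem enc_one : enc 1 = 1 := by
  have := h.le_card
  have := h.hp
  exact (h.eq_enc (by omega) (by rw [dec_of_lt h.hp ζ h.hp]; simp)).symm

theorem enc_neg_one : enc (-1) = p - 1 := by
  have := h.le_card
  have := h.hp
  refine (h.eq_enc (by omega) ?_).symm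
  rw [dec_of_lt h.hp ζ (by omega), Nat.cast_sub (by omega), h.char]; simp

theorem enc_add (x y : F) : enc (x + y) = addc p (enc x) (enc y) :=
  (h.eq_enc (addc_lt h.hp e (h.lt x) (h.lt y))
    (by rw [dec_addc h.hp h.char, h.dec_enc, h.dec_enc])).symm

theorem exists_enc {z : ℕ} (hz : z < p ^ e) : ∃ x, enc x = z := ⟨_, h.enc_dec z hz⟩

end Coding

end Coding

theorem div_mul_add {q x y : ℕ} (hy : y < q) : (x * q + y) / q = x := by
  rw [mul_comm, Nat.mul_add_div (by omega), Nat.div_eq_of_lt hy, add_zero]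

theorem mod_mul_add {q x y : ℕ} (hy : y < q) : (x * q + y) % q = y := by
  rw [mul_comm, Nat.mul_add_mod, Nat.mod_eq_of_lt hy]

theorem mul_add_lt {q d x y : ℕ} (hx : x < d) (hy : y < q) : x * q + y < d * q := by
  have := Nat.mul_le_mul_right q (Nat.succ_le_iff.2 hx)
  rw [Nat.succ_mul] at this
  omega

/-! ### Tables for the field operations -/

section Tables
variable {F : Type*} [Field F] {p e : ℕ} {ζ : F} {enc : F → ℕ}

theorem addS_run (h : Coding p e ζ enc) {s : St} (hp : s.v .p = p) (hq : s.v .q = p ^ e)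
    (h0 : s.a .add 0 = 0) (x y : F) :
    (addS.run s).a .add (enc x * p ^ e + enc y) = enc (x + y) := by
  have hq0 : 0 < p ^ e := (Nat.zero_le _).trans_lt (h.lt 0)
  have key : ∀ z < (Expr.op .mul (Expr.var .q) (Expr.var .q)).eval s,
      (addS.run s).a .add z = addc p (z / p ^ e) (z % p ^ e) := by
    -- Cell 0 is tracked separately because round 0 reads it before it has been written.
    refine Stmt.for_ind (I := fun i s' => s'.a .add 0 = 0 ∧ ∀ k < i, s'.a .add k =
      addc p (k / p ^ e) (k % p ^ e)) ⟨h0, by simp⟩ ?_ |>.2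
    intro z hz s' hF hI
    have e1 : s'.v .p = p := (hF.v .p rfl).trans hp
    have e2 : s'.v .q = p ^ e := (hF.v .q rfl).trans hq
    replace hz : z < p ^ e * p ^ e := by simpa [Expr.eval, BinOp.eval, hq] using hz
    have hx := Nat.div_lt_of_lt_mul hz
    have hy := Nat.mod_lt z hq0
    set x := z / p ^ e
    set y := z % p ^ e
    have hxy : x * p ^ e + y = z := Nat.div_add_mod' z _
    have hval : s'.a .add (x / p * p ^ e + y / p) = addc p (x / p) (y / p) := by
      rcases Nat.eq_zero_or_pos z with hz0 | hz0
      · have hx0 : x = 0 := by simp [x, hz0]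
        have hy0 : y = 0 := by simp [y, hz0]
        simp [hx0, hy0, hI.1, addc_zero]
      · have hy' : y / p < p ^ e := (Nat.div_le_self _ _).trans_lt hy
        rw [hI.2, div_mul_add hy', mod_mul_add hy']
        rw [← hxy]
        rcases Nat.eq_zero_or_pos x with hx0 | hx0
        · rw [hx0] at hxy ⊢
          have := Nat.div_lt_self (show 0 < y by omega) h.hp
          simpa using this
        · have h1 := Nat.div_lt_self hx0 h.hp
          have h2 := mul_add_lt h1 hy'
          exact h2.trans_le (Nat.le_add_right _ _)
    have hg := addc_lt h.hp e hx hy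
    have hv := addc_step h.hp x y
    have hrun : ∀ k, ((Stmt.store .add (.var .z) (.op .guard
        ((Var.z / Var.q % Var.p + Var.z % Var.q % Var.p) % Var.p +
      Var.p * .get .add (Var.z / Var.q / Var.p * Var.q + Var.z % Var.q / Var.p)) Var.q)).run
        (s'.setv .z z)).a .add k = if k = z then addc p x y else s'.a .add k := by
      intro k
      simp [e1, e2]
      rw [show z / p ^ e = x from rfl, show z % p ^ e = y from rfl, hval]
      rw [Nat.mod_add_mod, Nat.add_mod_mod] at hv
      rw [← hv, if_pos hg]
    refine ⟨?_, fun k hk => ?_⟩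
    · rw [hrun]
      split_ifs with hz0
      · have hx0 : x = 0 := by simp [x, ← hz0]
        have hy0 : y = 0 := by simp [y, ← hz0]
        rw [hx0, hy0, addc_zero]
      · exact hI.1
    · rw [hrun]
      split_ifs with hk0
      · rw [hk0]
      · exact hI.2 k (by omega)
  have hlt := mul_add_lt (h.lt x) (h.lt y)
  rw [key _ (by simpa [Expr.eval, BinOp.eval, hq] using hlt), div_mul_add (h.lt y), mod_mul_add (h.lt y), h.enc_add]

end Tables
end MME

namespace MME
open ForLang ForLang.Stmt

section Tables
variable {F : Type*} [Field F] {p e : ℕ} {ζ : F} {enc : F → ℕ}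

/-- The parameters of the field and its addition table are in place. -/
structure AddEnv (p e : ℕ) (enc : F → ℕ) (s : St) : Prop where
  vp : s.v .p = p
  vq : s.v .q = p ^ e
  add : ∀ x y, s.a .add (enc x * p ^ e + enc y) = enc (x + y)

theorem AddEnv.frame {s s' : St} (h : AddEnv p e enc s) {P : Stmt} (hF : P.Frame s s')
    (h1 : P.modv .p = false) (h2 : P.modv .q = false) (h3 : P.moda .add = false) :
    AddEnv p e enc s' :=
  ⟨(hF.v _ h1).trans h.vp, (hF.v _ h2).trans h.vq, fun x y => by rw [hF.a _ h3, h.add]⟩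

theorem AddEnv.fadd {s : St} (h : AddEnv p e enc s) {a b : Expr} {x y : F}
    (ha : a.eval s = enc x) (hb : b.eval s = enc y) : (fadd a b).eval s = enc (x + y) := by
  simp [MME.fadd, ha, hb, h.vq, h.add]

theorem AddEnv.setv {s : St} (h : AddEnv p e enc s) (x : Var) (n : ℕ) (h1 : Var.p ≠ x)
    (h2 : Var.q ≠ x) : AddEnv p e enc (s.setv x n) :=
  ⟨by simp [h1, h.vp], by simp [h2, h.vq], h.add⟩

/-- The relation E(ζ) = 0 expresses ζ^e by the negated lower coefficients. They are appended as
digits from the top one down, so after `i` rounds the word has `i` digits and the guard never fires.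
-/
theorem redS_run (h : Coding p e ζ enc) {s : St} (hp : s.v .p = p) (hq : s.v .q = p ^ e)
    (he : s.v .e = e) (E : ℕ → ℕ) (hE : ∀ j < e, s.a .inp (6 + j) = E j)
    (hEp : ∀ j < e, E j < p) (hζ : ζ ^ e = -∑ j ∈ Finset.range e, (E j : F) * ζ ^ j) :
    (redS.run s).v .ne = enc (ζ ^ e) := by
  have hp0 : 0 < p := (Nat.zero_le _).trans_lt h.hp
  have key : (redS.run s).v .ne < p ^ e ∧ dec p ζ ((redS.run s).v .ne) =
      ∑ j ∈ Finset.range e, -(E (e - e + j) : F) * ζ ^ j := by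
    have := Stmt.for_ind (x := .i) (n := .var .e) (P := .ne ≔ .op .guard
      (Var.ne * Var.p + (Var.p - .get .inp (6 + (Var.e - 1 - Var.i))) % Var.p) Var.q)
      (s := s.setv .ne 0) (I := fun i s' => s'.v .ne < p ^ i ∧ dec p ζ (s'.v .ne) =
        ∑ j ∈ Finset.range i, -(E (e - i + j) : F) * ζ ^ j) (by simp [dec_zero]) ?_
    · simpa [he, redS] using this
    intro i hi s' hF hI
    replace hi : i < e := by simpa [he] using hi
    have e1 : s'.v .p = p := (hF.v .p rfl).trans (by simp [hp])
    have e2 : s'.v .q = p ^ e := (hF.v .q rfl).trans (by simp [hq])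
    have e3 : s'.v .e = e := (hF.v .e rfl).trans (by simp [he])
    have e4 : s'.a .inp (6 + (e - 1 - i)) = E (e - 1 - i) := by
      rw [hF.a .inp rfl]; exact hE _ (by omega)
    set c := (p - E (e - 1 - i)) % p with hc
    have hcp : c < p := Nat.mod_lt _ hp0
    have hcF : (c : F) = -E (e - 1 - i) := by
      have h1 : ((c + p * ((p - E (e - 1 - i)) / p) : ℕ) : F) = ((p - E (e - 1 - i) : ℕ) : F) := by
        rw [hc, Nat.mod_add_div]
      rw [Nat.cast_sub (hEp _ (by omega)).le] at h1
      push_cast at h1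
      rw [h.char] at h1
      linear_combination h1
    have hlt : s'.v .ne * p + c < p ^ (i + 1) := by
      rw [pow_succ]; exact mul_add_lt hI.1 hcp
    have hlt' : s'.v .ne * p + c < p ^ e :=
      hlt.trans_le (Nat.pow_le_pow_right hp0 (by omega))
    have hne : ((Stmt.assign false .ne (.op .guard
      (Var.ne * Var.p + (Var.p - .get .inp (6 + (Var.e - 1 - Var.i))) % Var.p) Var.q)).run
        (s'.setv .i i)).v .ne = s'.v .ne * p + c := by
      simp [e1, e2, e3, e4, ← hc, hlt']
    rw [hne]
    refine ⟨hlt, ?_⟩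
    rw [add_comm, mul_comm, dec_mul_add h.hp ζ _ _ hcp, hI.2, hcF, Finset.sum_range_succ',
      Finset.mul_sum, add_comm, pow_zero, mul_one]
    congr 1
    · refine Finset.sum_congr rfl fun j _ => ?_
      rw [show e - (i + 1) + (j + 1) = e - i + j by omega]; ring
    · rw [show e - (i + 1) + 0 = e - 1 - i by omega]
  refine h.eq_enc key.1 ?_
  rw [key.2, hζ]
  simp

/-- If the top digit is 0, multiplication by ζ shifts the digits. Otherwise lowering the top digit
by 1 leads to an earlier cell, and ζ · ζ^(e-1) = ζ^e is added back. -/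
theorem mulzS_run (h : Coding p e ζ enc) {s : St} (hA : AddEnv p e enc s)
    (hne : s.v .ne = enc (ζ ^ e)) (x : F) :
    (mulzS.run s).a .mulz (enc x) = enc (ζ * x) := by
  have hp0 : 0 < p := (Nat.zero_le _).trans_lt h.hp
  obtain ⟨e', he'⟩ := Nat.exists_eq_add_of_le' h.he
  have hqp : p ^ e / p = p ^ e' := by rw [he', pow_succ, Nat.mul_div_cancel _ hp0]
  have hq : p ^ e = p ^ e' * p := by rw [he', pow_succ]
  have hpos : 0 < p ^ e' := by positivity
  have key : ∀ z < (Expr.var .q).eval s, (mulzS.run s).a .mulz z = enc (ζ * dec p ζ z) := by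
    refine Stmt.for_fill .mulz (fun z => enc (ζ * dec p ζ z)) ?_
    intro z hz s' hF hI
    have hA' := hA.frame hF rfl rfl rfl
    have e1 := hA'.vp
    have e2 := hA'.vq
    have e3 : s'.v .ne = enc (ζ ^ e) := (hF.v .ne rfl).trans hne
    replace hz : z < p ^ e := by simpa [hA.vq] using hz
    by_cases hzq : z < p ^ e'
    · refine ⟨?_, fun k hk => ?_⟩
      · simp [e1, e2, hqp, hzq]
        refine h.eq_enc (by rw [hq]; exact Nat.mul_lt_mul_of_pos_right hzq hp0) ?_
        have := dec_mul_add h.hp ζ z 0 hp0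
        rw [mul_comm]; simpa using this
      · simp [e2, e1, hqp, hzq, hk.ne]
    · have h1 : dec p ζ z = dec p ζ (z - p ^ e') + ζ ^ e' := by
        have h2 : z - p ^ e' + p ^ e' = z := Nat.sub_add_cancel (by omega)
        rw [← dec_add_pow h.hp ζ e' (z - p ^ e') (by rw [h2, ← he']; exact hz), h2]
      refine ⟨?_, fun k hk => ?_⟩
      · simp [e1, e2, hqp, hzq]
        rw [hA'.setv .z z (by simp) (by simp) |>.fadd (x := ζ * dec p ζ (z - p ^ e')) (y := ζ ^ e)]
        · rw [h1, he', pow_succ]; congr 1; ring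
        · simp [e1, e2, hqp]
          exact hI _ (by omega)
        · simp [e3]
      · simp [e2, e1, hqp, hzq, hk.ne]
  rw [key _ (by simpa [hA.vq] using h.lt x), h.dec_enc]

/-- Recursion on the second factor: strip a lowest digit 0 and multiply by ζ, or lower a nonzero
lowest digit by 1 and add the first factor. -/
theorem mulS_run (h : Coding p e ζ enc) {s : St} (hA : AddEnv p e enc s)
    (hz : ∀ x, s.a .mulz (enc x) = enc (ζ * x)) (x y : F) :
    (mulS.run s).a .mul (enc x * p ^ e + enc y) = enc (x * y) := by
  have hp0 : 0 < p := (Nat.zero_le _).trans_lt h.hp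
  have hq0 : 0 < p ^ e := by positivity
  have key : ∀ z < (Expr.op .mul (.var .q) (.var .q)).eval s, (mulS.run s).a .mul z =
      enc (dec p ζ (z / p ^ e) * dec p ζ (z % p ^ e)) := by
    refine Stmt.for_fill .mul (fun z => enc (dec p ζ (z / p ^ e) * dec p ζ (z % p ^ e))) ?_
    intro z hz' s' hF hI
    have hA' := hA.frame hF rfl rfl rfl
    have e1 := hA'.vp
    have e2 := hA'.vq
    have e3 : ∀ x, s'.a .mulz (enc x) = enc (ζ * x) := fun x => by rw [hF.a .mulz rfl, hz]
    replace hz' : z < p ^ e * p ^ e := by simpa [Expr.eval, BinOp.eval, hA.vq] using hz'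
    have hx := Nat.div_lt_of_lt_mul hz'
    have hy := Nat.mod_lt z hq0
    have hxy : z / p ^ e * p ^ e + z % p ^ e = z := Nat.div_add_mod' z _
    generalize z / p ^ e = x at *
    generalize z % p ^ e = y at *
    subst hxy
    refine ⟨?_, fun k hk => ?_⟩
    · by_cases h1 : y = 0
      · subst h1
        have := div_mul_add (x := x) hq0
        simp [e2, dec_zero, h.enc_zero]
      · by_cases h2 : y % p = 0
        · have hy' : y / p < y := Nat.div_lt_self (by omega) h.hp
          have h3 : dec p ζ y = ζ * dec p ζ (y / p) := by
            rw [dec_step h.hp ζ y, h2]; simp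
          have := hI (x * p ^ e + y / p) (by omega)
          rw [div_mul_add (by omega), mod_mul_add (by omega)] at this
          simp [e1, e2, div_mul_add hy, mod_mul_add hy, h1, h2, -Nat.mul_add_mod_self_right, this, e3]
          rw [h3]; congr 1; ring
        · have h3 : dec p ζ y = dec p ζ (y - 1) + 1 := by
            have h4 := Nat.mod_add_div y p
            have h5 : y - 1 = (y % p - 1) + p * (y / p) := by omega
            have h6 := Nat.mod_lt y hp0
            rw [dec_step h.hp ζ y, h5, dec_mul_add h.hp ζ _ _ (by omega), Nat.cast_sub (by omega)]
            push_cast; ring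
          have := hI (x * p ^ e + (y - 1)) (by omega)
          rw [div_mul_add (by omega), mod_mul_add (by omega)] at this
          simp [e1, e2, div_mul_add hy, mod_mul_add hy, h1, h2, -Nat.mul_add_mod_self_right]
          rw [hA'.setv .z _ (by simp) (by simp) |>.fadd
            (x := dec p ζ x * dec p ζ (y - 1)) (y := dec p ζ x)]
          · rw [h3]; congr 1; ring
          · simp
            rw [show x * p ^ e + y - 1 = x * p ^ e + (y - 1) by omega, this]
          · simp [e2, div_mul_add hy, h.enc_dec x hx]
    · simp only [run_ite]
      split_ifs <;> simp [hk.ne]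
  rw [key _ (by simpa [Expr.eval, BinOp.eval, hA.vq] using mul_add_lt (h.lt x) (h.lt y)), div_mul_add (h.lt y), mod_mul_add (h.lt y),
    h.dec_enc, h.dec_enc]

/-- The parameters of the field and its tables are in place. -/
structure FieldEnv (p e : ℕ) (enc : F → ℕ) (s : St) : Prop extends AddEnv p e enc s where
  mul : ∀ x y, s.a .mul (enc x * p ^ e + enc y) = enc (x * y)

theorem FieldEnv.frame {s s' : St} (h : FieldEnv p e enc s) {P : Stmt} (hF : P.Frame s s')
    (h1 : P.modv .p = false) (h2 : P.modv .q = false) (h3 : P.moda .add = false)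
    (h4 : P.moda .mul = false) : FieldEnv p e enc s' :=
  ⟨h.toAddEnv.frame hF h1 h2 h3, fun x y => by rw [hF.a _ h4, h.mul]⟩

theorem FieldEnv.setv {s : St} (h : FieldEnv p e enc s) (x : Var) (n : ℕ) (h1 : Var.p ≠ x)
    (h2 : Var.q ≠ x) : FieldEnv p e enc (s.setv x n) :=
  ⟨h.toAddEnv.setv x n h1 h2, h.mul⟩

theorem FieldEnv.fmul {s : St} (h : FieldEnv p e enc s) {a b : Expr} {x y : F}
    (ha : a.eval s = enc x) (hb : b.eval s = enc y) : (fmul a b).eval s = enc (x * y) := by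
  simp [MME.fmul, ha, hb, h.vq, h.mul]

end Tables
end MME

/-! ## Sums and truncated power series -/

namespace MME
open ForLang ForLang.Stmt

section Series
variable {F : Type*} [Field F] {p e r : ℕ} {ζ : F} {enc : F → ℕ}

theorem sumS_run (h : Coding p e ζ enc) {s : St} (hA : AddEnv p e enc s) {x : Var} {n a : Expr}
    (hx : Var.acc ≠ x ∧ Var.p ≠ x ∧ Var.q ≠ x) (N : ℕ) (hn : n.eval (s.setv .acc 0) = N) (φ : ℕ → F)
    (ha : ∀ i < N, ∀ s', (sumS x n a).Frame s s' → a.eval (s'.setv x i) = enc (φ i)) :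
    ((sumS x n a).run s).v .acc = enc (∑ i ∈ Finset.range N, φ i) := by
  subst hn
  refine Stmt.for_ind (s := s.setv .acc 0)
    (I := fun i s' => s'.v .acc = enc (∑ j ∈ Finset.range i, φ j)) (by simp [h.enc_zero]) ?_
  intro i hi s' hF hI
  have hF' : (sumS x n a).Frame s s' := by
    refine ⟨fun y hy => ?_, fun B hB => hF.a B hB⟩
    simp only [sumS, modv, Bool.or_eq_false_iff, decide_eq_false_iff_not] at hy
    rw [hF.v y (by simp [modv, hy])]
    simp [hy]
  have hA' : AddEnv p e enc s' := hA.frame hF' (by simp [sumS, modv, hx]) (by simp [sumS, modv, hx]) rfl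
  rw [run_assign, St.setv_v, if_pos rfl, Finset.sum_range_succ]
  exact (hA'.setv x i hx.2.1 hx.2.2).fadd (by simp [hx, hI]) (ha i hi s' hF')

/-- The word array `f` holds the first `r` coefficients of a series from place `o` on. -/
def IsSer (enc : F → ℕ) (r : ℕ) (f : ℕ → ℕ) (o : ℕ) (φ : PowerSeries F) : Prop :=
  ∀ k < r, f (o + k) = enc (PowerSeries.coeff k φ)

/-- The field and the precision of the power series are in place. -/
structure SerEnv (p e r : ℕ) (enc : F → ℕ) (s : St) : Prop extends FieldEnv p e enc s where
  vr : s.v .r = r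

theorem SerEnv.frame {s s' : St} (h : SerEnv p e r enc s) {P : Stmt} (hF : P.Frame s s')
    (h1 : P.modv .p = false) (h2 : P.modv .q = false) (h3 : P.moda .add = false)
    (h4 : P.moda .mul = false) (h5 : P.modv .r = false) : SerEnv p e r enc s' :=
  ⟨h.toFieldEnv.frame hF h1 h2 h3 h4, (hF.v _ h5).trans h.vr⟩

theorem setSerS_run {s : St} (hr : s.v .r = r) {A : Arr} {o a : Expr} (o' : ℕ) (g : ℕ → ℕ)
    (ho : ∀ k < r, ∀ s', (setSerS A o a).Frame s s' → o.eval (s'.setv .u k) = o')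
    (ha : ∀ k < r, ∀ s', (setSerS A o a).Frame s s' → a.eval (s'.setv .u k) = g k) (i : ℕ) :
    ((setSerS A o a).run s).a A i = if o' ≤ i ∧ i < o' + r then g (i - o') else s.a A i := by
  subst hr
  refine Stmt.for_ind (I := fun k s' => s'.a A i = if o' ≤ i ∧ i < o' + k then g (i - o') else s.a A i)
    (by simp) ?_
  intro k hk s' hF hI
  have h1 := ho k hk s' hF
  have h2 := ha k hk s' hF
  rw [run_store, Expr.eval_add, h1, h2]
  simp only [Expr.eval_var, St.setv_v, St.seta_a, St.setv_a, hI, if_true, true_and]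
  by_cases h3 : i = o' + k
  · subst h3; simp
  · rw [if_neg h3]
    refine if_congr ?_ rfl rfl
    omega

theorem isSer_setSerS {s : St} (hr : s.v .r = r) {A : Arr} {o a : Expr} (o' : ℕ) (φ : PowerSeries F)
    (ho : ∀ k < r, ∀ s', (setSerS A o a).Frame s s' → o.eval (s'.setv .u k) = o')
    (ha : ∀ k < r, ∀ s', (setSerS A o a).Frame s s' →
      a.eval (s'.setv .u k) = enc (PowerSeries.coeff k φ)) :
    IsSer enc r (((setSerS A o a).run s).a A) o' φ := by
  intro k hk
  rw [setSerS_run hr o' (fun k => enc (PowerSeries.coeff k φ)) ho ha, if_pos (by omega)]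
  simp

/-- Every coefficient of the product needs old entries of `W`, so the result is collected in `tmp`
and copied back; hence `A ≠ .tmp`. Squaring with `A = .W` is still allowed here, unlike in
`powSerS_run`. -/
theorem mulSerS_run (h : Coding p e ζ enc) {s : St} (hs : SerEnv p e r enc s) {A : Arr} {o : Expr}
    (hA : A ≠ .tmp) (o' : ℕ) {φ ψ : PowerSeries F}
    (ho : ∀ s', (mulSerS A o).Frame s s' → o.eval s' = o')
    (hφ : IsSer enc r (s.a .W) 0 φ) (hψ : IsSer enc r (s.a A) o' ψ) :
    IsSer enc r (((mulSerS A o).run s).a .W) 0 (φ * ψ) := by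
  set P : Stmt := .loop .u Var.r (sumS .i (Var.u + 1)
    (fmul (.get .W Var.i) (.get A (o + (Var.u - Var.i)))) ;; .store .tmp Var.u Var.acc) with hP
  have hFP : ∀ s', P.Frame s s' → (mulSerS A o).Frame s s' := fun s' hF =>
    ⟨fun y hy => hF.v y (by simp [mulSerS, sumS, modv, hP] at hy ⊢; tauto),
      fun B hB => hF.a B (by simp [mulSerS, sumS, moda, hP] at hB ⊢; tauto)⟩
  have h1 : ∀ k < (Expr.var .r).eval s, (P.run s).a .tmp k = enc (PowerSeries.coeff k (φ * ψ)) := by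
    refine Stmt.for_fill .tmp (fun k => enc (PowerSeries.coeff k (φ * ψ))) ?_
    intro k hk s' hF hI
    replace hk : k < r := by simpa [hs.vr] using hk
    refine ⟨?_, fun k' hk' => ?_⟩
    · rw [run_seq, run_store]
      have e1 : ((sumS .i (Var.u + 1) (fmul (.get .W Var.i) (.get A (o + (Var.u - Var.i))))).run
          (s'.setv .u k)).v .acc =
          enc (∑ i ∈ Finset.range (k + 1), PowerSeries.coeff i φ * PowerSeries.coeff (k - i) ψ) := by
        have hA' := hs.frame hF rfl rfl rfl rfl rfl
        refine sumS_run h (hA'.toAddEnv.setv .u k (by simp) (by simp)) (by simp) _ (by simp) _ ?_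
        intro i hi s'' hF''
        have hF3 : P.Frame s s'' := by
          refine ⟨fun y hy => ?_, fun B hB => ?_⟩
          · have := hF.v y hy
            simp [hP, sumS, modv] at hy
            rw [hF''.v y (by simp [sumS, modv, hy])]
            simp [hy, this]
          · have := hF.a B hB
            rw [hF''.a B rfl, St.setv_a, this]
        have hF4 : P.Frame s (s''.setv .i i) := by
          refine ⟨fun y hy => ?_, fun B hB => hF3.a B hB⟩
          have := hF3.v y hy
          simp [hP, sumS, modv] at hy
          simp [hy, this]
        refine (hs.toFieldEnv.frame hF4 rfl rfl rfl rfl).fmul ?_ ?_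
        · simp only [Expr.eval_get, Expr.eval_var, St.setv_v, if_true]
          rw [hF4.a .W rfl, ← hφ i (by omega), zero_add]
        · have hu : s''.v .u = k := by rw [hF''.v .u rfl]; simp
          simp only [Expr.eval_get, Expr.eval_var, Expr.eval_add, Expr.eval_sub, St.setv_v, if_true,
            ho _ (hFP _ hF4)]
          rw [hF4.a A (by simp [hP, sumS, moda, hA])]
          simp [hu]
          exact hψ _ (by omega)
      have e2 : ((sumS .i (Var.u + 1) (fmul (.get .W Var.i) (.get A (o + (Var.u - Var.i))))).run
          (s'.setv .u k)).v .u = k := by rw [run_v _ _ rfl]; simp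
      simp only [Expr.eval_var, St.seta_a, e1, e2, true_and, if_true]
      rw [PowerSeries.coeff_mul, Finset.Nat.sum_antidiagonal_eq_sum_range_succ_mk]
    · rw [run_seq, run_store]
      have e2 : ((sumS .i (Var.u + 1) (fmul (.get .W Var.i) (.get A (o + (Var.u - Var.i))))).run
          (s'.setv .u k)).v .u = k := by rw [run_v _ _ rfl]; simp
      simp only [Expr.eval_var, St.seta_a, e2, true_and]
      rw [if_neg hk'.ne, run_a _ _ rfl, St.setv_a]
  have h2 : (P.run s).v .r = r := by rw [run_v _ _ rfl, hs.vr]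
  have h3 : ∀ k < (Expr.var .r).eval (P.run s), ((mulSerS A o).run s).a .W k =
      enc (PowerSeries.coeff k (φ * ψ)) := by
    refine Stmt.for_fill .W (fun k => enc (PowerSeries.coeff k (φ * ψ))) ?_
    intro k hk s' hF hI
    refine ⟨?_, fun k' hk' => by simp [hk'.ne]⟩
    simp [hF.a .tmp rfl]
    exact h1 k (by simpa [h2, hs.vr] using hk)
  intro k hk
  rw [zero_add]
  exact h3 k (by simpa [h2] using hk)

theorem powSerS_run (h : Coding p e ζ enc) {s : St} (hs : SerEnv p e r enc s) {A : Arr} {n o : Expr}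
    (hA : A ≠ .tmp) (hW : A ≠ .W) (o' : ℕ) {φ ψ : PowerSeries F}
    (ho : ∀ s', (Stmt.loop .j n (mulSerS A o)).Frame s s' → o.eval s' = o')
    (hφ : IsSer enc r (s.a .W) 0 φ) (hψ : IsSer enc r (s.a A) o' ψ) :
    IsSer enc r (((Stmt.loop .j n (mulSerS A o)).run s).a .W) 0 (φ * ψ ^ n.eval s) := by
  refine Stmt.for_ind (I := fun i s' => IsSer enc r (s'.a .W) 0 (φ * ψ ^ i)) (by simpa using hφ) ?_
  intro i hi s' hF hI
  rw [pow_succ, ← mul_assoc]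
  have hs' := hs.frame hF rfl rfl rfl rfl rfl
  refine mulSerS_run h ⟨hs'.toFieldEnv.setv .j i (by simp) (by simp), by simp [hs'.vr]⟩ hA o'
    ?_ hI ?_
  · intro s'' hF''
    refine ho s'' ⟨fun y hy => ?_, fun B hB => ?_⟩
    · have := hF.v y hy
      simp only [modv, Bool.or_eq_false_iff, decide_eq_false_iff_not] at hy
      rw [hF''.v y hy.2]
      simp [hy.1, this]
    · rw [hF''.a B hB, St.setv_a, hF.a B hB]
  · have : (Stmt.loop Var.j n (mulSerS A o)).moda A = false := by
      simp [moda, mulSerS, sumS, hA, hW]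
    rw [St.setv_a, hF.a A this]
    exact hψ

end Series
end MME

/-! ## Curves and weights -/

namespace MME
open ForLang ForLang.Stmt

/-- Names the configuration between two statements and keeps its frame, so long sequences are
handled without nested terms. -/
theorem run_seq_split {P Q : Stmt} {s s' : St} (h : s' = (P ;; Q).run s) :
    ∃ s₁, P.Frame s s₁ ∧ s₁ = P.run s ∧ s' = Q.run s₁ :=
  ⟨_, P.frame s, rfl, h⟩

section Series
variable {F : Type*} [Field F] {p e r : ℕ} {ζ : F} {enc : F → ℕ}

theorem Coding.enc_ite (h : Coding p e ζ enc) (P : Prop) [Decidable P] :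
    enc (if P then 1 else 0) = if P then 1 else 0 := by
  split_ifs
  exacts [h.enc_one, h.enc_zero]

theorem isSer_one (h : Coding p e ζ enc) {s : St} (hr : s.v .r = r) (A : Arr) :
    IsSer enc r (((setSerS A 0 (.op .eq Var.u 0)).run s).a A) 0 1 := by
  refine isSer_setSerS hr 0 1 (by simp) fun k _ s' _ => ?_
  simp [PowerSeries.coeff_one, h.enc_ite]

theorem isSer_copy {s : St} (hr : s.v .r = r) {A B : Arr} (hAB : A ≠ B) {φ : PowerSeries F}
    {o : Expr} (o' : ℕ) (ho : ∀ k < r, ∀ s', (setSerS B o (.get A Var.u)).Frame s s' →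
      o.eval (s'.setv .u k) = o') (h : IsSer enc r (s.a A) 0 φ) :
    IsSer enc r (((setSerS B o (.get A Var.u)).run s).a B) o' φ := by
  refine isSer_setSerS hr o' φ ho fun k hk s' hF => ?_
  simp [hF.a A (by simp [setSerS, moda, hAB])]
  rw [← h k hk, zero_add]

/-- The exponent of the root is exponential in r, but its recursion gives root(i+1) =
(1+X)·root(i)^q. Thus r rounds of q multiplications suffice. -/
theorem rootS_run (h : Coding p e ζ enc) {s : St} (hs : SerEnv p e r enc s) :
    IsSer enc r ((rootS.run s).a .U) 0 (1 + PowerSeries.X) ∧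
    IsSer enc r ((rootS.run s).a .T) 0 (root (p ^ e) r) := by
  obtain ⟨s', e'⟩ : ∃ s', s' = rootS.run s := ⟨_, rfl⟩
  rw [← e']
  obtain ⟨s₁, F₁, e₁, e'⟩ := run_seq_split e'
  obtain ⟨s₂, F₂, e₂, e'⟩ := run_seq_split e'
  have hs₁ := hs.frame F₁ rfl rfl rfl rfl rfl
  have hs₂ := hs₁.frame F₂ rfl rfl rfl rfl rfl
  have hU : IsSer enc r (s₁.a .U) 0 (1 + PowerSeries.X) := by
    rw [e₁]
    refine isSer_setSerS hs.vr 0 _ (by simp) fun k _ s' _ => ?_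
    have : (PowerSeries.coeff k (1 + PowerSeries.X) : F) = if k < 2 then 1 else 0 := by
      rcases k with _ | _ | k
      · simp
      · simp
      · simp [PowerSeries.coeff_X, PowerSeries.coeff_one]
    simp [this, h.enc_ite]
  rw [← F₂.a .U rfl] at hU
  have hT : IsSer enc r (s₂.a .T) 0 1 := by
    rw [e₂]; exact isSer_one h hs₁.vr .T
  have key : IsSer enc r (s'.a .U) 0 (1 + PowerSeries.X) ∧
      IsSer enc r (s'.a .T) 0 (root (p ^ e) ((Expr.var .r).eval s₂)) := by
    rw [e']
    refine Stmt.for_ind (I := fun i s' => IsSer enc r (s'.a .U) 0 (1 + PowerSeries.X) ∧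
      IsSer enc r (s'.a .T) 0 (root (p ^ e) i)) ⟨hU, by simpa [root, geomExp] using hT⟩ ?_
    rintro i hi t hF ⟨hU, hT⟩
    have ht := hs₂.frame hF rfl rfl rfl rfl rfl
    obtain ⟨t', E'⟩ : ∃ t', t' = Stmt.run (setSerS .W 0 (.get .U Var.u) ;;
      .loop .j Var.q (mulSerS .T 0) ;; setSerS .T 0 (.get .W Var.u)) (t.setv .x i) := ⟨_, rfl⟩
    rw [← E']
    have ht₀ : SerEnv p e r enc (t.setv .x i) :=
      ⟨ht.toFieldEnv.setv .x i (by simp) (by simp), by simp [ht.vr]⟩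
    obtain ⟨t₁, G₁, E₁, E'⟩ := run_seq_split E'
    obtain ⟨t₂, G₂, E₂, E'⟩ := run_seq_split E'
    have ht₁ := ht₀.frame G₁ rfl rfl rfl rfl rfl
    have ht₂ := ht₁.frame G₂ rfl rfl rfl rfl rfl
    have hW₁ : IsSer enc r (t₁.a .W) 0 (1 + PowerSeries.X) := by
      rw [E₁]; exact isSer_copy ht₀.vr (by simp) 0 (by simp) hU
    have hW₂ : IsSer enc r (t₂.a .W) 0 ((1 + PowerSeries.X) * root (p ^ e) i ^ (p ^ e)) := by
      have := powSerS_run (A := .T) (n := .var .q) (o := 0) h ht₁ (by simp) (by simp) 0 (by simp)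
        hW₁ (by rw [G₁.a .T rfl]; exact hT)
      rw [← E₂] at this
      simpa [ht₁.vq] using this
    constructor
    · rw [E', run_a _ _ rfl, G₂.a .U rfl, G₁.a .U rfl]; exact hU
    · have : root (F := F) (p ^ e) (i + 1) = (1 + PowerSeries.X) * root (p ^ e) i ^ (p ^ e) := by
        rw [root, root, geomExp, pow_add, pow_one, mul_comm (p ^ e), pow_mul]
      rw [E', this]
      exact isSer_copy ht₂.vr (by simp) 0 (by simp) hW₂
  rwa [show (Expr.var .r).eval s₂ = r from hs₂.vr] at key

theorem curveParamS_run (h : Coding p e ζ enc) {s : St} (hs : AddEnv p e enc s) :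
    (curveParamS.run s).v .n = (p ^ e - 1) / (s.v .d' - 1) ∧
    (curveParamS.run s).v .b = enc (-((s.v .d' - 1 : ℕ) : F)) := by
  refine ⟨?_, ?_⟩
  · change (Stmt.run (.loop .i (Var.d' - 1) (.b ≔ fadd Var.b (Var.p - 1))) _).v .n = _
    rw [run_v _ _ rfl]
    simp [hs.vq]
  · have := Stmt.for_ind (x := .i) (n := Var.d' - 1) (P := .b ≔ fadd Var.b (Var.p - 1))
      (s := ((Stmt.assign false .n ((Var.q - 1) / (Var.d' - 1))) ;; .b ≔ 0).run s)
      (I := fun i s' => s'.v .b = enc (-(i : F))) (by simp [h.enc_zero]) ?_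
    · simpa [curveParamS] using this
    · intro i hi s' hF hI
      have hs' : AddEnv p e enc s' := ((hs.setv .n _ (by simp) (by simp)).setv .b _ (by simp)
        (by simp)).frame hF rfl rfl rfl
      rw [run_assign, St.setv_v, if_pos rfl, (hs'.setv .i i (by simp) (by simp)).fadd
        (x := -(i : F)) (y := -1) (by simpa using hI) (by simp [hs'.vp, h.enc_neg_one])]
      push_cast
      congr 1; ring

theorem degS_run {s : St} {d m X oF D : ℕ} (hd : s.v .d = d) (hm : s.v .m = m) (hX : s.v .X = X)
    (hoF : s.v .oF = oF) (hd0 : 0 < d)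
    (hD : ∀ k < X, s.a .inp (oF + k) ≠ 0 → ∑ l ∈ Finset.range m, k / d ^ l % d = D)
    (hex : ∃ k < X, s.a .inp (oF + k) ≠ 0) : (degS.run s).v .D = D := by
  obtain ⟨s', e'⟩ : ∃ s', s' = degS.run s := ⟨_, rfl⟩
  rw [← e']
  obtain ⟨s₁, F₁, e₁, e'⟩ := run_seq_split e'
  suffices key : ∀ k < (Expr.var .X).eval s₁, s.a .inp (oF + k) ≠ 0 → s'.v .D = D by
    obtain ⟨k, hk, hk'⟩ := hex
    exact key k (by simpa [F₁.v .X rfl, hX] using hk) hk'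
  rw [e']
  refine Stmt.for_ind (I := fun i s' => ∀ k < i, s.a .inp (oF + k) ≠ 0 → s'.v .D = D)
    (by simp) ?_
  intro k hk t hF hI k' hk' hne
  have hk : k < X := by simpa [F₁.v .X rfl, hX] using hk
  have g1 : t.v .d = d := by rw [hF.v .d rfl, F₁.v .d rfl, hd]
  have g2 : t.v .m = m := by rw [hF.v .m rfl, F₁.v .m rfl, hm]
  have g3 : t.v .oF = oF := by rw [hF.v .oF rfl, F₁.v .oF rfl, hoF]
  have g4 : t.a .inp = s.a .inp := by rw [hF.a .inp rfl, F₁.a .inp rfl]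
  rw [run_ite]
  split_ifs with hc
  · have hne' : s.a .inp (oF + k) ≠ 0 := by simpa [g3, g4] using hc
    rw [← hD k hk hne']
    have := Stmt.for_ind (x := .j) (n := .var .m)
      (P := .D ≔ .op .guard (Var.D + Var.y % Var.d) (Var.m * Var.d + 1) ;; .y ≔ Var.y / Var.d)
      (s := ((Stmt.assign false .D 0) ;; .y ≔ Var.k).run (t.setv .k k))
      (I := fun j s' => s'.v .D = ∑ l ∈ Finset.range j, k / d ^ l % d ∧ s'.v .y = k / d ^ j)
      (by simp) ?_
    · simpa [g2] using this.1
    · rintro j hj u hF' ⟨h1, h2⟩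
      replace hj : j < m := by simpa [g2] using hj
      have k1 : u.v .d = d := by rw [hF'.v .d rfl]; simp [g1]
      have k2 : u.v .m = m := by rw [hF'.v .m rfl]; simp [g2]
      -- The guard on the degree is never active, since each digit is below d.
      have hlt : ∑ l ∈ Finset.range (j + 1), k / d ^ l % d < m * d + 1 := by
        have : ∑ l ∈ Finset.range (j + 1), k / d ^ l % d ≤ ∑ l ∈ Finset.range (j + 1), d :=
          Finset.sum_le_sum fun l _ => (Nat.mod_lt _ hd0).le
        rw [Finset.sum_const, Finset.card_range, smul_eq_mul] at this
        have := Nat.mul_le_mul_right d hj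
        rw [Nat.succ_eq_add_one] at this
        omega
      rw [Finset.sum_range_succ] at hlt
      constructor
      · simp [k1, k2, h1, h2, hlt, Finset.sum_range_succ]
      · simp [k1, h2, pow_succ, Nat.div_div_eq_div_mul]
  · have hz : s.a .inp (oF + k) = 0 := by simpa [g3, g4] using hc
    rcases Nat.lt_succ_iff_lt_or_eq.1 hk' with hk' | rfl
    · simpa using hI k' hk' hne
    · exact absurd hz hne

/-- The parameters and results that describe the curves. -/
theorem curveS_run (h : Coding p e ζ enc) {s : St} (hs : SerEnv p e r enc s) (hr : 0 < r) {n : ℕ} {b : F}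
    (hn : s.v .n = n) (hb : s.v .b = enc b)
    (hT : IsSer enc r (s.a .T) 0 (root (p ^ e) r)) (x : F) :
    (curveS.run s).a .val (enc x) = enc (base n b x) ∧
    IsSer enc r ((curveS.run s).a .del) (enc x * r) (increment (p ^ e) r n b x) := by
  suffices key : ∀ x, enc x < (Expr.var .q).eval s →
      (curveS.run s).a .val (enc x) = enc (base n b x) ∧
      IsSer enc r ((curveS.run s).a .del) (enc x * r) (increment (p ^ e) r n b x) from
    key x (by simpa [hs.vq] using h.lt x)
  refine Stmt.for_ind (I := fun i s' => ∀ x, enc x < i → s'.a .val (enc x) = enc (base n b x) ∧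
      IsSer enc r (s'.a .del) (enc x * r) (increment (p ^ e) r n b x)) (by simp) ?_
  intro i hi t hF hI x hx
  obtain ⟨c, rfl⟩ := h.exists_enc (show i < p ^ e by simpa [hs.vq] using hi)
  obtain ⟨t', E'⟩ : ∃ t', t' = Stmt.run (.bc ≔ fmul Var.b Var.c ;;
    setSerS .V 0 (fadd (.op .eq Var.u 0) (fmul Var.bc (.get .T Var.u))) ;;
    setSerS .W 0 (.op .eq Var.u 0) ;; .loop .j Var.n (mulSerS .V 0) ;;
    .store .val Var.c (fadd (.get .W 0) (Var.p - 1)) ;; .store .W 0 0 ;;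
    setSerS .del (Var.c * Var.r) (.get .W Var.u)) (t.setv .c (enc c)) := ⟨_, rfl⟩
  rw [← E']
  have ht := hs.frame hF rfl rfl rfl rfl rfl
  have ht₀ : SerEnv p e r enc (t.setv .c (enc c)) :=
    ⟨ht.toFieldEnv.setv .c _ (by simp) (by simp), by simp [ht.vr]⟩
  obtain ⟨t₁, G₁, E₁, E'⟩ := run_seq_split E'
  obtain ⟨t₂, G₂, E₂, E'⟩ := run_seq_split E'
  obtain ⟨t₃, G₃, E₃, E'⟩ := run_seq_split E'
  obtain ⟨t₄, G₄, E₄, E'⟩ := run_seq_split E'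
  obtain ⟨t₅, G₅, E₅, E'⟩ := run_seq_split E'
  obtain ⟨t₆, G₆, E₆, E'⟩ := run_seq_split E'
  have ht₁ := ht₀.frame G₁ rfl rfl rfl rfl rfl
  have ht₂ := ht₁.frame G₂ rfl rfl rfl rfl rfl
  have ht₃ := ht₂.frame G₃ rfl rfl rfl rfl rfl
  have ht₄ := ht₃.frame G₄ rfl rfl rfl rfl rfl
  have ht₅ := ht₄.frame G₅ rfl rfl rfl rfl rfl
  have ht₆ := ht₅.frame G₆ rfl rfl rfl rfl rfl
  have hbc : t₁.v .bc = enc (b * c) := by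
    rw [E₁, run_assign, St.setv_v, if_pos rfl, ht₀.toFieldEnv.fmul (x := b) (y := c)]
    · simp [hF.v .b rfl, hb]
    · simp
  have hV : IsSer enc r (t₂.a .V) 0 (1 + PowerSeries.C (b * c) * root (p ^ e) r) := by
    rw [E₂]
    refine isSer_setSerS ht₁.vr 0 _ (by simp) fun k hk t'' hF'' => ?_
    have hk'' : FieldEnv p e enc (t''.setv .u k) :=
      (ht₁.toFieldEnv.frame hF'' rfl rfl rfl rfl).setv .u k (by simp) (by simp)
    rw [map_add, PowerSeries.coeff_C_mul, PowerSeries.coeff_one]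
    refine hk''.fadd (by simp [h.enc_ite]) (hk''.fmul ?_ ?_)
    · simp [hF''.v .bc rfl, hbc]
    · simp [hF''.a .T rfl, G₁.a .T rfl, hF.a .T rfl]
      rw [← hT k hk, zero_add]
  have hW₃ : IsSer enc r (t₃.a .W) 0 1 := by
    rw [E₃]; exact isSer_one h ht₂.vr .W
  have hn₃ : t₃.v .n = n := by rw [G₃.v .n rfl, G₂.v .n rfl, G₁.v .n rfl]; simp [hF.v .n rfl, hn]
  have hW₄ : IsSer enc r (t₄.a .W) 0 (curve (p ^ e) r n b c) := by
    have := powSerS_run (A := .V) (n := .var .n) (o := 0) h ht₃ (by simp) (by simp) 0 (by simp)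
      hW₃ (by rw [G₃.a .V rfl]; exact hV)
    rw [← E₄] at this
    simpa [curve, hn₃] using this
  have hc₄ : t₄.v .c = enc c := by
    rw [G₄.v .c rfl, G₃.v .c rfl, G₂.v .c rfl, G₁.v .c rfl]; simp
  have hval₄ : t₄.a .val = t.a .val := by
    rw [G₄.a .val rfl, G₃.a .val rfl, G₂.a .val rfl, G₁.a .val rfl]; rfl
  have hval : t'.a .val (enc x) = enc (base n b x) := by
    rw [E', run_a _ _ rfl, G₆.a .val rfl, E₅, run_store, St.seta_a]
    have hx' : enc c = (Expr.var .c).eval t₄ := hc₄.symm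
    rw [← hx']
    by_cases hxc : x = c
    · rw [if_pos ⟨rfl, by rw [hxc]⟩, ht₄.fadd (x := base n b c + 1) (y := -1)]
      · rw [hxc]; congr 1; ring
      · have := hW₄ 0 hr
        rw [PowerSeries.coeff_zero_eq_constantCoeff_apply, constantCoeff_curve] at this
        simpa using this
      · simp [ht₄.vp, h.enc_neg_one]
    · rw [if_neg fun h' => hxc (h.enc_inj.1 h'.2), hval₄]
      have : enc x ≠ enc c := fun h' => hxc (h.enc_inj.1 h')
      exact (hI x (by omega)).1
  refine ⟨hval, ?_⟩
  have hW₆ : IsSer enc r (t₆.a .W) 0 (increment (p ^ e) r n b c) := by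
    intro k hk
    rw [E₆, run_store, St.seta_a, G₅.a .W rfl, increment, PowerSeries.coeff_mk]
    simp only [Expr.eval_zero, zero_add, true_and]
    split_ifs with hk0
    · exact h.enc_zero.symm
    · simpa using hW₄ k hk
  have hc₆ : t₆.v .c = enc c := by rw [G₆.v .c rfl, G₅.v .c rfl, hc₄]
  have ho : ∀ k < r, ∀ s', (setSerS .del (Var.c * Var.r) (.get .W Var.u)).Frame t₆ s' →
      Expr.eval (s'.setv .u k) (Var.c * Var.r) = enc c * r := by
    intro k hk s' hF'
    simp [hF'.v .c rfl, hF'.v .r rfl, hc₆, ht₆.vr]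
  by_cases hxc : x = c
  · rw [E', hxc]
    exact isSer_copy ht₆.vr (by simp) _ ho hW₆
  · have hlt : enc x < enc c := by
      have : enc x ≠ enc c := fun h' => hxc (h.enc_inj.1 h')
      omega
    intro k hk
    rw [E', setSerS_run ht₆.vr (enc c * r) (fun k => t₆.a .W k) ho, if_neg, G₆.a .del rfl,
      G₅.a .del rfl, G₄.a .del rfl, G₃.a .del rfl, G₂.a .del rfl, G₁.a .del rfl]
    · exact (hI x hlt).2 k hk
    · have := mul_add_lt hlt hk
      omega
    · intro k hk s' hF'
      simp [hF'.a .W rfl]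

theorem weightS_run (h : Coding p e ζ enc) {s : St} {s₀ D : ℕ} (hs : SerEnv p e (s₀ + 1) enc s)
    (hD : s.v .D = D) (hU : IsSer enc (s₀ + 1) (s.a .U) 0 (1 + PowerSeries.X))
    (hT : IsSer enc (s₀ + 1) (s.a .T) 0 (root (p ^ e) (s₀ + 1))) (x : F) :
    IsSer enc (s₀ + 1) ((weightS.run s).a .om) (enc x * (s₀ + 1)) (weight (p ^ e) s₀ D x) := by
  suffices key : ∀ x, enc x < (Expr.var .q).eval s →
      IsSer enc (s₀ + 1) ((weightS.run s).a .om) (enc x * (s₀ + 1)) (weight (p ^ e) s₀ D x) from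
    key x (by simpa [hs.vq] using h.lt x)
  refine Stmt.for_ind (I := fun i s' => ∀ x, enc x < i →
    IsSer enc (s₀ + 1) (s'.a .om) (enc x * (s₀ + 1)) (weight (p ^ e) s₀ D x)) (by simp) ?_
  intro i hi t hF hI x hx
  obtain ⟨c, rfl⟩ := h.exists_enc (show i < p ^ e by simpa [hs.vq] using hi)
  obtain ⟨t', E'⟩ : ∃ t', t' = Stmt.run (setSerS .V 0 (fmul Var.lam (.get .T Var.u)) ;;
    setSerS .W 0 (.op .eq Var.u 0) ;;
    .loop .j ((Var.q - 1) * (Var.D + 1) - Var.D) (mulSerS .V 0) ;;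
    .loop .j (Var.r + Var.D) (mulSerS .U 0) ;;
    setSerS .om (Var.lam * Var.r) (.get .W Var.u)) (t.setv .lam (enc c)) := ⟨_, rfl⟩
  rw [← E']
  have ht := hs.frame hF rfl rfl rfl rfl rfl
  have ht₀ : SerEnv p e (s₀ + 1) enc (t.setv .lam (enc c)) :=
    ⟨ht.toFieldEnv.setv .lam _ (by simp) (by simp), by simp [ht.vr]⟩
  obtain ⟨t₂, G₂, E₂, E'⟩ := run_seq_split E'
  obtain ⟨t₃, G₃, E₃, E'⟩ := run_seq_split E'
  obtain ⟨t₄, G₄, E₄, E'⟩ := run_seq_split E'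
  obtain ⟨t₅, G₅, E₅, E'⟩ := run_seq_split E'
  have ht₂ := ht₀.frame G₂ rfl rfl rfl rfl rfl
  have ht₃ := ht₂.frame G₃ rfl rfl rfl rfl rfl
  have ht₄ := ht₃.frame G₄ rfl rfl rfl rfl rfl
  have ht₅ := ht₄.frame G₅ rfl rfl rfl rfl rfl
  have hV : IsSer enc (s₀ + 1) (t₂.a .V) 0 (PowerSeries.C c * root (p ^ e) (s₀ + 1)) := by
    rw [E₂]
    refine isSer_setSerS ht₀.vr 0 _ (by simp) fun k hk t'' hF'' => ?_
    have hk'' : FieldEnv p e enc (t''.setv .u k) :=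
      (ht₀.toFieldEnv.frame hF'' rfl rfl rfl rfl).setv .u k (by simp) (by simp)
    rw [PowerSeries.coeff_C_mul]
    refine hk''.fmul ?_ ?_
    · simp [hF''.v .lam rfl]
    · simp [hF''.a .T rfl, hF.a .T rfl]
      rw [← hT k hk, zero_add]
  have hW₃ : IsSer enc (s₀ + 1) (t₃.a .W) 0 1 := by
    rw [E₃]; exact isSer_one h ht₂.vr .W
  have hD₃ : t₃.v .D = D := by rw [G₃.v .D rfl, G₂.v .D rfl]; simp [hF.v .D rfl, hD]
  have hW₄ := powSerS_run (A := .V) (n := (Var.q - 1) * (Var.D + 1) - Var.D) (o := 0) h ht₃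
    (by simp) (by simp) 0 (by simp) hW₃ (by rw [G₃.a .V rfl]; exact hV)
  rw [← E₄] at hW₄
  have hU₄ : t₄.a .U = s.a .U := by
    rw [G₄.a .U rfl, G₃.a .U rfl, G₂.a .U rfl, St.setv_a, hF.a .U rfl]
  have hW₅ := powSerS_run (A := .U) (n := Var.r + Var.D) (o := 0) h ht₄
    (by simp) (by simp) 0 (by simp) hW₄ (by rw [hU₄]; exact hU)
  rw [← E₅] at hW₅
  have hlam : t₅.v .lam = enc c := by
    rw [G₅.v .lam rfl, G₄.v .lam rfl, G₃.v .lam rfl, G₂.v .lam rfl]; simp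
  have ho : ∀ k < s₀ + 1, ∀ s', (setSerS .om (Var.lam * Var.r) (.get .W Var.u)).Frame t₅ s' →
      Expr.eval (s'.setv .u k) (Var.lam * Var.r) = enc c * (s₀ + 1) := by
    intro k hk s' hF'
    simp [hF'.v .lam rfl, hF'.v .r rfl, hlam, ht₅.vr]
  by_cases hxc : x = c
  · rw [E', hxc]
    refine isSer_copy ht₅.vr (by simp) _ ho ?_
    have hD₄ : t₄.v .D = D := by rw [G₄.v .D rfl, hD₃]
    simpa [weight, hD₃, hD₄, ht₃.vq, ht₄.vr] using hW₅
  · have hlt : enc x < enc c := by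
      have : enc x ≠ enc c := fun h' => hxc (h.enc_inj.1 h')
      omega
    intro k hk
    rw [E', setSerS_run ht₅.vr (enc c * (s₀ + 1)) (fun k => t₅.a .W k) ho, if_neg,
      G₅.a .om rfl, G₄.a .om rfl, G₃.a .om rfl, G₂.a .om rfl]
    · exact hI x hlt k hk
    · have := mul_add_lt hlt hk
      omega
    · intro k hk s' hF'
      simp [hF'.a .W rfl]

end Series
end MME

/-! ## The grid, the Taylor coefficients and the exponent vectors -/

namespace MME
open ForLang ForLang.Stmt

section Grid
variable {F : Type*} [Field F] {p e r : ℕ} {ζ : F} {enc : F → ℕ}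

/-- The values of the curves form a small set. -/
theorem card_base_le [Fintype F] [DecidableEq F] {n d' : ℕ} (hd : 2 ≤ d')
    (hn : n * (d' - 1) = Fintype.card F - 1) (b : F) :
    (Finset.univ.image (base n b)).card ≤ d' := by
  have hsub : Finset.univ.image (base n b) ⊆
      (insert 0 (Polynomial.nthRoots (d' - 1) (1 : F)).toFinset).image (· - 1) := by
    intro y hy
    obtain ⟨x, -, rfl⟩ := Finset.mem_image.1 hy
    refine Finset.mem_image.2 ⟨(1 + b * x) ^ n, ?_, rfl⟩
    have hn0 : n ≠ 0 := by
      rintro rfl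
      have : 1 < Fintype.card F := Fintype.one_lt_card
      omega
    rcases eq_or_ne (1 + b * x) 0 with h | h
    · simp [h, hn0]
    · rw [Finset.mem_insert, Multiset.mem_toFinset, Polynomial.mem_nthRoots (by omega), ← pow_mul, hn]
      exact Or.inr (FiniteField.pow_card_sub_one_eq_one _ h)
  refine (Finset.card_le_card hsub).trans (Finset.card_image_le.trans
    ((Finset.card_insert_le _ _).trans ?_))
  have := (Multiset.toFinset_card_le _).trans (Polynomial.card_nthRoots (d' - 1) (1 : F))
  omega

/-- The rank of a value is the number of values with smaller words, so at most d values have ranks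
below d. Unused places of `xs` keep the word 0 and pad the grid to d points per coordinate. -/
theorem gridS_run [Fintype F] [DecidableEq F] (h : Coding p e ζ enc) {s : St}
    (hs : AddEnv p e enc s) {n d : ℕ} {b : F}
    (hval : ∀ x, s.a .val (enc x) = enc (base n b x)) (hmark : ∀ i, s.a .mark i = 0)
    (hxs : ∀ i, s.a .xs i = 0) (hcard : (Finset.univ.image (base n b)).card ≤ d) :
    ∃ pts : ℕ → F, (∀ i, (gridS.run s).a .xs i = enc (pts i)) ∧
      ∀ x, (gridS.run s).a .rank (enc (base n b x)) < d ∧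
        pts ((gridS.run s).a .rank (enc (base n b x))) = base n b x := by
  classical
  obtain ⟨s', e'⟩ : ∃ s', s' = gridS.run s := ⟨_, rfl⟩
  rw [← e']
  obtain ⟨s₁, F₁, e₁, e'⟩ := run_seq_split e'
  obtain ⟨s₂, F₂, e₂, e'⟩ := run_seq_split e'
  let M : ℕ → Prop := fun k => ∃ x, k = enc (base n b x)
  have hM : ∀ k, s₁.a .mark k ≠ 0 ↔ M k := by
    have : ∀ k, s₁.a .mark k ≠ 0 ↔ ∃ x, enc x < (Expr.var .q).eval s ∧ k = enc (base n b x) := by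
      rw [e₁]
      refine Stmt.for_ind (I := fun i s' => ∀ k, s'.a .mark k ≠ 0 ↔
        ∃ x, enc x < i ∧ k = enc (base n b x)) (by simp [hmark]) ?_
      intro i hi t hF hI k
      obtain ⟨c, rfl⟩ := h.exists_enc (show i < p ^ e by simpa [hs.vq] using hi)
      simp only [run_store, Expr.eval_get, Expr.eval_var, St.setv_v, St.setv_a, if_true,
        hF.a .val rfl, hval, Expr.eval_one, St.seta_a, true_and]
      split_ifs with hk
      · exact ⟨fun _ => ⟨c, by omega, hk⟩, fun _ => one_ne_zero⟩
      · rw [hI]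
        refine ⟨fun ⟨x, h1, h2⟩ => ⟨x, by omega, h2⟩, fun ⟨x, h1, h2⟩ => ⟨x, ?_, h2⟩⟩
        have : enc x ≠ enc c := fun hh => hk (by rw [h2, h.enc_inj.1 hh])
        omega
    intro k
    rw [this]
    refine ⟨fun ⟨x, _, h2⟩ => ⟨x, h2⟩, fun ⟨x, h2⟩ => ⟨x, ?_, h2⟩⟩
    simpa [hs.vq] using h.lt x
  have hcount : Nat.count M (p ^ e) ≤ d := by
    rw [Nat.count_eq_card_filter_range]
    refine le_trans (Finset.card_le_card ?_)
      ((Finset.card_image_le (f := enc) (s := Finset.univ.image (base n b))).trans hcard)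
    intro k hk
    obtain ⟨-, x, hx⟩ := Finset.mem_filter.1 hk
    exact Finset.mem_image.2 ⟨_, Finset.mem_image_of_mem _ (Finset.mem_univ x), hx.symm⟩
  have hs₂ : AddEnv p e enc s₂ := (hs.frame F₁ rfl rfl rfl).frame F₂ rfl rfl rfl
  have key : s'.v .cnt = Nat.count M ((Expr.var .q).eval s₂) ∧
      (∀ z < (Expr.var .q).eval s₂, M z → s'.a .rank z = Nat.count M z ∧
        s'.a .xs (Nat.count M z) = z) ∧ ∀ k, s'.a .xs k < p ^ e := by
    rw [e']
    refine Stmt.for_ind (I := fun i s' => s'.v .cnt = Nat.count M i ∧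
      (∀ z < i, M z → s'.a .rank z = Nat.count M z ∧ s'.a .xs (Nat.count M z) = z) ∧
      ∀ k, s'.a .xs k < p ^ e) ⟨?_, by simp, ?_⟩ ?_
    · simp [e₂]
    · intro k
      rw [F₂.a .xs rfl, F₁.a .xs rfl, hxs]
      exact (Nat.zero_le _).trans_lt (h.lt 0)
    · rintro i hi t hF ⟨h1, h2, h3⟩
      replace hi : i < p ^ e := by simpa [hs₂.vq] using hi
      have g1 : t.v .q = p ^ e := (hs₂.frame hF rfl rfl rfl).vq
      have g2 : t.a .mark i ≠ 0 ↔ M i := by rw [hF.a .mark rfl, F₂.a .mark rfl, hM]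
      have hle : Nat.count M i < p ^ e := (Nat.count_le M).trans_lt hi
      by_cases hMi : M i
      · have g3 := g2.2 hMi
        refine ⟨?_, fun z hz hMz => ?_, fun k => ?_⟩
        · simp [g3, g1, h1, Nat.count_succ, hMi, hle]
        · rcases Nat.lt_succ_iff_lt_or_eq.1 hz with hz | rfl
          · have hne := (Nat.count_strict_mono hMz hz).ne
            simp [g3, h1, hz.ne, hne, h2 z hz hMz]
          · simp [g3, h1]
        · simp [g3]
          split_ifs
          exacts [hi, h3 k]
      · have g3 : t.a .mark i = 0 := by
          by_contra hh; exact hMi (g2.1 hh)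
        refine ⟨?_, fun z hz hMz => ?_, fun k => ?_⟩
        · simp [g3, h1, Nat.count_succ, hMi]
        · rcases Nat.lt_succ_iff_lt_or_eq.1 hz with hz | rfl
          · simp [g3, h1, hz.ne, h2 z hz hMz]
          · exact absurd hMz hMi
        · simpa [g3] using h3 k
  obtain ⟨-, k2, k3⟩ := key
  refine ⟨fun i => dec p ζ (s'.a .xs i), fun i => (h.enc_dec _ (k3 i)).symm, fun x => ?_⟩
  have hMx : M (enc (base n b x)) := ⟨x, rfl⟩
  obtain ⟨h1, h2⟩ := k2 (enc (base n b x)) (by simpa [hs₂.vq] using h.lt _) hMx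
  rw [h1]
  refine ⟨(Nat.count_strict_mono hMx (h.lt _)).trans_le hcount, ?_⟩
  change dec p ζ (s'.a .xs _) = _
  rw [h2, h.dec_enc]

/-- The Pascal-type recursion of `taylor`: the cells for (j, k+1) and (j, k) lie `r` and `r + 1`
places before the cell for (j+1, k+1). -/
theorem taylorS_run (h : Coding p e ζ enc) {s : St} (hs : SerEnv p e r enc s) (hr : 0 < r)
    {d : ℕ} (hd : s.v .d = d) (pts : ℕ → F) (hpts : ∀ i, s.a .xs i = enc (pts i))
    (x j k : ℕ) (hx : x < d) (hj : j < d) (hk : k < r) :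
    (taylorS.run s).a .pt ((x * d + j) * r + k) = enc (taylor (pts x) j k) := by
  have hd0 : 0 < d := by omega
  have key : ∀ z < (Expr.op .mul (.op .mul (.var .d) (.var .d)) (.var .r)).eval s,
      (taylorS.run s).a .pt z = enc (taylor (pts (z / r / d)) (z / r % d) (z % r)) := by
    refine Stmt.for_fill .pt (fun z => enc (taylor (pts (z / r / d)) (z / r % d) (z % r))) ?_
    clear hx hj hk x j k
    intro z hz t hF hI
    have ht := hs.frame hF rfl rfl rfl rfl rfl
    have g1 : t.v .d = d := (hF.v .d rfl).trans hd
    have g2 : ∀ i, t.a .xs i = enc (pts i) := fun i => by rw [hF.a .xs rfl, hpts]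
    have hk := Nat.mod_lt z hr
    have hj := Nat.mod_lt (z / r) hd0
    have hz' : (z / r / d * d + z / r % d) * r + z % r = z := by
      rw [Nat.div_add_mod', Nat.div_add_mod']
    generalize z / r / d = x at *
    generalize z / r % d = j at *
    generalize z % r = k at *
    subst hz'
    refine ⟨?_, fun z' hz' => ?_⟩
    · have e1 := div_mul_add (q := r) (x := x * d + j) hk
      have e2 := mod_mul_add (q := r) (x := x * d + j) hk
      have e3 := mod_mul_add (q := d) (x := x) hj
      have e4 := div_mul_add (q := d) (x := x) hj
      rcases j with _ | j
      · have e3' : x * d % d = 0 := by simp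
        have e1' : (x * d * r + k) / r = x * d := by simpa using e1
        have e2' : (x * d * r + k) % r = k := by simpa using e2
        simp [g1, ht.vr, e1', e2', e3', taylor_zero, h.enc_ite, -Nat.mul_add_mod_self_right]
      · have hsub : (x * d + (j + 1)) * r + k - r = (x * d + j) * r + k := by
          have : (x * d + (j + 1)) * r = (x * d + j) * r + r := by ring
          omega
        have hlt : (x * d + j) * r + k < (x * d + (j + 1)) * r + k := by
          have : (x * d + (j + 1)) * r = (x * d + j) * r + r := by ring
          omega
        have hI1 := hI _ hlt
        rw [div_mul_add hk, mod_mul_add hk, div_mul_add (show j < d by omega),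
          mod_mul_add (show j < d by omega)] at hI1
        simp only [run_ite, Expr.eval_eq, Expr.eval_mod, Expr.eval_div, Expr.eval_var, St.setv_v,
          if_true, ht.vr, g1, Expr.eval_zero, reduceCtorEq, if_false, e1, e3]
        rw [if_neg (by simp), run_store, St.seta_a, if_pos ⟨rfl, by simp⟩]
        have ht' := ht.toFieldEnv.setv .z ((x * d + (j + 1)) * r + k) (by simp) (by simp)
        have hfirst : (fmul (.get .pt (Var.z - Var.r)) (.get .xs (Var.z / Var.r / Var.d))).eval
            (t.setv .z ((x * d + (j + 1)) * r + k)) = enc (taylor (pts x) j k * pts x) := by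
          refine ht'.fmul ?_ ?_
          · simp [ht.vr, hsub, hI1]
          · simp [ht.vr, g1, e1, e4, g2]
        rcases k with _ | k
        · have e2' : (x * d + (j + 1)) * r % r = 0 := by simp
          rw [ht'.fadd (y := 0) hfirst, add_zero, taylor_succ_zero]
          simp [ht.vr, e2', h.enc_zero]
        · have hI2 := hI ((x * d + j) * r + k) (by omega)
          rw [div_mul_add (show k < r by omega), mod_mul_add (show k < r by omega),
            div_mul_add (show j < d by omega),
            mod_mul_add (show j < d by omega)] at hI2
          rw [ht'.fadd (y := taylor (pts x) j k) hfirst, taylor_succ_succ]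
          simp only [Expr.eval_mul, Expr.eval_lt, Expr.eval_zero, Expr.eval_mod, Expr.eval_var,
            Expr.eval_get, Expr.eval_sub, Expr.eval_one, St.setv_v, St.setv_a, if_true, reduceCtorEq,
            if_false, ht.vr, e2, hsub]
          rw [if_pos (by omega), one_mul, ← hI2]
          rfl
    · simp only [run_ite]
      split_ifs <;> simp [hz'.ne]
  have hz : (x * d + j) * r + k < d * d * r := mul_add_lt (mul_add_lt hx hj) hk
  rw [key _ (by simpa [Expr.eval, BinOp.eval, hd, hs.vr] using hz), div_mul_add hk, mod_mul_add hk,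
    div_mul_add hj, mod_mul_add hj]

theorem parseS_run {s : St} {L B : ℕ} (hL : s.v .L = L) (hB : s.v .bits = B) :
    (∀ i ≤ L, (parseS.run s).a .al i = (parse B L).1 i) ∧
      (parseS.run s).v .z = (parse B L).2 := by
  obtain ⟨s', e'⟩ : ∃ s', s' = parseS.run s := ⟨_, rfl⟩
  rw [← e']
  obtain ⟨s₁, F₁, e₁, e'⟩ := run_seq_split e'
  obtain ⟨s₂, F₂, e₂, e'⟩ := run_seq_split e'
  obtain ⟨s₃, F₃, e₃, e'⟩ := run_seq_split e'
  have h0 : ∀ i < (Expr.op .add (.var .L) 1).eval s, s₁.a .al i = 0 := by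
    rw [e₁]
    refine Stmt.for_fill .al (fun _ => 0) ?_
    intro i hi t hF hI
    refine ⟨by simp, fun k hk => by simp [hk.ne]⟩
  have hL₃ : s₃.v .L = L := by rw [F₃.v .L rfl, F₂.v .L rfl, F₁.v .L rfl, hL]
  have key : (∀ i ≤ L, s'.a .al i = (parse B ((Expr.var .L).eval s₃)).1 i) ∧
      s'.v .z = (parse B ((Expr.var .L).eval s₃)).2 ∧
      s'.v .y = B / 2 ^ ((Expr.var .L).eval s₃) := by
    rw [e']
    refine Stmt.for_ind (I := fun j s' => (∀ i ≤ L, s'.a .al i = (parse B j).1 i) ∧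
      s'.v .z = (parse B j).2 ∧ s'.v .y = B / 2 ^ j) ⟨?_, ?_, ?_⟩ ?_
    · intro i hi
      rw [F₃.a .al rfl, F₂.a .al rfl, h0 i (by simp [Expr.eval, BinOp.eval, hL]; exact hi)]
      rfl
    · rw [F₃.v .z rfl, e₂]
      simp [parse]
    · rw [e₃]
      simp [F₂.v .bits rfl, F₁.v .bits rfl, hB]
    · rintro j hj t hF ⟨h1, h2, h3⟩
      replace hj : j < L := by simpa [hL₃] using hj
      have g1 : t.v .L = L := by rw [hF.v .L rfl, hL₃]
      obtain ⟨hz, -⟩ := parse_le B j 0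
      have ha := fun i => (parse_le B j i).2
      have hg1 : (parse B j).1 (parse B j).2 + 1 < L + 1 := by have := ha (parse B j).2; omega
      have hg2 : (parse B j).2 + 1 < L + 1 := by omega
      have hy : B / 2 ^ j / 2 = B / 2 ^ (j + 1) := by rw [Nat.div_div_eq_div_mul, pow_succ]
      rw [parse]
      by_cases hb : B / 2 ^ j % 2 = 1
      · have hal := h1 (parse B j).2 (by omega)
        refine ⟨fun i hi => ?_, ?_, ?_⟩
        · simp [h2, h3, hb, g1, hal, Function.update_apply]
          by_cases hiz : i = (parse B j).2
          · have := ha (parse B j).2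
            simp [hiz]
            omega
          · simp [hiz, h1 i hi]
        · simp [h2, h3, hb]
        · simp [h2, h3, hb, hy]
      · have hb0 : B / 2 ^ j % 2 = 0 := by omega
        refine ⟨fun i hi => ?_, ?_, ?_⟩
        · simp [h2, h3, hb0, h1 i hi]
        · simp [h2, h3, hb0, g1]; omega
        · simp [h2, h3, hb0, hy]
  rw [show (Expr.var .L).eval s₃ = L from hL₃] at key
  exact ⟨key.1, key.2.1⟩

end Grid
end MME

/-! ## Evaluation on the grid and at the points -/

namespace MME
open ForLang ForLang.Stmt

/-- An instance of the problem: its parameters, coefficients and points. -/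
structure Inst (F : Type*) where
  p : ℕ
  e : ℕ
  ord : ℕ
  d : ℕ
  m : ℕ
  N : ℕ
  n : ℕ
  D : ℕ
  oF : ℕ
  oP : ℕ
  ζ : F
  b : F
  enc : F → ℕ
  f : ℕ → F
  a : ℕ → ℕ → F
  pts : ℕ → F

/-! ### Digitwise partial evaluation -/

section Digits

theorem sum_range_mul {M : Type*} [AddCommMonoid M] (n q : ℕ) (g : ℕ → M) :
    ∑ k ∈ Finset.range (q * n), g k =
      ∑ j ∈ Finset.range n, ∑ i ∈ Finset.range q, g (i + q * j) := by
  induction n with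
  | zero => simp
  | succ n ih =>
    rw [Nat.mul_succ, Finset.sum_range_add, ih, Finset.sum_range_succ]
    congr 1
    exact Finset.sum_congr rfl fun i _ => by rw [add_comm]

theorem digit_add {d i l : ℕ} (hd : 0 < d) (hl : l < i) (y x : ℕ) :
    (y + d ^ i * x) / d ^ l % d = y / d ^ l % d := by
  obtain ⟨k, rfl⟩ := Nat.exists_eq_add_of_lt hl
  have : y + d ^ (l + k + 1) * x = y + d ^ l * (d * (d ^ k * x)) := by ring
  rw [this, Nat.add_mul_div_left _ _ (pow_pos hd _), Nat.add_mul_mod_self_left]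

theorem digit_top {d i y x : ℕ} (hy : y < d ^ i) (hx : x < d) : (y + d ^ i * x) / d ^ i % d = x := by
  rw [Nat.add_mul_div_left _ _ (by omega), Nat.div_eq_of_lt hy, zero_add, Nat.mod_eq_of_lt hx]

variable {F : Type*} [Field F]

/-- Evaluation of the first `i` variables at the grid point with number `y`. -/
def partialEval (d : ℕ) (T : ℕ → ℕ → ℕ → F) (f : ℕ → F) (i rest y : ℕ) : F :=
  ∑ κ ∈ Finset.range (d ^ i), f (κ + d ^ i * rest) *
    ∏ l ∈ Finset.range i, T l (y / d ^ l % d) (κ / d ^ l % d)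

/-- Splitting off the top digit `j` of the summation index moves it to the lowest place of the
exponents not yet evaluated. This is the tensor structure that makes each coordinate cost only a
factor d. -/
theorem partialEval_succ {d : ℕ} (hd : 0 < d) (T : ℕ → ℕ → ℕ → F) (f : ℕ → F) (i rest : ℕ) {x y : ℕ}
    (hx : x < d) (hy : y < d ^ i) : partialEval d T f (i + 1) rest (y + d ^ i * x) =
      ∑ j ∈ Finset.range d, T i x j * partialEval d T f i (j + d * rest) y := by
  rw [partialEval, pow_succ, sum_range_mul]
  refine Finset.sum_congr rfl fun j hj => ?_
  rw [partialEval, Finset.mul_sum]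
  refine Finset.sum_congr rfl fun κ hκ => ?_
  rw [Finset.prod_range_succ, digit_top hy hx, digit_top (Finset.mem_range.1 hκ) (Finset.mem_range.1 hj),
    Finset.prod_congr rfl fun l hl => by
      rw [digit_add hd (Finset.mem_range.1 hl), digit_add hd (Finset.mem_range.1 hl)],
    show κ + d ^ i * j + d ^ i * d * rest = κ + d ^ i * (j + d * rest) by ring]
  ring
end Digits

section Run
variable {F : Type*} [Field F]

/-- The tables of an instance are in place. -/
structure Inst.Env (I : Inst F) (s : St) : Prop extends SerEnv I.p I.e (I.ord + 1) I.enc s where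
  vd : s.v .d = I.d
  vm : s.v .m = I.m
  vX : s.v .X = I.d ^ I.m
  vN : s.v .N = I.N
  voF : s.v .oF = I.oF
  voP : s.v .oP = I.oP
  f : ∀ k < I.d ^ I.m, s.a .inp (I.oF + k) = I.enc (I.f k)
  a : ∀ i < I.N, ∀ l < I.m, s.a .inp (I.oP + i * I.m + l) = I.enc (I.a i l)
  val : ∀ x, s.a .val (I.enc x) = I.enc (base I.n I.b x)
  rank : ∀ x, s.a .rank (I.enc (base I.n I.b x)) < I.d ∧
    I.pts (s.a .rank (I.enc (base I.n I.b x))) = base I.n I.b x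
  del : ∀ x, IsSer I.enc (I.ord + 1) (s.a .del) (I.enc x * (I.ord + 1))
    (increment (I.p ^ I.e) (I.ord + 1) I.n I.b x)
  om : ∀ x, IsSer I.enc (I.ord + 1) (s.a .om) (I.enc x * (I.ord + 1))
    (weight (I.p ^ I.e) I.ord I.D x)
  pt : ∀ x < I.d, ∀ j < I.d, ∀ k < I.ord + 1,
    s.a .pt ((x * I.d + j) * (I.ord + 1) + k) = I.enc (taylor (I.pts x) j k)

theorem Inst.Env.frame {I : Inst F} {s s' : St} (h : I.Env s) {P : Stmt} (hF : P.Frame s s')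
    (hv : ([.p, .q, .r, .d, .m, .X, .N, .oF, .oP].all fun x => !P.modv x) = true)
    (ha : ([.add, .mul, .inp, .val, .rank, .del, .om, .pt].all fun A => !P.moda A) = true) :
    I.Env s' := by
  simp only [List.all_cons, List.all_nil, Bool.and_true, Bool.and_eq_true, Bool.not_eq_true'] at hv ha
  obtain ⟨h1, h2, h3, h4, h5, h6, h7, h8, h9⟩ := hv
  obtain ⟨k1, k2, k3, k4, k5, k6, k7, k8⟩ := ha
  refine ⟨h.toSerEnv.frame hF h1 h2 k1 k2 h3, ?_, ?_, ?_, ?_, ?_, ?_, ?_, ?_, ?_, ?_, ?_, ?_, ?_⟩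
  · rw [hF.v _ h4, h.vd]
  · rw [hF.v _ h5, h.vm]
  · rw [hF.v _ h6, h.vX]
  · rw [hF.v _ h7, h.vN]
  · rw [hF.v _ h8, h.voF]
  · rw [hF.v _ h9, h.voP]
  · rw [hF.a _ k3]; exact h.f
  · rw [hF.a _ k3]; exact h.a
  · rw [hF.a _ k4]; exact h.val
  · rw [hF.a _ k5]; exact h.rank
  · rw [hF.a _ k6]; exact h.del
  · rw [hF.a _ k7]; exact h.om
  · rw [hF.a _ k8]; exact h.pt

theorem frame_setv (s : St) (x : Var) (n : ℕ) : (Stmt.assign false x (.num n)).Frame s (s.setv x n) :=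
  Stmt.frame _ s

/-- The derivatives of the powers at the grid points. -/
noncomputable def Inst.T (I : Inst F) (α : ℕ → ℕ) (l x j : ℕ) : F := taylor (I.pts x) j (α l)

theorem evalS_run (I : Inst F) (h : Coding I.p I.e I.ζ I.enc) {s : St} (hs : I.Env s) (hd : 0 < I.d)
    {α : ℕ → ℕ} (hα : ∀ l < I.m, s.a .al l = α l ∧ α l < I.ord + 1) (y : ℕ) (hy : y < I.d ^ I.m) :
    (evalS.run s).a .H y = I.enc (partialEval I.d (I.T α) I.f I.m 0 y) := by
  obtain ⟨s', e'⟩ : ∃ s', s' = evalS.run s := ⟨_, rfl⟩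
  rw [← e']
  obtain ⟨s₁, F₁, e₁, e'⟩ := run_seq_split e'
  obtain ⟨s₂, F₂, e₂, e'⟩ := run_seq_split e'
  have hs₁ := hs.frame F₁ rfl rfl
  have hs₂ := hs₁.frame F₂ rfl rfl
  have hX₁ : s₂.v .X₁ = I.d ^ I.m / I.d := by
    rw [F₂.v .X₁ rfl, e₁]; simp [hs.vX, hs.vd]
  have hH : ∀ k < (Expr.var .X).eval s₁, s₂.a .H k = I.enc (I.f k) := by
    rw [e₂]
    refine Stmt.for_fill .H (fun k => I.enc (I.f k)) ?_
    intro k hk t hF _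
    have ht := hs₁.frame hF rfl rfl
    replace hk : k < I.d ^ I.m := by simpa [hs₁.vX] using hk
    exact ⟨by simp [ht.voF, ht.f k hk], fun k' hk' => by simp [hk'.ne]⟩
  have key : ∀ rest < I.d ^ (I.m - (Expr.var .m).eval s₂), ∀ y < I.d ^ (Expr.var .m).eval s₂,
      s'.a .H (rest + I.d ^ (I.m - (Expr.var .m).eval s₂) * y) =
        I.enc (partialEval I.d (I.T α) I.f ((Expr.var .m).eval s₂) rest y) := by
    rw [e']
    -- After `i` passes the low m - i digits of an index are remaining exponents and the high `i`
    -- digits are grid coordinates.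
    refine Stmt.for_ind (I := fun i s' => ∀ rest < I.d ^ (I.m - i), ∀ y < I.d ^ i,
      s'.a .H (rest + I.d ^ (I.m - i) * y) = I.enc (partialEval I.d (I.T α) I.f i rest y)) ?_ ?_
    · intro rest hrest y hy
      obtain rfl : y = 0 := by simpa using hy
      rw [mul_zero, add_zero, hH rest (by simpa [hs₁.vX] using hrest)]
      simp [partialEval]
    · intro i hi t hF hI
      replace hi : i < I.m := by simpa [hs₂.vm] using hi
      have ht := (hs₂.frame hF rfl rfl).frame (frame_setv t .l i) rfl rfl
      have hl : (t.setv .l i).v .l = i := by simp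
      have hX₁t : (t.setv .l i).v .X₁ = I.d ^ I.m / I.d := by
        rw [← hX₁, ← hF.v .X₁ rfl]; simp
      have hal : (t.setv .l i).a .al i = α i ∧ α i < I.ord + 1 := by
        rw [St.setv_a, hF.a .al rfl, F₂.a .al rfl, F₁.a .al rfl]; exact hα i hi
      change ∀ rest < I.d ^ (I.m - i), ∀ y < I.d ^ i, (t.setv .l i).a .H
        (rest + I.d ^ (I.m - i) * y) = _ at hI
      generalize t.setv .l i = t₀ at *
      clear hF t
      obtain ⟨M, hM⟩ : ∃ M, M = I.d ^ (I.m - (i + 1)) := ⟨_, rfl⟩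
      have hMi : I.d ^ (I.m - i) = I.d * M := by
        rw [hM, ← pow_succ', show I.m - (i + 1) + 1 = I.m - i by omega]
      have hMX : I.d ^ I.m = M * I.d ^ i * I.d := by
        rw [hM, mul_assoc, ← pow_succ, ← pow_add, show I.m - (i + 1) + (i + 1) = I.m by omega]
      have hM0 : 0 < M := hM ▸ pow_pos hd _
      have hX₁' : I.d ^ I.m / I.d = M * I.d ^ i := by rw [hMX, Nat.mul_div_cancel _ hd]
      rw [hX₁'] at hX₁t
      generalize e₄ : Stmt.run _ t₀ = s₄
      replace e₄ := e₄.symm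
      obtain ⟨s₃, F₃, e₃, e₄⟩ := run_seq_split e₄
      have hs₃ := ht.frame F₃ rfl rfl
      have h1 : ∀ k < (Expr.var .X).eval t₀, s₃.a .H' k =
          I.enc (partialEval I.d (I.T α) I.f (i + 1) (k % M) (k / M)) := by
        rw [e₃]
        refine Stmt.for_fill .H'
          (fun k => I.enc (partialEval I.d (I.T α) I.f (i + 1) (k % M) (k / M))) ?_
        intro k hk u hF _
        replace hk : k < M * I.d ^ i * I.d := by simpa [ht.vX, hMX] using hk
        have hu := (ht.frame hF rfl rfl)
        have g1 : u.v .X₁ = M * I.d ^ i := (hF.v .X₁ rfl).trans hX₁t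
        have g2 : u.v .l = i := (hF.v .l rfl).trans hl
        have g3 : u.a .al = t₀.a .al := hF.a .al rfl
        have g4 : u.a .H = t₀.a .H := hF.a .H rfl
        rw [run_seq, run_seq, run_seq]
        obtain ⟨u₁, eu₁⟩ : ∃ u₁, u₁ = (Var.rest ≔ Var.k % Var.X₁).run
          ((Var.x ≔ Var.k / Var.X₁).run (u.setv .k k)) := ⟨_, rfl⟩
        rw [← eu₁]
        have hu₁ : I.Env u₁ := by
          rw [eu₁]
          exact (((hu.frame (frame_setv u .k k) rfl rfl).frame (Stmt.frame _ _) rfl rfl).frame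
            (Stmt.frame _ _) rfl rfl)
        have x1 : u₁.v .x = k / (M * I.d ^ i) := by rw [eu₁]; simp [g1]
        have x2 : u₁.v .rest = k % (M * I.d ^ i) := by rw [eu₁]; simp [g1]
        have x3 : u₁.v .k = k := by rw [eu₁]; simp
        have x4 : u₁.v .l = i := by rw [eu₁]; simp [g2]
        have x5 : u₁.a .al = t₀.a .al := by rw [eu₁]; simp [g3]
        have x6 : u₁.a .H = t₀.a .H := by rw [eu₁]; simp [g4]
        have x7 : u₁.a .H' = u.a .H' := by rw [eu₁]; simp
        have hx : k / M / I.d ^ i < I.d := by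
          rw [Nat.div_div_eq_div_mul]; exact Nat.div_lt_of_lt_mul hk
        have hy : k / M % I.d ^ i < I.d ^ i := Nat.mod_lt _ (pow_pos hd _)
        have hsum := sumS_run h hu₁.toAddEnv (x := .j) (n := Var.d)
          (a := fmul (.get .pt ((Var.x * Var.d + Var.j) * Var.r + .get .al Var.l))
            (.get .H (Var.j + Var.d * Var.rest))) (by simp) I.d (by simp [hu₁.vd])
          (fun j => I.T α i (k / M / I.d ^ i) j *
            partialEval I.d (I.T α) I.f i (j + I.d * (k % M)) (k / M % I.d ^ i)) (by
          intro j hj w hFw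
          have hw := hu₁.frame hFw rfl rfl
          refine (hw.toFieldEnv.setv .j j (by simp) (by simp)).fmul ?_ ?_
          · simp only [Expr.eval_get, Expr.eval_add, Expr.eval_mul, Expr.eval_var, St.setv_v,
              St.setv_a, if_true, reduceCtorEq, if_false, hw.vd, hw.vr, hFw.v .x rfl, x1,
              hFw.v .l rfl, x4, hFw.a .al rfl, x5, hal.1]
            rw [← Nat.div_div_eq_div_mul]
            exact hw.pt _ hx j hj _ hal.2
          · simp only [Expr.eval_get, Expr.eval_add, Expr.eval_mul, Expr.eval_var, St.setv_v,
              St.setv_a, if_true, reduceCtorEq, if_false, hw.vd, hFw.v .rest rfl, x2, hFw.a .H rfl, x6]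
            rw [Nat.mod_mul, mul_add, ← add_assoc, ← mul_assoc, ← hMi]
            refine hI _ ?_ _ hy
            rw [hMi]
            have := Nat.mod_lt k hM0
            nlinarith)
        rw [← partialEval_succ hd _ _ _ _ hx hy, Nat.mod_add_div] at hsum
        refine ⟨?_, fun k' hk' => ?_⟩
        · rw [run_store, St.seta_a, Expr.eval_var, Expr.eval_var, run_v _ _ rfl, x3, hsum]
          simp
        · rw [run_store, St.seta_a, Expr.eval_var, Expr.eval_var, run_v _ _ rfl, x3,
            run_a _ _ rfl, x7]
          simp [hk'.ne]
      have h2 : ∀ k < (Expr.var .X).eval s₃, s₄.a .H k =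
          I.enc (partialEval I.d (I.T α) I.f (i + 1) (k % M) (k / M)) := by
        rw [e₄]
        refine Stmt.for_fill .H
          (fun k => I.enc (partialEval I.d (I.T α) I.f (i + 1) (k % M) (k / M))) ?_
        intro k hk u hF _
        refine ⟨?_, fun k' hk' => by simp [hk'.ne]⟩
        simp only [run_store, St.seta_a, Expr.eval_var, Expr.eval_get, St.setv_v, St.setv_a, if_true,
          and_self, hF.a .H' rfl]
        exact h1 k (by simpa [hs₃.vX, ht.vX] using hk)
      intro rest hrest y hy
      rw [← hM] at hrest ⊢
      have hlt : rest + M * y < I.d ^ I.m := by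
        rw [hMX, mul_assoc, ← pow_succ]
        calc rest + M * y < M + M * y := by omega
          _ = M * (y + 1) := by ring
          _ ≤ _ := Nat.mul_le_mul_left _ hy
      rw [h2 _ (by simpa [hs₃.vX] using hlt), Nat.add_mul_mod_self_left, Nat.mod_eq_of_lt hrest,
        Nat.add_mul_div_left _ _ hM0, Nat.div_eq_of_lt hrest, zero_add]
  rw [show (Expr.var .m).eval s₂ = I.m from hs₂.vm] at key
  simpa using key 0 (by simp) y hy

end Run
end MME

namespace MME
open ForLang ForLang.Stmt

/-- Sharper than `parse_le`: with the cursor at m after 3m bits, every entry is at most 2m. So it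
indexes the Taylor table of precision 2m + 1, and the guard in `localS` is inactive. -/
theorem parse_add_le (B : ℕ) : ∀ j i : ℕ, (parse B j).1 i + (parse B j).2 ≤ j
  | 0, _ => le_rfl
  | j + 1, i => by
    have h := parse_add_le B j i
    have h' := parse_add_le B j (parse B j).2
    rw [parse]
    split_ifs with hb
    · simp only [Function.update_apply]
      split_ifs <;> omega
    · simp only; omega

section Run
variable {F : Type*} [Field F]

/-- The contribution of a field element and a derivative to the value at a point. -/
noncomputable def Inst.term (I : Inst F) (α : ℕ → ℕ) (i : ℕ) (x : F) : F :=
  (∑ κ ∈ Finset.range (I.d ^ I.m), I.f κ *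
    ∏ l ∈ Finset.range I.m, taylor (base I.n I.b (x * I.a i l)) (κ / I.d ^ l % I.d) (α l)) *
  PowerSeries.coeff I.ord (weight (I.p ^ I.e) I.ord I.D x *
    ∏ l ∈ Finset.range I.m, increment (I.p ^ I.e) (I.ord + 1) I.n I.b (x * I.a i l) ^ α l)

theorem localS_run (I : Inst F) (h : Coding I.p I.e I.ζ I.enc) {s : St} (hs : I.Env s)
    {α : ℕ → ℕ} (hα : ∀ l < I.m, s.a .al l = α l ∧ α l < I.ord + 1)
    (hH : ∀ y < I.d ^ I.m, s.a .H y = I.enc (partialEval I.d (I.T α) I.f I.m 0 y))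
    {i : ℕ} (hi : i < I.N) (hpt : s.v .pt = i) {x : F} (hx : s.v .lam = I.enc x)
    {o : F} (ho : s.a .out i = I.enc o) :
    (localS.run s).a .out i = I.enc (o + I.term α i x) ∧
      ∀ i' ≠ i, (localS.run s).a .out i' = s.a .out i' := by
  obtain ⟨s', e'⟩ : ∃ s', s' = localS.run s := ⟨_, rfl⟩
  rw [← e']
  obtain ⟨s₁, F₁, e₁, e'⟩ := run_seq_split e'
  obtain ⟨s₂, F₂, e₂, e'⟩ := run_seq_split e'
  obtain ⟨s₃, F₃, e₃, e'⟩ := run_seq_split e'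
  have hs₁ := hs.frame F₁ rfl rfl
  have hs₂ := hs₁.frame F₂ rfl rfl
  have hs₃ := hs₂.frame F₃ rfl rfl
  have hW : IsSer I.enc (I.ord + 1) (s₂.a .W) 0 (weight (I.p ^ I.e) I.ord I.D x) := by
    rw [F₂.a .W rfl, e₁]
    refine isSer_setSerS hs.vr 0 _ (by simp) fun k hk t hF => ?_
    have ht := hs.frame hF rfl rfl
    simp only [Expr.eval_get, Expr.eval_add, Expr.eval_mul, Expr.eval_var, St.setv_v, St.setv_a,
      if_true, reduceCtorEq, if_false, hF.v .lam rfl, hx, ht.vr]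
    exact ht.om x k hk
  have hidx : s₂.v .idx = 0 := by rw [e₂]; simp
  have hlam : s₂.v .lam = I.enc x := by rw [F₂.v .lam rfl, F₁.v .lam rfl, hx]
  have hpt₂ : s₂.v .pt = i := by rw [F₂.v .pt rfl, F₁.v .pt rfl, hpt]
  have hal : ∀ l < I.m, s₂.a .al l = α l ∧ α l < I.ord + 1 := by
    rw [F₂.a .al rfl, F₁.a .al rfl]; exact hα
  clear e₁ e₂
  let g : ℕ → ℕ := fun l => s₂.a .rank (I.enc (base I.n I.b (x * I.a i l)))
  have hg : ∀ l, g l < I.d ∧ I.pts (g l) = base I.n I.b (x * I.a i l) :=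
    fun l => hs₂.rank _
  have key : s₃.v .idx < I.d ^ (Expr.var .m).eval s₂ ∧
      (∀ t < (Expr.var .m).eval s₂, s₃.v .idx / I.d ^ t % I.d = g (I.m - (Expr.var .m).eval s₂ + t)) ∧
      IsSer I.enc (I.ord + 1) (s₃.a .W) 0 (weight (I.p ^ I.e) I.ord I.D x *
        ∏ l ∈ Finset.range ((Expr.var .m).eval s₂), increment (I.p ^ I.e) (I.ord + 1) I.n I.b
          (x * I.a i (I.m - 1 - l)) ^ α (I.m - 1 - l)) := by
    rw [e₃]
    -- The digits of the partial index are the ranks of the last `j` coordinates, and `W` holds the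
    -- weight times the matching powers of increments.
    refine Stmt.for_ind (I := fun j s' => s'.v .idx < I.d ^ j ∧
      (∀ t < j, s'.v .idx / I.d ^ t % I.d = g (I.m - j + t)) ∧
      IsSer I.enc (I.ord + 1) (s'.a .W) 0 (weight (I.p ^ I.e) I.ord I.D x *
        ∏ l ∈ Finset.range j, increment (I.p ^ I.e) (I.ord + 1) I.n I.b
          (x * I.a i (I.m - 1 - l)) ^ α (I.m - 1 - l)))
      ⟨by simp [hidx], by simp, by simpa using hW⟩ ?_
    rintro j hj t hF ⟨h1, h2, h3⟩
    replace hj : j < I.m := by simpa [hs₂.vm] using hj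
    have ht := hs₂.frame hF rfl rfl
    have g1 : t.v .lam = I.enc x := (hF.v .lam rfl).trans hlam
    have g2 : t.v .pt = i := (hF.v .pt rfl).trans hpt₂
    have g3 : t.a .al = s₂.a .al := hF.a .al rfl
    have g4 : t.a .rank = s₂.a .rank := hF.a .rank rfl
    obtain ⟨c, hc⟩ : ∃ c, c = x * I.a i (I.m - 1 - j) := ⟨_, rfl⟩
    generalize e₅ : Stmt.run _ (t.setv .l j) = t₅
    replace e₅ := e₅.symm
    obtain ⟨t₁, T₁, d₁, e₅⟩ := run_seq_split e₅
    obtain ⟨t₂, T₂, d₂, e₅⟩ := run_seq_split e₅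
    obtain ⟨t₃, T₃, d₃, e₅⟩ := run_seq_split e₅
    have ht₀ := ht.frame (frame_setv t .l j) rfl rfl
    have ht₁ := ht₀.frame T₁ rfl rfl
    have ht₂ := ht₁.frame T₂ rfl rfl
    have ht₃ := ht₂.frame T₃ rfl rfl
    have y₁ : t₁.v .y = I.m - 1 - j := by rw [d₁]; simp [ht.vm]
    have l₁ : t₁.v .lam = I.enc x := by rw [d₁]; simp [g1]
    have p₁ : t₁.v .pt = i := by rw [d₁]; simp [g2]
    have c₂ : t₂.v .c = I.enc c := by
      rw [d₂, run_assign, St.setv_v, if_pos rfl, hc]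
      refine ht₁.toFieldEnv.fmul (by simp [l₁]) ?_
      simp only [Expr.eval_get, Expr.eval_add, Expr.eval_mul, Expr.eval_var, ht₁.voP, p₁, ht₁.vm, y₁]
      exact ht₁.a i hi _ (by omega)
    have i₂ : t₂.v .idx = t.v .idx := by
      rw [T₂.v .idx rfl, T₁.v .idx rfl]; simp
    have i₃ : t₃.v .idx = t.v .idx * I.d + g (I.m - 1 - j) := by
      have hr : t₂.a .rank (I.enc (base I.n I.b c)) = g (I.m - 1 - j) := by
        rw [T₂.a .rank rfl, T₁.a .rank rfl, St.setv_a, g4, hc]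
      rw [d₃, run_assign, St.setv_v, if_pos rfl]
      simp only [Expr.eval_guard, Expr.eval_get, Expr.eval_add, Expr.eval_mul, Expr.eval_var, i₂,
        ht₂.vd, c₂, ht₂.val, hr, ht₂.vX]
      rw [if_pos]
      calc t.v .idx * I.d + g (I.m - 1 - j) < I.d ^ j * I.d := mul_add_lt h1 (hg _).1
        _ = I.d ^ (j + 1) := (pow_succ _ _).symm
        _ ≤ _ := Nat.pow_le_pow_right (Nat.zero_lt_of_lt (hg 0).1) hj
    have W₃ : t₃.a .W = t.a .W := by
      rw [T₃.a .W rfl, T₂.a .W rfl, T₁.a .W rfl]; simp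
    have a₃ : t₃.a .al = s₂.a .al := by
      rw [T₃.a .al rfl, T₂.a .al rfl, T₁.a .al rfl]; simp [g3]
    have y₃ : t₃.v .y = I.m - 1 - j := by rw [T₃.v .y rfl, T₂.v .y rfl, y₁]
    have c₃ : t₃.v .c = I.enc c := by rw [T₃.v .c rfl, c₂]
    obtain ⟨hα1, hα2⟩ := hal (I.m - 1 - j) (by omega)
    have hpow := powSerS_run h ht₃.toSerEnv (A := .del) (o := Var.c * Var.r)
      (n := .op .guard (.get .al Var.y) Var.r) (by simp) (by simp) (I.enc c * (I.ord + 1))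
      (fun u hu => by simp [hu.v .c rfl, hu.v .r rfl, c₃, ht₃.vr]) (W₃ ▸ h3) (ht₃.del c)
    have hev : (Expr.op .guard (.get .al Var.y) Var.r).eval t₃ = α (I.m - 1 - j) := by
      simp [y₃, a₃, hα1, ht₃.vr, hα2]
    rw [hev, mul_assoc, hc] at hpow
    have i₅ : t₅.v .idx = t₃.v .idx := by rw [e₅, run_v _ _ rfl]
    refine ⟨?_, fun u hu => ?_, ?_⟩
    · rw [i₅, i₃, pow_succ]; exact mul_add_lt h1 (hg _).1
    · rw [i₅, i₃]
      rcases u with _ | u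
      · rw [pow_zero, Nat.div_one, mod_mul_add (hg _).1]
        congr 1; omega
      · rw [pow_succ', ← Nat.div_div_eq_div_mul, div_mul_add (hg _).1, h2 u (by omega)]
        congr 1; omega
    · rw [Finset.prod_range_succ, e₅]; exact hpow
  obtain ⟨k1, k2, k3⟩ := key
  rw [show (Expr.var .m).eval s₂ = I.m from hs₂.vm] at k1 k2 k3
  rw [Finset.prod_range_reflect (fun l => increment (I.p ^ I.e) (I.ord + 1) I.n I.b
          (x * I.a i l) ^ α l)] at k3
  have pt₃ : s₃.v .pt = i := by rw [F₃.v .pt rfl, hpt₂]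
  have out₃ : s₃.a .out = s.a .out := by rw [F₃.a .out rfl, F₂.a .out rfl, F₁.a .out rfl]
  have H₃ : s₃.a .H (s₃.v .idx) = I.enc (∑ κ ∈ Finset.range (I.d ^ I.m), I.f κ *
      ∏ l ∈ Finset.range I.m, taylor (base I.n I.b (x * I.a i l)) (κ / I.d ^ l % I.d) (α l)) := by
    rw [F₃.a .H rfl, F₂.a .H rfl, F₁.a .H rfl, hH _ k1, partialEval]
    congr 1
    refine Finset.sum_congr rfl fun κ _ => ?_
    rw [mul_zero, add_zero]
    congr 1
    refine Finset.prod_congr rfl fun l hl => ?_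
    rw [Inst.T, k2 l (Finset.mem_range.1 hl), Nat.sub_self, zero_add, (hg l).2]
  have hval : (fadd (.get .out Var.pt) (fmul (.get .H Var.idx) (.get .W (Var.r - 1)))).eval s₃ =
      I.enc (o + I.term α i x) := by
    refine hs₃.fadd (by simp [pt₃, out₃, ho]) (hs₃.fmul (by simp [H₃]) ?_)
    simp [hs₃.vr]
    rw [← k3 _ (Nat.lt_succ_self _), zero_add]
  rw [e']
  refine ⟨?_, fun i' hi' => ?_⟩
  · rw [run_store, St.seta_a, if_pos ⟨rfl, by simp [pt₃]⟩, hval]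
  · rw [run_store, St.seta_a, if_neg (by simp [pt₃, hi']), out₃]

theorem sum_range_dec [Fintype F] {p e : ℕ} {ζ : F} {enc : F → ℕ} (h : Coding p e ζ enc) (g : F → F) :
    ∑ c ∈ Finset.range (p ^ e), g (dec p ζ c) = ∑ x, g x :=
  Finset.sum_bij' (fun c _ => dec p ζ c) (fun x _ => enc x) (by simp)
    (fun x _ => Finset.mem_range.2 (h.lt x)) (fun c hc => h.enc_dec c (Finset.mem_range.1 hc))
    (fun x _ => h.dec_enc x) (by simp)

theorem decodeS_run [Fintype F] (I : Inst F) (h : Coding I.p I.e I.ζ I.enc) {s : St} (hs : I.Env s)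
    {α : ℕ → ℕ} (hα : ∀ l < I.m, s.a .al l = α l ∧ α l < I.ord + 1)
    (hH : ∀ y < I.d ^ I.m, s.a .H y = I.enc (partialEval I.d (I.T α) I.f I.m 0 y))
    {o : ℕ → F} (ho : ∀ i < I.N, s.a .out i = I.enc (o i)) :
    ∀ i < I.N, (decodeS.run s).a .out i = I.enc (o i + ∑ x, I.term α i x) := by
  have key : ∀ i < I.N, (decodeS.run s).a .out i =
      I.enc (o i + if i < (Expr.var .N).eval s then ∑ x, I.term α i x else 0) := by
    refine Stmt.for_ind (I := fun k s' => ∀ i < I.N, s'.a .out i =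
      I.enc (o i + if i < k then ∑ x, I.term α i x else 0)) (by simpa using ho) ?_
    intro k hk t hF hI
    replace hk : k < I.N := by simpa [hs.vN] using hk
    have ht := (hs.frame hF rfl rfl).frame (frame_setv t .pt k) rfl rfl
    have g1 : (t.setv .pt k).v .pt = k := by simp
    have g2 : (t.setv .pt k).a .al = s.a .al := hF.a .al rfl
    have g3 : (t.setv .pt k).a .H = s.a .H := hF.a .H rfl
    change ∀ i < I.N, (t.setv .pt k).a .out i = _ at hI
    generalize t.setv .pt k = t₀ at *
    have inner : ∀ i < I.N, ((Stmt.loop .lam Var.q localS).run t₀).a .out i =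
        I.enc (o i + if i < k then ∑ x, I.term α i x else if i = k then
          ∑ c ∈ Finset.range ((Expr.var .q).eval t₀), I.term α i (dec I.p I.ζ c) else 0) := by
      refine Stmt.for_ind (I := fun j s' => ∀ i < I.N, s'.a .out i =
        I.enc (o i + if i < k then ∑ x, I.term α i x else if i = k then
          ∑ c ∈ Finset.range j, I.term α i (dec I.p I.ζ c) else 0)) ?_ ?_
      · intro i hi
        rw [hI i hi]
        simp
      · intro j hj u hFu hIu
        replace hj : j < I.p ^ I.e := by simpa [ht.vq] using hj
        have hu := (ht.frame hFu rfl rfl).frame (frame_setv u .lam j) rfl rfl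
        have hk' := hIu k hk
        rw [if_neg (lt_irrefl k), if_pos rfl] at hk'
        obtain ⟨r1, r2⟩ := localS_run I h hu (α := α)
          (by rw [St.setv_a, hFu.a .al rfl, g2]; exact hα)
          (by rw [St.setv_a, hFu.a .H rfl, g3]; exact hH) hk
          (by simp [hFu.v .pt rfl, g1]) (x := dec I.p I.ζ j)
          (by simp [h.enc_dec j hj]) (o := _) (by rw [St.setv_a]; exact hk')
        intro i hi
        rcases eq_or_ne i k with rfl | hne
        · rw [r1, if_neg (lt_irrefl i), if_pos rfl, Finset.sum_range_succ, add_assoc]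
        · rw [r2 i hne, St.setv_a, hIu i hi, if_neg hne, if_neg hne]
    intro i hi
    rw [inner i hi, show (Expr.var .q).eval t₀ = I.p ^ I.e from ht.vq, sum_range_dec h]
    congr 2
    -- The round for point `k` completes exactly the sum at `k` and leaves all other points alone.
    split_ifs <;> first | rfl | omega
  intro i hi
  rw [key i hi, if_pos (by simpa [hs.vN] using hi)]

theorem mainS_run [Fintype F] (I : Inst F) (h : Coding I.p I.e I.ζ I.enc) {s : St} (hs : I.Env s)
    (hd : 0 < I.d) (hord : I.ord = 2 * I.m) (hL : s.v .L = I.m + 2 * I.m)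
    (hB : s.v .B = 2 ^ (I.m + 2 * I.m)) (ho : ∀ i < I.N, s.a .out i = 0) :
    ∀ i < I.N, (mainS.run s).a .out i = I.enc (∑ B ∈ Finset.range (2 ^ (I.m + 2 * I.m)),
      if (parse B (I.m + 2 * I.m)).2 = I.m then
        ∑ x, I.term (parse B (I.m + 2 * I.m)).1 i x else 0) := by
  have key : ∀ i < I.N, (mainS.run s).a .out i = I.enc (∑ B ∈ Finset.range ((Expr.var .B).eval s),
      if (parse B (I.m + 2 * I.m)).2 = I.m then
        ∑ x, I.term (parse B (I.m + 2 * I.m)).1 i x else 0) := by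
    refine Stmt.for_ind (I := fun k s' => ∀ i < I.N, s'.a .out i = I.enc (∑ B ∈ Finset.range k,
      if (parse B (I.m + 2 * I.m)).2 = I.m then
        ∑ x, I.term (parse B (I.m + 2 * I.m)).1 i x else 0)) ?_ ?_
    · intro i hi; rw [ho i hi, Finset.sum_range_zero, h.enc_zero]
    · intro B _ t hF hI
      have ht := (hs.frame hF rfl rfl).frame (frame_setv t .bits B) rfl rfl
      have g1 : (t.setv .bits B).v .bits = B := by simp
      have g2 : (t.setv .bits B).v .L = I.m + 2 * I.m := by simp [hF.v .L rfl, hL]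
      change ∀ i < I.N, (t.setv .bits B).a .out i = _ at hI
      generalize t.setv .bits B = t₀ at *
      obtain ⟨h1, h2⟩ := parseS_run g2 g1
      have hP := parseS.frame t₀
      rw [run_seq]
      have hout : (parseS.run t₀).a .out = t₀.a .out := hP.a .out rfl
      have ht₁ := ht.frame hP rfl rfl
      generalize parseS.run t₀ = t₁ at *
      rw [← hout] at hI
      intro i hi
      rw [Finset.sum_range_succ, run_ite]
      by_cases hz : (parse B (I.m + 2 * I.m)).2 = I.m
      · rw [if_pos (by simp [ht₁.vm, h2, hz]), if_pos hz, run_seq]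
        have hα : ∀ l < I.m, t₁.a .al l = (parse B (I.m + 2 * I.m)).1 l ∧
            (parse B (I.m + 2 * I.m)).1 l < I.ord + 1 := by
          intro l hl
          refine ⟨h1 l (by omega), ?_⟩
          rw [hord]
          have := parse_add_le B (I.m + 2 * I.m) l
          omega
        have hev := evalS_run I h ht₁ hd hα
        have hE := evalS.frame t₁
        exact decodeS_run I h (ht₁.frame hE rfl rfl) (by rw [hE.a .al rfl]; exact hα) hev
          (by rw [hE.a .out rfl]; exact hI) i hi
      · rw [if_neg (by simp [ht₁.vm, h2, hz]), if_neg hz, add_zero, run_skip, hI i hi]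
  rw [show (Expr.var .B).eval s = 2 ^ (I.m + 2 * I.m) from hB] at key
  exact key

theorem outS_run (I : Inst F) (h : Coding I.p I.e I.ζ I.enc) {s : St} (hs : FieldEnv I.p I.e I.enc s)
    {N : ℕ} (hN : s.v .N = N) {o : ℕ → F} (ho : ∀ i < N, s.a .out i = I.enc (o i)) :
    ∀ i < N, (outS.run s).a .inp i = I.enc (-o i) := by
  subst hN
  change ∀ i < (Expr.var .N).eval s, _
  refine Stmt.for_fill .inp (fun i => I.enc (-o i)) ?_
  intro i hi t hF _
  have ht := hs.frame hF rfl rfl rfl rfl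
  refine ⟨?_, fun k hk => by simp [hk.ne]⟩
  rw [run_store, St.seta_a, if_pos ⟨rfl, by simp⟩, neg_eq_neg_one_mul]
  refine (ht.setv .pt i (by simp) (by simp)).fmul (by simp [ht.vp, h.enc_neg_one]) ?_
  simp [hF.a .out rfl]
  exact ho i hi

end Run
end MME

namespace MME
open ForLang ForLang.Stmt

/-! ### Correctness after the parameters are read -/

section Body
variable {F : Type*} [Field F] [Fintype F]

/-- By linearity this reduces to `sum_grid` for single monomials. Only monomials with nonzero
coefficient need the common degree, since the others are multiplied by 0. -/
theorem sum_term (I : Inst F) (hq : Fintype.card F = I.p ^ I.e) (hord : I.ord = 2 * I.m)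
    (hb : I.n * I.b = 1)
    (hD : ∀ κ < I.d ^ I.m, I.f κ ≠ 0 → ∑ l ∈ Finset.range I.m, κ / I.d ^ l % I.d = I.D)
    (hn : ∀ κ, I.n * ∑ l ∈ Finset.range I.m, κ / I.d ^ l % I.d ≤ 2 * I.m * (I.p ^ I.e - 1)) (i : ℕ) :
    (∑ B ∈ Finset.range (2 ^ (I.m + 2 * I.m)), if (parse B (I.m + 2 * I.m)).2 = I.m then
      ∑ x, I.term (parse B (I.m + 2 * I.m)).1 i x else 0) =
    -∑ κ ∈ Finset.range (I.d ^ I.m), I.f κ *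
      ∏ l ∈ Finset.range I.m, I.a i l ^ (κ / I.d ^ l % I.d) := by
  have key : ∀ κ ∈ Finset.range (I.d ^ I.m),
      I.f κ * (∑ B ∈ Finset.range (2 ^ (I.m + 2 * I.m)), if (parse B (I.m + 2 * I.m)).2 = I.m then
        ∑ x : F, (∏ l ∈ Finset.range I.m, taylor (base I.n I.b (x * I.a i l)) (κ / I.d ^ l % I.d)
          ((parse B (I.m + 2 * I.m)).1 l)) *
          PowerSeries.coeff I.ord (weight (I.p ^ I.e) I.ord I.D x * ∏ l ∈ Finset.range I.m,
            increment (I.p ^ I.e) (I.ord + 1) I.n I.b (x * I.a i l) ^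
              (parse B (I.m + 2 * I.m)).1 l) else 0) =
      I.f κ * -∏ l ∈ Finset.range I.m, I.a i l ^ (κ / I.d ^ l % I.d) := by
    intro κ hκ
    rcases eq_or_ne (I.f κ) 0 with h0 | h0
    · rw [h0, zero_mul, zero_mul]
    · rw [← hD κ (Finset.mem_range.1 hκ) h0, hord, sum_grid hq hb _ (hn κ) (I.a i)]
  rw [← Finset.sum_neg_distrib]
  simp only [neg_mul_eq_mul_neg]
  rw [← Finset.sum_congr rfl key]
  simp only [Finset.mul_sum]
  rw [Finset.sum_comm]
  refine Finset.sum_congr rfl fun B _ => ?_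
  split_ifs
  · simp only [Finset.mul_sum]
    rw [Finset.sum_comm]
    refine Finset.sum_congr rfl fun x _ => ?_
    rw [Inst.term, Finset.sum_mul]
    exact Finset.sum_congr rfl fun κ _ => by ring
  · simp

theorem bodyS_run [DecidableEq F] {p e d d' m N oF oP : ℕ} {ζ : F} {enc : F → ℕ}
    (h : Coding p e ζ enc) (hq : Fintype.card F = p ^ e) {s : St}
    (vp : s.v .p = p) (vq : s.v .q = p ^ e) (ve : s.v .e = e) (vd : s.v .d = d) (vd' : s.v .d' = d')
    (vm : s.v .m = m) (vN : s.v .N = N) (vX : s.v .X = d ^ m) (vr : s.v .r = 2 * m + 1)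
    (vL : s.v .L = m + 2 * m) (vB : s.v .B = 2 ^ (m + 2 * m)) (voF : s.v .oF = oF)
    (voP : s.v .oP = oP) (h0 : ∀ A, A ≠ .inp → ∀ i, s.a A i = 0)
    (E : ℕ → ℕ) (hE : ∀ j < e, s.a .inp (6 + j) = E j) (hEp : ∀ j < e, E j < p)
    (hζ : ζ ^ e = -∑ j ∈ Finset.range e, (E j : F) * ζ ^ j)
    (f : ℕ → F) (hf : ∀ k < d ^ m, s.a .inp (oF + k) = enc (f k))
    (a : ℕ → ℕ → F) (ha : ∀ i < N, ∀ l < m, s.a .inp (oP + i * m + l) = enc (a i l))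
    (hd2 : 2 ≤ d') (hd'd : d' ≤ d) (hdvd : d' - 1 ∣ p ^ e - 1) (hdd : d - 1 ≤ 2 * (d' - 1))
    (D : ℕ) (hD : ∀ k < d ^ m, f k ≠ 0 → ∑ l ∈ Finset.range m, k / d ^ l % d = D) :
    ∀ i < N, (bodyS.run s).a .inp i =
      enc (∑ κ ∈ Finset.range (d ^ m), f κ * ∏ l ∈ Finset.range m, a i l ^ (κ / d ^ l % d)) := by
  obtain ⟨s', e'⟩ : ∃ s', s' = bodyS.run s := ⟨_, rfl⟩
  rw [← e']
  obtain ⟨s₁, F₁, e₁, e'⟩ := run_seq_split e'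
  obtain ⟨s₂, F₂, e₂, e'⟩ := run_seq_split e'
  obtain ⟨s₃, F₃, e₃, e'⟩ := run_seq_split e'
  obtain ⟨s₄, F₄, e₄, e'⟩ := run_seq_split e'
  obtain ⟨s₅, F₅, e₅, e'⟩ := run_seq_split e'
  obtain ⟨s₆, F₆, e₆, e'⟩ := run_seq_split e'
  obtain ⟨s₇, F₇, e₇, e'⟩ := run_seq_split e'
  obtain ⟨s₈, F₈, e₈, e'⟩ := run_seq_split e'
  obtain ⟨s₉, F₉, e₉, e'⟩ := run_seq_split e'
  obtain ⟨s₁₀, F₁₀, e₁₀, e'⟩ := run_seq_split e'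
  obtain ⟨s₁₁, F₁₁, e₁₁, e'⟩ := run_seq_split e'
  obtain ⟨s₁₂, F₁₂, e₁₂, e'⟩ := run_seq_split e'
  have hs₁ : AddEnv p e enc s₁ := ⟨by rw [F₁.v .p rfl, vp], by rw [F₁.v .q rfl, vq], fun x y => by
    rw [e₁]; exact addS_run h vp vq (h0 .add (by simp) 0) x y⟩
  have hs₂ := hs₁.frame F₂ rfl rfl rfl
  have hne : s₂.v .ne = enc (ζ ^ e) := by
    rw [e₂]
    exact redS_run h hs₁.vp hs₁.vq (by rw [F₁.v .e rfl, ve]) E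
      (fun j hj => by rw [F₁.a .inp rfl, hE j hj]) hEp hζ
  have hs₃ := hs₂.frame F₃ rfl rfl rfl
  have hmz : ∀ x, s₃.a .mulz (enc x) = enc (ζ * x) := fun x => by
    rw [e₃]; exact mulzS_run h hs₂ hne x
  have hs₄ : SerEnv p e (2 * m + 1) enc s₄ := ⟨⟨hs₃.frame F₄ rfl rfl rfl, fun x y => by
    rw [e₄]; exact mulS_run h hs₃ hmz x y⟩, by
    rw [F₄.v .r rfl, F₃.v .r rfl, F₂.v .r rfl, F₁.v .r rfl, vr]⟩
  have hs₅ := hs₄.frame F₅ rfl rfl rfl rfl rfl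
  obtain ⟨hU, hT⟩ := rootS_run h hs₄
  rw [← e₅] at hU hT
  have hs₆ := hs₅.frame F₆ rfl rfl rfl rfl rfl
  obtain ⟨hn, hb⟩ := curveParamS_run h hs₅.toAddEnv
  rw [← e₆, F₅.v .d' rfl, F₄.v .d' rfl, F₃.v .d' rfl, F₂.v .d' rfl, F₁.v .d' rfl, vd'] at hn hb
  have G₆ : ∀ x, (x = .d ∨ x = .m ∨ x = .X ∨ x = .oF ∨ x = .oP ∨ x = .N ∨ x = .L ∨ x = .B) →
      s₆.v x = s.v x := by
    intro x hx
    rcases hx with rfl | rfl | rfl | rfl | rfl | rfl | rfl | rfl <;>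
    rw [F₆.v _ rfl, F₅.v _ rfl, F₄.v _ rfl, F₃.v _ rfl, F₂.v _ rfl, F₁.v _ rfl]
  have inp₆ : s₆.a .inp = s.a .inp := by
    rw [F₆.a _ rfl, F₅.a _ rfl, F₄.a _ rfl, F₃.a _ rfl, F₂.a _ rfl, F₁.a _ rfl]
  have hs₇ := hs₆.frame F₇ rfl rfl rfl rfl rfl
  obtain ⟨n, hn'⟩ : ∃ n, n = (p ^ e - 1) / (d' - 1) := ⟨_, rfl⟩
  obtain ⟨b, hb'⟩ : ∃ b : F, b = -((d' - 1 : ℕ) : F) := ⟨_, rfl⟩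
  rw [← hn'] at hn
  rw [← hb'] at hb
  have hmul : n * (d' - 1) = p ^ e - 1 := by rw [hn', Nat.div_mul_cancel hdvd]
  -- The computed degree is used rather than `D`: for f = 0 the two may differ, and then any degree
  -- works.
  obtain ⟨D', hD'⟩ : ∃ D', s₇.v .D = D' := ⟨_, rfl⟩
  have hDD : ∀ k < d ^ m, f k ≠ 0 → ∑ l ∈ Finset.range m, k / d ^ l % d = D' := by
    intro k hk hk0
    have hne0 : ∀ k < d ^ m, s₆.a .inp (oF + k) ≠ 0 ↔ f k ≠ 0 := by
      intro k hk
      rw [inp₆, hf k hk, ← h.enc_zero, Ne, h.enc_inj]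
    rw [hD k hk hk0, ← hD', e₇]
    symm
    refine degS_run (by rw [G₆ .d (by simp), vd]) (by rw [G₆ .m (by simp), vm])
      (by rw [G₆ .X (by simp), vX]) (by rw [G₆ .oF (by simp), voF]) (by omega)
      (fun k hk hk0 => hD k hk ((hne0 k hk).1 hk0)) ⟨k, hk, (hne0 k hk).2 hk0⟩
  have hs₈ := hs₇.frame F₈ rfl rfl rfl rfl rfl
  have hc := curveS_run h hs₇ (Nat.succ_pos _) (n := n) (b := b) (by rw [F₇.v .n rfl, hn])
    (by rw [F₇.v .b rfl, hb]) (by rw [F₇.a .T rfl, F₆.a .T rfl]; exact hT)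
  rw [← e₈] at hc
  have hs₉ := hs₈.frame F₉ rfl rfl rfl rfl rfl
  have hw := weightS_run h (D := D') hs₈ (by rw [F₈.v .D rfl, hD'])
    (by rw [F₈.a .U rfl, F₇.a .U rfl, F₆.a .U rfl]; exact hU)
    (by rw [F₈.a .T rfl, F₇.a .T rfl, F₆.a .T rfl]; exact hT)
  rw [← e₉] at hw
  have hs₁₀ := hs₉.frame F₁₀ rfl rfl rfl rfl rfl
  have zero₉ : ∀ A, (A = .mark ∨ A = .xs) → ∀ i, s₉.a A i = 0 := by
    intro A hA i
    rcases hA with rfl | rfl <;>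
    rw [F₉.a _ rfl, F₈.a _ rfl, F₇.a _ rfl, F₆.a _ rfl, F₅.a _ rfl, F₄.a _ rfl, F₃.a _ rfl,
      F₂.a _ rfl, F₁.a _ rfl, h0 _ (by simp)]
  obtain ⟨pts, hxs, hrank⟩ := gridS_run h hs₉.toAddEnv (n := n) (b := b) (d := d)
    (fun x => by rw [F₉.a .val rfl]; exact (hc x).1) (zero₉ .mark (by simp)) (zero₉ .xs (by simp))
    ((card_base_le hd2 (by rw [hq, hmul]) b).trans hd'd)
  rw [← e₁₀] at hxs hrank
  have hs₁₁ := hs₁₀.frame F₁₁ rfl rfl rfl rfl rfl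
  have G₁₀ : ∀ x, (x = .d ∨ x = .m ∨ x = .X ∨ x = .oF ∨ x = .oP ∨ x = .N ∨ x = .L ∨ x = .B) →
      s₁₀.v x = s.v x := by
    intro x hx
    rw [← G₆ x hx]
    rcases hx with rfl | rfl | rfl | rfl | rfl | rfl | rfl | rfl <;>
    rw [F₁₀.v _ rfl, F₉.v _ rfl, F₈.v _ rfl, F₇.v _ rfl]
  have G₁₁ : ∀ x, (x = .d ∨ x = .m ∨ x = .X ∨ x = .oF ∨ x = .oP ∨ x = .N ∨ x = .L ∨ x = .B) →
      s₁₁.v x = s.v x := by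
    intro x hx
    rw [← G₁₀ x hx]
    rcases hx with rfl | rfl | rfl | rfl | rfl | rfl | rfl | rfl <;> rw [F₁₁.v _ rfl]
  have inp₁₁ : s₁₁.a .inp = s.a .inp := by
    rw [F₁₁.a _ rfl, F₁₀.a _ rfl, F₉.a _ rfl, F₈.a _ rfl, F₇.a _ rfl, inp₆]
  have hpt := taylorS_run h hs₁₀ (Nat.succ_pos _) (by rw [G₁₀ .d (by simp), vd]) pts hxs
  rw [← e₁₁] at hpt
  let I : Inst F := ⟨p, e, 2 * m, d, m, N, n, D', oF, oP, ζ, b, enc, f, a, pts⟩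
  have hI : I.Env s₁₁ := by
    refine ⟨hs₁₁, ?_, ?_, ?_, ?_, ?_, ?_, ?_, ?_, ?_, ?_, ?_, ?_, ?_⟩
    · rw [G₁₁ .d (by simp), vd]
    · rw [G₁₁ .m (by simp), vm]
    · rw [G₁₁ .X (by simp), vX]
    · rw [G₁₁ .N (by simp), vN]
    · rw [G₁₁ .oF (by simp), voF]
    · rw [G₁₁ .oP (by simp), voP]
    · rw [inp₁₁]; exact hf
    · rw [inp₁₁]; exact ha
    · rw [F₁₁.a .val rfl, F₁₀.a .val rfl, F₉.a .val rfl]; exact fun x => (hc x).1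
    · rw [F₁₁.a .rank rfl]; exact hrank
    · rw [F₁₁.a .del rfl, F₁₀.a .del rfl, F₉.a .del rfl]; exact fun x => (hc x).2
    · rw [F₁₁.a .om rfl, F₁₀.a .om rfl]; exact hw
    · exact fun x hx j hj k hk => hpt x j k hx hj hk
  have hout : ∀ i < N, s₁₁.a .out i = 0 := by
    intro i _
    rw [F₁₁.a _ rfl, F₁₀.a _ rfl, F₉.a _ rfl, F₈.a _ rfl, F₇.a _ rfl, F₆.a _ rfl, F₅.a _ rfl,
      F₄.a _ rfl, F₃.a _ rfl, F₂.a _ rfl, F₁.a _ rfl, h0 _ (by simp)]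
  have hmain := mainS_run I h hI (show 0 < d by omega) rfl (by rw [G₁₁ .L (by simp), vL])
    (by rw [G₁₁ .B (by simp), vB]) hout
  rw [← e₁₂] at hmain
  have hI₁₂ := hI.frame F₁₂ rfl rfl
  have hp1 : 1 ≤ p ^ e := (Nat.zero_le _).trans_lt (h.lt 0)
  -- In F, n·b = -n(d'-1) = -(q-1) = 1, because q is a power of the characteristic.
  have hnb : (n : F) * b = 1 := by
    rw [hb', mul_neg, ← Nat.cast_mul, hmul, Nat.cast_sub hp1, Nat.cast_pow, h.char,
      zero_pow (by have := h.he; omega)]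
    simp
  -- Every exponent is at most d - 1 ≤ 2(d'-1), and n(d'-1) = q - 1; this is why order 2m suffices.
  have hdeg : ∀ κ, n * ∑ l ∈ Finset.range m, κ / d ^ l % d ≤ 2 * m * (p ^ e - 1) := by
    intro κ
    calc n * ∑ l ∈ Finset.range m, κ / d ^ l % d
        ≤ n * ∑ l ∈ Finset.range m, 2 * (d' - 1) := by
          refine Nat.mul_le_mul_left _ (Finset.sum_le_sum fun l _ => ?_)
          have := Nat.mod_lt (κ / d ^ l) (show 0 < d by omega)
          omega
      _ = 2 * m * (n * (d' - 1)) := by rw [Finset.sum_const, Finset.card_range, smul_eq_mul]; ring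
      _ = _ := by rw [hmul]
  intro i hi
  have := outS_run I h hI₁₂.toFieldEnv hI₁₂.vN hmain i hi
  rw [e', this, sum_term I hq rfl hnb hDD hdeg, neg_neg]

end Body
end MME

/-! ## The coding of the instances -/

namespace MME

/-! ### The coding of the field as a quotient of a polynomial ring -/

section Encode
variable {p : ℕ} [Fact p.Prime] {E : Polynomial (ZMod p)} {F : Type*} [Field F]

theorem card_adjoinRoot [Fintype F] (hE : E.Monic) (θ : AdjoinRoot E ≃+* F) :
    Fintype.card F = p ^ E.natDegree := by
  have : Module.Finite (ZMod p) (AdjoinRoot E) := (AdjoinRoot.powerBasis' hE).finite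
  rw [← Nat.card_eq_fintype_card, ← Nat.card_congr θ.toEquiv,
    Module.natCard_eq_pow_finrank (K := ZMod p), Nat.card_zmod, (AdjoinRoot.powerBasis' hE).finrank,
    AdjoinRoot.powerBasis'_dim]

theorem map_of_val (θ : AdjoinRoot E ≃+* F) (x : ZMod p) : θ (AdjoinRoot.of E x) = (x.val : F) := by
  conv_lhs => rw [← ZMod.natCast_zmod_val x]
  rw [map_natCast, map_natCast]

theorem cast_char (θ : AdjoinRoot E ≃+* F) : (p : F) = 0 := by
  have h : ((p : ZMod p) : ZMod p) = 0 := ZMod.natCast_self p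
  rw [← map_natCast θ, ← map_natCast (AdjoinRoot.of E), h, map_zero, map_zero]

theorem dec_encode (hE : E.Monic) (θ : AdjoinRoot E ≃+* F) (x : F) :
    dec p (θ (AdjoinRoot.root E)) (encode hE θ x) = x := by
  have hp := (Fact.out : p.Prime).one_lt
  rw [encode, dec_sum hp _ _ _ fun j => ZMod.val_lt _]
  obtain ⟨P, hP⟩ := AdjoinRoot.mk_surjective (θ.symm x)
  rw [← hP, AdjoinRoot.modByMonicHom_mk]
  have hx : x = θ (AdjoinRoot.mk E (P %ₘ E)) := by
    rw [← AdjoinRoot.modByMonicHom_mk hE, AdjoinRoot.mk_leftInverse hE, hP, RingEquiv.apply_symm_apply]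
  conv_rhs => rw [hx, ← Polynomial.sum_modByMonic_coeff hE Polynomial.degree_le_natDegree]
  rw [map_sum, map_sum, Finset.sum_range]
  refine Finset.sum_congr rfl fun j _ => ?_
  rw [← Polynomial.C_mul_X_pow_eq_monomial, map_mul, map_mul, map_pow, map_pow, AdjoinRoot.mk_C,
    AdjoinRoot.mk_X, map_of_val]

theorem encode_lt (hE : E.Monic) (θ : AdjoinRoot E ≃+* F) (x : F) :
    encode hE θ x < p ^ E.natDegree :=
  sum_digits_lt _ _ fun _ => ZMod.val_lt _

/-- Decoding is a left inverse of encoding by reduction modulo E. Equal cardinalities make encoding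
a bijection onto the words below p^e, so decoding is also a right inverse there. -/
theorem coding_encode [Fintype F] (hE : E.Monic) (θ : AdjoinRoot E ≃+* F) :
    Coding p E.natDegree (θ (AdjoinRoot.root E)) (encode hE θ) := by
  have hp := (Fact.out : p.Prime).one_lt
  have hcard := card_adjoinRoot hE θ
  refine ⟨hp, ?_, cast_char θ, encode_lt hE θ, fun z hz => ?_, dec_encode hE θ⟩
  · by_contra h0
    have : 1 < Fintype.card F := Fintype.one_lt_card
    rw [hcard, show E.natDegree = 0 by omega] at this
    simp at this
  · let g : F → Fin (p ^ E.natDegree) := fun x => ⟨encode hE θ x, encode_lt hE θ x⟩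
    have hg : Function.Injective g := fun x y hxy => by
      rw [← dec_encode hE θ x, ← dec_encode hE θ y, Fin.mk.inj_iff.1 hxy]
    have hb : Function.Bijective g := (Fintype.bijective_iff_injective_and_card g).2
      ⟨hg, by rw [hcard, Fintype.card_fin]⟩
    obtain ⟨x, hx⟩ := hb.2 ⟨z, hz⟩
    have hx' : encode hE θ x = z := Fin.mk.inj_iff.1 hx
    rw [← hx', dec_encode]

theorem root_pow_natDegree (hE : E.Monic) (θ : AdjoinRoot E ≃+* F) :
    θ (AdjoinRoot.root E) ^ E.natDegree =
      -∑ j ∈ Finset.range E.natDegree, ((E.coeff j).val : F) * θ (AdjoinRoot.root E) ^ j := by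
  have h : θ (AdjoinRoot.mk E E) = 0 := by rw [AdjoinRoot.mk_self, map_zero]
  have h' := congrArg (fun P => θ (AdjoinRoot.mk E P)) hE.as_sum
  simp only [h, map_add, map_sum, map_mul, map_pow, AdjoinRoot.mk_C, AdjoinRoot.mk_X,
    map_of_val] at h'
  exact eq_neg_of_add_eq_zero_left h'.symm
end Encode

/-! ### Polynomials as coefficient vectors indexed by base-d digits -/

section Poly
variable {F : Type*} [Field F]

theorem prod_exponent {d m : ℕ} (k : ℕ) (a : Fin m → F) :
    ∏ i, a i ^ exponent d m k i =
      ∏ l ∈ Finset.range m, (if h : l < m then a ⟨l, h⟩ else 0) ^ (k / d ^ l % d) := by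
  rw [Finset.prod_range]
  refine Finset.prod_congr rfl fun i _ => ?_
  simp [exponent]

theorem exists_exponent {d m : ℕ} (s : Fin m →₀ ℕ) (hs : ∀ i, s i < d) :
    ∃ k < d ^ m, exponent d m k = s := by
  refine ⟨finFunctionFinEquiv fun i => ⟨s i, hs i⟩, Fin.is_lt _, ?_⟩
  ext i
  have := finFunctionFinEquiv_symm_apply_val (finFunctionFinEquiv fun i => (⟨s i, hs i⟩ : Fin d)) i
  rw [Equiv.symm_apply_apply] at this
  simpa [exponent] using this.symm

theorem exponent_injOn {d m : ℕ} : Set.InjOn (exponent d m) (Finset.range (d ^ m)) := by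
  intro k hk k' hk' h
  have hk := Finset.mem_range.1 hk
  have hk' := Finset.mem_range.1 hk'
  have : finFunctionFinEquiv.symm (⟨k, hk⟩ : Fin (d ^ m)) =
      finFunctionFinEquiv.symm (⟨k', hk'⟩ : Fin (d ^ m)) := by
    ext i
    have := DFunLike.congr_fun h i
    rw [finFunctionFinEquiv_symm_apply_val, finFunctionFinEquiv_symm_apply_val]
    simpa [exponent] using this
  simpa using finFunctionFinEquiv.symm.injective this

theorem eval_eq_sum_exponent {d m : ℕ} (f : MvPolynomial (Fin m) F) (hf : ∀ i, f.degreeOf i < d)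
    (a : Fin m → F) : MvPolynomial.eval a f = ∑ k ∈ Finset.range (d ^ m),
      f.coeff (exponent d m k) *
        ∏ l ∈ Finset.range m, (if h : l < m then a ⟨l, h⟩ else 0) ^ (k / d ^ l % d) := by
  classical
  rw [MvPolynomial.eval_eq']
  simp only [← prod_exponent]
  rw [← Finset.sum_image (f := fun s => f.coeff s * ∏ i, a i ^ s i) exponent_injOn]
  refine Finset.sum_subset (fun s hs => ?_) fun s _ hs => ?_
  · have hlt : ∀ i, s i < d := fun i =>
      (MvPolynomial.degreeOf_lt_iff ((Nat.zero_le _).trans_lt (hf i))).1 (hf i) s hs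
    obtain ⟨k, hk, rfl⟩ := exists_exponent s hlt
    exact Finset.mem_image_of_mem _ (Finset.mem_range.2 hk)
  · rw [MvPolynomial.notMem_support_iff.1 hs, zero_mul]

theorem sum_digits_of_isHomogeneous {d m D : ℕ} {f : MvPolynomial (Fin m) F}
    (hf : f.IsHomogeneous D) {k : ℕ} (hk : f.coeff (exponent d m k) ≠ 0) :
    ∑ l ∈ Finset.range m, k / d ^ l % d = D := by
  have h := hf hk
  have h' := DFunLike.congr_fun (Finsupp.degree_eq_weight_one (R := ℕ) (σ := Fin m)) (exponent d m k)
  rw [Finset.sum_range, ← h]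
  refine Eq.trans ?_ h'
  rw [Finsupp.degree_eq_sum]
  simp [exponent]
end Poly

/-! ### Positions and sizes in the input list -/

section Input

theorem getD_flatten {n : ℕ} : ∀ (L : List (List ℕ)) (_ : ∀ l ∈ L, l.length = n) (i j : ℕ)
    (_ : i < L.length) (_ : j < n), L.flatten.getD (i * n + j) 0 = (L.getD i []).getD j 0
  | [], _, _, _, h, _ => by simp at h
  | l :: L, hL, i, j, hi, hj => by
    have hl : l.length = n := hL l (by simp)
    rw [List.flatten_cons]
    rcases i with _ | i
    · rw [zero_mul, zero_add, List.getD_append _ _ _ _ (by omega)]; rfl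
    · rw [List.getD_append_right _ _ _ _ (by rw [hl, Nat.succ_mul]; omega), hl,
        show (i + 1) * n + j - n = i * n + j by rw [Nat.succ_mul]; omega,
        getD_flatten L (fun l hl => hL l (by simp [hl])) i j (by simpa using hi) hj]
      rfl

variable {p : ℕ} [Fact p.Prime] {E : Polynomial (ZMod p)} (hE : E.Monic)
  {F : Type*} [Field F] (θ : AdjoinRoot E ≃+* F) (d d' m N : ℕ)
  (f : MvPolynomial (Fin m) F) (a : Fin N → Fin m → F)

theorem input_coeff_modulus {j : ℕ} (hj : j < E.natDegree) :
    (input hE θ d d' m N f a).getD (6 + j) 0 = (E.coeff j).val := by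
  rw [input, List.append_assoc, List.append_assoc, List.getD_append_right _ _ _ _ (by simp),
    List.getD_append _ _ _ _ (by simp; omega)]
  simp [hj]

theorem input_coeff {k : ℕ} (hk : k < d ^ m) :
    (input hE θ d d' m N f a).getD (6 + E.natDegree + k) 0 =
      encode hE θ (f.coeff (exponent d m k)) := by
  rw [input, List.append_assoc, List.getD_append_right _ _ _ _ (by simp; omega),
    List.getD_append _ _ _ _ (by simp; omega)]
  have : 6 + E.natDegree + k - (E.natDegree + 6) = k := by omega
  simp [hk, this]

theorem input_point (i : Fin N) (l : Fin m) :
    (input hE θ d d' m N f a).getD (6 + E.natDegree + d ^ m + i * m + l) 0 =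
      encode hE θ (a i l) := by
  rw [input, List.getD_append_right _ _ _ _ (by simp; omega)]
  simp only [List.length_append, List.length_cons, List.length_nil, List.length_map,
    List.length_range]
  rw [show 6 + E.natDegree + d ^ m + i * m + l - (0 + 1 + 1 + 1 + 1 + 1 + 1 + E.natDegree + d ^ m) =
    i * m + l by omega, getD_flatten _ (by simp [List.mem_ofFn]) _ _ (by simp) l.2]
  simp

theorem length_input : (input hE θ d d' m N f a).length = 6 + E.natDegree + d ^ m + N * m := by
  simp [input, List.length_flatten, Function.comp_def]
  ring

theorem mem_input_le {x B : ℕ} (hx : x ∈ input hE θ d d' m N f a) (h1 : p ^ E.natDegree ≤ B)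
    (h2 : d ≤ B) (h3 : d' ≤ B) (h4 : m ≤ B) (h5 : N ≤ B) (h6 : p ≤ B) : x ≤ B := by
  have := (Fact.out : p.Prime).one_lt
  have he : E.natDegree ≤ B := (Nat.lt_pow_self this).le.trans h1
  simp only [input, List.mem_append, List.mem_cons, List.not_mem_nil, or_false, List.mem_map,
    List.mem_range, List.mem_flatten, List.mem_ofFn] at hx
  rcases hx with ((hx | ⟨j, hj, rfl⟩) | ⟨j, hj, rfl⟩) | ⟨L, ⟨i, rfl⟩, hx⟩
  · rcases hx with rfl | rfl | rfl | rfl | rfl | rfl <;> assumption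
  · exact (ZMod.val_lt _).le.trans h6
  · exact (encode_lt hE θ _).le.trans h1
  · obtain ⟨l, rfl⟩ := List.mem_ofFn.1 hx
    exact (encode_lt hE θ _).le.trans h1

theorem getD_input_le {B : ℕ} (i : ℕ) (h1 : p ^ E.natDegree ≤ B) (h2 : d ≤ B) (h3 : d' ≤ B)
    (h4 : m ≤ B) (h5 : N ≤ B) (h6 : p ≤ B) : (input hE θ d d' m N f a).getD i 0 ≤ B := by
  rcases lt_or_ge i (input hE θ d d' m N f a).length with hi | hi
  · rw [List.getD_eq_getElem _ _ hi]
    exact mem_input_le hE θ d d' m N f a (List.getElem_mem hi) h1 h2 h3 h4 h5 h6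
  · rw [List.getD_eq_default _ _ hi]
    exact Nat.zero_le _

end Input
end MME

/-! ## The whole program -/

namespace MME
open ForLang ForLang.Stmt

/-! ### Reading the parameters, with bounds from actual values -/

section Param
variable {σ : Size}

/-- A repeated product has no useful static bound, so its assignments are flagged and all
intermediate powers are bounded by hand. -/
theorem powS_run {s : St} {x : Var} {a n : Expr} (hx : x ≠ .i) {A k : ℕ}
    (hn : n.eval (s.setv x 1) = k) (ha : ∀ s', (powS x a n).Frame s s' → a.eval s' = A) :
    ((powS x a n).run s).v x = A ^ k ∧
      ((∀ j ≤ k, A ^ j ≤ (bounds.v x).val σ) → (powS x a n).Dyn bounds σ s) := by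
  subst hn
  -- The bound is left arbitrary so that the literal `j` also describes the state after `j` rounds.
  have key : ∀ t : Expr, ((Stmt.loop .i t (.assign true x (x * a))).run (s.setv x 1)).v x =
      A ^ t.eval (s.setv x 1) := by
    intro t
    refine Stmt.for_ind (I := fun j s' => s'.v x = A ^ j) (by simp) ?_
    intro j _ s' hF hI
    have : (powS x a n).Frame s (s'.setv .i j) := by
      refine ⟨fun y hy => ?_, fun B hB => hF.a B rfl⟩
      simp only [powS, modv, Bool.or_eq_false_iff, decide_eq_false_iff_not] at hy
      rw [St.setv_v, if_neg hy.2.1, hF.v y (by simp [modv, hy]), St.setv_v, if_neg hy.1]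
    simp [ha _ this, hx, hI, pow_succ]
  refine ⟨key n, fun hle => ⟨?_, fun j hj => ?_⟩⟩
  · have := hle 0 (Nat.zero_le _)
    rwa [pow_zero] at this
  have h1 := key (.num j)
  rw [Stmt.run_for] at h1
  have hF := (Stmt.loop .i (.num j) (.assign true x (x * a))).frame (s.setv x 1)
  rw [Stmt.run_for] at hF
  simp only [Expr.eval_num] at h1 hF
  have : (powS x a n).Frame s ((iter (fun i s' => (Stmt.assign true x (x * a)).run (s'.setv .i i))
      (s.setv x 1) j).setv .i j) := by
    refine ⟨fun y hy => ?_, fun B hB => hF.a B rfl⟩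
    simp only [powS, modv, Bool.or_eq_false_iff, decide_eq_false_iff_not] at hy
    rw [St.setv_v, if_neg hy.2.1, hF.v y (by simp [modv, hy]), St.setv_v, if_neg hy.1]
  change (Expr.op .mul (.var x) a).eval _ ≤ _
  have he : (Expr.op .mul (.var x) a).eval ((iter (fun i s' => (Stmt.assign true x (x * a)).run
      (s'.setv .i i)) (s.setv x 1) j).setv .i j) = A ^ (j + 1) := by
    change St.v _ x * a.eval _ = _
    rw [ha _ this, St.setv_v, if_neg hx, h1, pow_succ]
  exact he.le.trans (hle (j + 1) hj)

/-- The values of the parameters are in place. -/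
structure Params (p e d d' m N : ℕ) (s : St) : Prop where
  vp : s.v .p = p
  ve : s.v .e = e
  vd : s.v .d = d
  vd' : s.v .d' = d'
  vm : s.v .m = m
  vN : s.v .N = N
  vq : s.v .q = p ^ e
  vX : s.v .X = d ^ m
  vr : s.v .r = 2 * m + 1
  vL : s.v .L = m + 2 * m
  vB : s.v .B = 2 ^ (m + 2 * m)
  voF : s.v .oF = 6 + e
  voP : s.v .oP = 6 + e + d ^ m

theorem paramS_run {s : St} {p e d d' m N : ℕ} (h0 : s.a .inp 0 = p) (h1 : s.a .inp 1 = e)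
    (h2 : s.a .inp 2 = d) (h3 : s.a .inp 3 = d') (h4 : s.a .inp 4 = m) (h5 : s.a .inp 5 = N)
    (hp : p ≤ σ.S) (he : e ≤ σ.S) (hd : d ≤ σ.S) (hd' : d' ≤ σ.S) (hm : m ≤ σ.S) (hN : N ≤ σ.Y)
    (hq : ∀ j ≤ e, p ^ j ≤ σ.S) (hX : ∀ j ≤ m, d ^ j ≤ σ.Y)
    (hB : ∀ j ≤ m + 2 * m, 2 ^ j ≤ σ.Z ^ 3) :
    Params p e d d' m N (paramS.run s) ∧ paramS.Dyn bounds σ s := by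
  obtain ⟨s', e'⟩ : ∃ s', s' = paramS.run s := ⟨_, rfl⟩
  rw [← e']
  have dyn : ∀ {P Q : Stmt} {s s₁ : St}, s₁ = P.run s → P.Dyn bounds σ s → Q.Dyn bounds σ s₁ →
      (P ;; Q).Dyn bounds σ s := fun h h1 h2 => ⟨h1, h ▸ h2⟩
  have v1 : (⟨1, 0, 0⟩ : Lv).val σ = σ.S := by simp [Lv.val]
  have v2 : (⟨0, 0, 1⟩ : Lv).val σ = σ.Y := by simp [Lv.val]
  have v3 : (⟨0, 3, 0⟩ : Lv).val σ = σ.Z ^ 3 := by simp [Lv.val]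
  obtain ⟨s₁, F₁, e₁, e'⟩ := run_seq_split e'
  obtain ⟨s₂, F₂, e₂, e'⟩ := run_seq_split e'
  obtain ⟨s₃, F₃, e₃, e'⟩ := run_seq_split e'
  obtain ⟨s₄, F₄, e₄, e'⟩ := run_seq_split e'
  obtain ⟨s₅, F₅, e₅, e'⟩ := run_seq_split e'
  obtain ⟨s₆, F₆, e₆, e'⟩ := run_seq_split e'
  obtain ⟨s₇, F₇, e₇, e'⟩ := run_seq_split e'
  obtain ⟨s₈, F₈, e₈, e'⟩ := run_seq_split e'
  obtain ⟨s₉, F₉, e₉, e'⟩ := run_seq_split e'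
  obtain ⟨s₁₀, F₁₀, e₁₀, e'⟩ := run_seq_split e'
  obtain ⟨s₁₁, F₁₁, e₁₁, e'⟩ := run_seq_split e'
  obtain ⟨s₁₂, F₁₂, e₁₂, e'⟩ := run_seq_split e'
  have F₁₃ := (Stmt.assign false .oP (Var.oF + Var.X)).frame s₁₂
  rw [← e'] at F₁₃
  have i₁ : s₁.a .inp = s.a .inp := F₁.a _ rfl
  have i₂ : s₂.a .inp = s.a .inp := (F₂.a _ rfl).trans i₁
  have i₃ : s₃.a .inp = s.a .inp := (F₃.a _ rfl).trans i₂
  have i₄ : s₄.a .inp = s.a .inp := (F₄.a _ rfl).trans i₃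
  have i₅ : s₅.a .inp = s.a .inp := (F₅.a _ rfl).trans i₄
  have p₁ : s₁.v .p = p := by rw [e₁]; simp [h0]
  have x₂ : s₂.v .e = e := by rw [e₂]; simp [i₁, h1]
  have x₃ : s₃.v .d = d := by rw [e₃]; simp [i₂, h2]
  have x₄ : s₄.v .d' = d' := by rw [e₄]; simp [i₃, show (3 : Expr).eval s₃ = 3 from rfl, h3]
  have x₅ : s₅.v .m = m := by rw [e₅]; simp [i₄, show (4 : Expr).eval s₄ = 4 from rfl, h4]
  have x₆ : s₆.v .N = N := by rw [e₆]; simp [i₅, show (5 : Expr).eval s₅ = 5 from rfl, h5]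
  have p₆ : s₆.v .p = p := by
    rw [F₆.v _ rfl, F₅.v _ rfl, F₄.v _ rfl, F₃.v _ rfl, F₂.v _ rfl, p₁]
  have e₆' : s₆.v .e = e := by rw [F₆.v _ rfl, F₅.v _ rfl, F₄.v _ rfl, F₃.v _ rfl, x₂]
  have d₇ : s₇.v .d = d := by rw [F₇.v _ rfl, F₆.v _ rfl, F₅.v _ rfl, F₄.v _ rfl, x₃]
  have m₇ : s₇.v .m = m := by rw [F₇.v _ rfl, F₆.v _ rfl, x₅]
  obtain ⟨q₇, dq⟩ := powS_run (σ := σ) (s := s₆) (x := .q) (a := Var.p) (n := Var.e) (by simp)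
    (A := p) (k := e) (by simp [e₆']) (fun t ht => by simp [ht.v .p rfl, p₆])
  obtain ⟨X₈, dX⟩ := powS_run (σ := σ) (s := s₇) (x := .X) (a := Var.d) (n := Var.m) (by simp)
    (A := d) (k := m) (by simp [m₇]) (fun t ht => by simp [ht.v .d rfl, d₇])
  rw [← e₇] at q₇
  rw [← e₈] at X₈
  have m₈ : s₈.v .m = m := by rw [F₈.v _ rfl, m₇]
  have m₉ : s₉.v .m = m := by rw [F₉.v _ rfl, m₈]
  have r₉ : s₉.v .r = 2 * m + 1 := by rw [e₉]; simp [m₈, two_mul]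
  have L₁₀ : s₁₀.v .L = m + 2 * m := by rw [e₁₀]; simp [m₉]
  obtain ⟨B₁₁, dB⟩ := powS_run (σ := σ) (s := s₁₀) (x := .B) (a := 2) (n := Var.L) (by simp)
    (A := 2) (k := m + 2 * m) (by simp [L₁₀]) (fun t ht => by simp)
  rw [← e₁₁] at B₁₁
  have e₁₁' : s₁₁.v .e = e := by
    rw [F₁₁.v _ rfl, F₁₀.v _ rfl, F₉.v _ rfl, F₈.v _ rfl, F₇.v _ rfl, e₆']
  have oF₁₂ : s₁₂.v .oF = 6 + e := by rw [e₁₂]; simp [e₁₁']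
  have X₁₂ : s₁₂.v .X = d ^ m := by
    rw [F₁₂.v _ rfl, F₁₁.v _ rfl, F₁₀.v _ rfl, F₉.v _ rfl, X₈]
  constructor
  · constructor
    · rw [F₁₃.v _ rfl, F₁₂.v _ rfl, F₁₁.v _ rfl, F₁₀.v _ rfl, F₉.v _ rfl, F₈.v _ rfl, F₇.v _ rfl, p₆]
    · rw [F₁₃.v _ rfl, F₁₂.v _ rfl, e₁₁']
    · rw [F₁₃.v _ rfl, F₁₂.v _ rfl, F₁₁.v _ rfl, F₁₀.v _ rfl, F₉.v _ rfl, F₈.v _ rfl, d₇]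
    · rw [F₁₃.v _ rfl, F₁₂.v _ rfl, F₁₁.v _ rfl, F₁₀.v _ rfl, F₉.v _ rfl, F₈.v _ rfl, F₇.v _ rfl,
        F₆.v _ rfl, F₅.v _ rfl, x₄]
    · rw [F₁₃.v _ rfl, F₁₂.v _ rfl, F₁₁.v _ rfl, F₁₀.v _ rfl, m₉]
    · rw [F₁₃.v _ rfl, F₁₂.v _ rfl, F₁₁.v _ rfl, F₁₀.v _ rfl, F₉.v _ rfl, F₈.v _ rfl, F₇.v _ rfl, x₆]
    · rw [F₁₃.v _ rfl, F₁₂.v _ rfl, F₁₁.v _ rfl, F₁₀.v _ rfl, F₉.v _ rfl, F₈.v _ rfl, q₇]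
    · rw [F₁₃.v _ rfl, X₁₂]
    · rw [F₁₃.v _ rfl, F₁₂.v _ rfl, F₁₁.v _ rfl, F₁₀.v _ rfl, r₉]
    · rw [F₁₃.v _ rfl, F₁₂.v _ rfl, F₁₁.v _ rfl, L₁₀]
    · rw [F₁₃.v _ rfl, F₁₂.v _ rfl, B₁₁]
    · rw [F₁₃.v _ rfl, oF₁₂]
    · rw [e']; simp [oF₁₂, X₁₂]
  · have hS : ∀ x, bounds.v x = ⟨1, 0, 0⟩ → (bounds.v x).val σ = σ.S := fun x hx => by rw [hx, v1]
    refine dyn e₁ (?_ : s.a .inp 0 ≤ _) (dyn e₂ (?_ : s₁.a .inp 1 ≤ _)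
      (dyn e₃ (?_ : s₂.a .inp 2 ≤ _) (dyn e₄ (?_ : s₃.a .inp 3 ≤ _)
      (dyn e₅ (?_ : s₄.a .inp 4 ≤ _) (dyn e₆ (?_ : s₅.a .inp 5 ≤ _) (dyn e₇ (dq ?_) (dyn e₈ (dX ?_)
      (dyn e₉ trivial (dyn e₁₀ trivial (dyn e₁₁ (dB ?_) (dyn e₁₂ trivial trivial)))))))))))
    · rw [h0]; exact hp.trans v1.ge
    · rw [i₁, h1]; exact he.trans v1.ge
    · rw [i₂, h2]; exact hd.trans v1.ge
    · rw [i₃, h3]; exact hd'.trans v1.ge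
    · rw [i₄, h4]; exact hm.trans v1.ge
    · rw [i₅, h5]; exact hN.trans v2.ge
    · exact fun j hj => (hq j hj).trans v1.ge
    · exact fun j hj => (hX j hj).trans v2.ge
    · exact fun j hj => (hB j hj).trans v3.ge

end Param

/-- The exponent 3 of Z comes from the loop over 2^(3m) bit strings. The exponent 1 of Y holds
because loops over the d^m coefficients and over the N points are never nested in one another. -/
theorem evaluationS_time : (evaluationS.time bounds).le ⟨108, 3, 1⟩ = true := by decide +kernel

end MME

namespace MME
open ForLang ForLang.Stmt

theorem dyn_evaluationS {σ : Size} {s : St} (h : paramS.Dyn bounds σ s) :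
    evaluationS.Dyn bounds σ s :=
  show paramS.Dyn bounds σ s ∧ bodyS.Dyn bounds σ (paramS.run s) from
    ⟨h, dyn_of_static _ _ bodyS_static⟩

theorem evaluationS_run {p : ℕ} [Fact p.Prime] {E : Polynomial (ZMod p)} (hE : E.Monic)
    {F : Type*} [Field F] [Fintype F] (θ : AdjoinRoot E ≃+* F) {q d d' m N : ℕ}
    (hq : Fintype.card F = q) (hd2 : 2 ≤ d') (hd'd : d' ≤ d) (hdd : d - 1 ≤ 2 * (d' - 1))
    (hdvd : d' - 1 ∣ q - 1) {f : MvPolynomial (Fin m) F} (hf : ∃ D, f.IsHomogeneous D)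
    (hfd : ∀ i, f.degreeOf i < d) (a : Fin N → Fin m → F)
    (σ : Size) (hS : σ.S = q + m + d) (hZ : σ.Z = 2 ^ m) (hY : σ.Y = d ^ m + N) :
    evaluationS.Dyn bounds σ (St.init (input hE θ d d' m N f a)) ∧
    ∀ i : Fin N, (evaluationS.run (St.init (input hE θ d d' m N f a))).a .inp i =
      encode hE θ (MvPolynomial.eval (a i) f) := by
  classical
  have h := coding_encode hE θ
  have hcard := card_adjoinRoot hE θ
  have hqe : q = p ^ E.natDegree := hq.symm.trans hcard
  have hp := h.hp
  have hpq : p ≤ q := hqe ▸ h.le_card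
  have heq : E.natDegree ≤ q := hqe ▸ (Nat.lt_pow_self hp).le
  obtain ⟨hP, hdyn⟩ := paramS_run (σ := σ) (s := St.init (input hE θ d d' m N f a)) (p := p)
    (e := E.natDegree) (d := d) (d' := d') (m := m) (N := N)
    (by simp [St.init, input]) (by simp [St.init, input]) (by simp [St.init, input]) (by simp [St.init, input]) (by simp [St.init, input])
    (by simp [St.init, input])
    (by omega) (by omega) (by omega) (by omega) (by omega) (by omega)
    (fun j hj => by
      have := Nat.pow_le_pow_right (show 0 < p by omega) hj
      omega)
    (fun j hj => by
      have := Nat.pow_le_pow_right (show 0 < d by omega) hj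
      omega)
    (fun j hj => by
      rw [hZ, ← pow_mul]
      exact Nat.pow_le_pow_right (by omega) (by omega))
  have hrun : evaluationS.run (St.init (input hE θ d d' m N f a)) =
      bodyS.run (paramS.run (St.init (input hE θ d d' m N f a))) := by rw [evaluationS, run_seq]
  refine ⟨dyn_evaluationS hdyn, fun i => ?_⟩
  rw [hrun]
  clear hrun
  have hF := paramS.frame (St.init (input hE θ d d' m N f a))
  have hinp : ∀ k, (paramS.run (St.init (input hE θ d d' m N f a))).a .inp k =
      (input hE θ d d' m N f a).getD k 0 := fun k => by rw [hF.a .inp rfl]; simp [St.init]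
  obtain ⟨D, hD⟩ := hf
  have key := bodyS_run h hcard hP.vp hP.vq hP.ve hP.vd hP.vd' hP.vm hP.vN hP.vX hP.vr hP.vL hP.vB
    hP.voF hP.voP
    (fun A hA k => by
      have : paramS.moda A = false := by cases A <;> rfl
      rw [hF.a A this]
      simp [St.init, hA])
    (fun j => (E.coeff j).val)
    (fun j hj => by rw [hinp, input_coeff_modulus _ _ _ _ _ _ _ _ hj])
    (fun j _ => ZMod.val_lt _) (root_pow_natDegree hE θ)
    (fun k => f.coeff (exponent d m k))
    (fun k hk => by rw [hinp, input_coeff _ _ _ _ _ _ _ _ hk])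
    (fun i l => if h : i < N ∧ l < m then a ⟨i, h.1⟩ ⟨l, h.2⟩ else 0)
    (fun i hi l hl => by
      rw [hinp, dif_pos ⟨hi, hl⟩]
      exact input_point hE θ d d' m N f a ⟨i, hi⟩ ⟨l, hl⟩)
    hd2 hd'd (hqe ▸ hdvd) hdd D (fun k _ hk => sum_digits_of_isHomogeneous hD hk) i i.2
  refine key.trans (congrArg (encode hE θ) ?_)
  rw [eval_eq_sum_exponent f hfd]
  refine Finset.sum_congr rfl fun k _ => ?_
  refine congrArg (f.coeff (exponent d m k) * ·) (Finset.prod_congr rfl fun l _ => ?_)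
  by_cases hl : l < m
  · rw [dif_pos ⟨i.2, hl⟩, dif_pos hl]
  · rw [dif_neg fun hh => hl hh.2, dif_neg hl]

end MME

/-- Fast multipoint evaluation over nice finite fields: one program `P` and constants `c`, `C`, `k`
serve all instances. Words may have any number `w ≥ c * log₂ (q + m + d + d ^ m + N)` of bits. -/
theorem mainTheorem6 :
    ∃ (P : WordRAM.Prog) (c C k : ℕ),
      ∀ (p : ℕ) [Fact p.Prime] (E : Polynomial (ZMod p)) (hE : E.Monic)
        (F : Type*) [Field F] [Fintype F] (θ : AdjoinRoot E ≃+* F)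
        (q : ℕ) (_ : Fintype.card F = q)
        (d d' m N : ℕ) (_ : (d' : ℝ) ∈ Set.Icc (0.8 * (d : ℝ)) (d : ℝ)) (_ : d' - 1 ∣ q - 1)
        (f : MvPolynomial (Fin m) F) (_ : ∃ D, f.IsHomogeneous D) (_ : ∀ i, f.degreeOf i < d)
        (a : Fin N → Fin m → F)
        (w : ℕ) (_ : (q + m + d + d ^ m + N) ^ c ≤ 2 ^ w),
        ∃ (t : ℕ) (s : WordRAM.State),
          WordRAM.Exec w P (WordRAM.State.init w (MME.input hE θ d d' m N f a)) t s ∧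
          t ≤ (d ^ m + N) * C ^ m * (q + m + d) ^ k ∧
          ∀ i : Fin N, s.mem i = MME.encode hE θ (MvPolynomial.eval (a i) f) := by
  -- With V = q+m+d+d^m+N, the value bound `topLv` is at most V^(40+6+3) = V^49, and V^11 pays for
  -- the 32 segments. C = 8 is Z^3 = (2^m)^3, and k = 108 + 3 absorbs the set-up steps.
  refine ⟨MME.evaluationS.prog, 60, 8, 111, ?_⟩
  intro p _ E hE F _ _ θ q hq d d' m N hd hdvd f hf hfd a w hw
  have hq2 : 2 ≤ q := hq ▸ Fintype.one_lt_card
  have hd'd : d' ≤ d := by exact_mod_cast hd.2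
  have h4 : 4 * d ≤ 5 * d' := by
    have := hd.1
    have : (4 * d : ℝ) ≤ 5 * d' := by linarith
    exact_mod_cast this
  -- If d' - 1 were 0, it would divide q - 1 ≥ 1, which is impossible.
  have hd2 : 2 ≤ d' := by
    have : d' - 1 ≠ 0 := fun h0 => by
      rw [h0, zero_dvd_iff] at hdvd; omega
    omega
  have hX : 1 ≤ d ^ m := Nat.one_le_pow _ _ (by omega)
  let σ : ForLang.Size := ⟨q + m + d, 2 ^ m, d ^ m + N, by omega, Nat.one_le_two_pow, by omega⟩
  -- The inequality d - 1 ≤ 2(d'-1) follows from 4d ≤ 5d' and d' ≥ 2; this is the only use of the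
  -- factor 0.8.
  obtain ⟨hdyn, hrun⟩ := MME.evaluationS_run hE θ hq hd2 hd'd (by omega) hdvd hf hfd a σ rfl rfl rfl
  have hqe := hq.symm.trans (MME.card_adjoinRoot hE θ)
  have hpq : p ≤ q := hqe ▸ (MME.coding_encode hE θ).le_card
  have heq : E.natDegree ≤ q := hqe ▸ (Nat.lt_pow_self (MME.coding_encode hE θ).hp).le
  obtain ⟨V, hV⟩ : ∃ V, V = q + m + d + d ^ m + N := ⟨_, rfl⟩
  rw [← hV] at hw
  have hV5 : 5 ≤ V := by omega
  have hZX : 2 ^ m ≤ d ^ m := Nat.pow_le_pow_left (by omega) m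
  have hcells : V ^ 49 < ForLang.cells w := by
    have h1 : V ^ 60 = V ^ 49 * V ^ 11 := by rw [← pow_add]
    have h2 : V ^ 49 * 5 ^ 11 ≤ V ^ 49 * V ^ 11 := by gcongr
    have h3 : 1 ≤ V ^ 49 := Nat.one_le_pow _ _ (by omega)
    rw [ForLang.cells, ← Nat.succ_le_iff, Nat.le_div_iff_mul_le (by norm_num)]
    omega
  have htop : MME.topLv.val σ ≤ V ^ 49 := by
    calc MME.topLv.val σ = (q + m + d) ^ 40 * (2 ^ m) ^ 6 * (d ^ m + N) ^ 3 := rfl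
      _ ≤ V ^ 40 * V ^ 6 * V ^ 3 := by gcongr <;> omega
      _ = V ^ 49 := by ring
  have hVle : V ≤ V ^ 49 := Nat.le_self_pow (by norm_num) V
  have hcw : ForLang.cells w < 2 ^ w := by
    have : ForLang.cells w ≤ 2 ^ w - 1 := Nat.div_le_self _ _
    have := Nat.one_le_two_pow (n := w)
    omega
  have hmem : ∀ x ∈ MME.input hE θ d d' m N f a, x ≤ V := fun x hx =>
    MME.mem_input_le hE θ d d' m N f a hx (by omega) (by omega) (by omega) (by omega) (by omega)
      (by omega)
  have hBdd : (ForLang.St.init (MME.input hE θ d d' m N f a)).Bdd MME.bounds σ := by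
    refine ⟨fun x => Nat.zero_le _, fun A i => ?_⟩
    change (if A = .inp then (MME.input hE θ d d' m N f a).getD i 0 else 0) ≤
      (q + m + d) ^ 10 * (2 ^ m) ^ 0 * (d ^ m + N) ^ 1
    split_ifs
    · rw [pow_zero, mul_one, pow_one]
      -- Input words are of size S or of size Y (the number N), so the product S·Y bounds them all
      -- and fits the array bound.
      refine (MME.getD_input_le hE θ d d' m N f a i (B := (q + m + d) * (d ^ m + N)) ?_ ?_ ?_ ?_ ?_
        ?_).trans (Nat.mul_le_mul_right _ (Nat.le_self_pow (by norm_num) _))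
      all_goals nlinarith
    · exact Nat.zero_le _
  obtain ⟨t, s, hex, ht, hs⟩ := ForLang.Stmt.prog_runs (β := MME.bounds) (top := MME.topLv) (S := σ)
    (w := w) (htop.trans_lt hcells) MME.evaluationS (MME.input hE θ d d' m N f a)
    (fun x hx => by have := hmem x hx; omega)
    (by
      rw [MME.length_input]
      have h1 : N * m ≤ V * V := Nat.mul_le_mul (by omega) (by omega)
      have h2 : V ^ 3 ≤ V ^ 49 := Nat.pow_le_pow_right (by omega) (by norm_num)
      nlinarith)
    MME.evaluationS_ok hBdd hdyn
  refine ⟨t, s, hex, ht.trans ?_, fun i => ?_⟩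
  · have h1 := ForLang.Lv.val_mono (σ := σ) MME.evaluationS_time
    have h2 : ForLang.Lv.val σ ⟨108, 3, 1⟩ = (q + m + d) ^ 108 * (2 ^ m) ^ 3 * (d ^ m + N) ^ 1 := rfl
    have h3 : (2 ^ m) ^ 3 = 8 ^ m := by rw [← pow_mul, mul_comm, pow_mul]; norm_num
    have h4 : 1 ≤ ForLang.Lv.val σ ⟨108, 3, 1⟩ := ForLang.Lv.val_pos
    -- Since q and d are at least 2, three more factors S exceed 64 times nothing smaller than 1,
    -- which covers the 5 set-up steps.
    have h5 : 4 ^ 3 ≤ (q + m + d) ^ 3 := Nat.pow_le_pow_left (by omega) 3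
    calc 5 + (MME.evaluationS.time MME.bounds).val σ ≤ ForLang.Lv.val σ ⟨108, 3, 1⟩ * 4 ^ 3 := by
          omega
      _ ≤ ForLang.Lv.val σ ⟨108, 3, 1⟩ * (q + m + d) ^ 3 := Nat.mul_le_mul_left _ h5
      _ = (d ^ m + N) * 8 ^ m * (q + m + d) ^ 111 := by
          rw [h2, h3, pow_one]
          generalize q + m + d = S
          generalize d ^ m + N = Y
          ring
  · rw [hs i (by have := i.2; omega), hrun i]
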